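/- Let \(n\) be a positive integer, let \(k\) be a nonnegative integer, let \(Y\) be a separable real Banach space with dual \(Y^\ast\), and let \(T\in\mathscr D'(\mathbf R^n,Y)\), that is, \(T\) is a continuous linear map \(\mathscr D(\mathbf R^n,Y)\to\mathbf R\), where \(\mathscr D(\mathbf R^n,Y)\) is the space of smooth compactly supported functions \(\mathbf R^n\to Y\) with its usual locally convex topology. For a polynomial function \(P:\mathbf R^n\to Y^\ast\) let \(S_P(\phi)=\int\langle\phi,P\rangle\,\mathrm d\mathscr L^n\), and for \(a\in\mathbf R^n\), \(r>0\), and \(\phi\in\mathscr D(\mathbf R^n,Y)\) let \(\phi_{a,r}(x)=\phi(r^{-1}(x-a))\). Polynomial functions of degree at most \(-1\) are zero. For a nonnegative integer \(i\), let \(\nu^i(\phi)=\sup\{\|\mathrm D^j\phi(x)\|: 0\le j\le i,\ |x|\le 1\}\), and let \(\mathscr D_{\mathbf B(0,1)}(\mathbf R^n,Y)\) consist of those \(\phi\in\mathscr D(\mathbf R^n,Y)\) with support in the closed unit ball \(\mathbf B(0,1)\). At a point \(a\in\mathbf R^n\), the distribution \(T\) is called * *pointwise differentiable of order \(k\)*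 if there is a polynomial function \(P:\mathbf R^n\to Y^\ast\) of degree at most \(k\) with \(\lim_{r\to0+}r^{-k-n}(T-S_P)(\phi_{a,r})=0\) for every \(\phi\in\mathscr D(\mathbf R^n,Y)\); * *pointwise differentiable of order \((k-1,1)\)* if there is a polynomial function \(P:\mathbf R^n\to Y^\ast\) of degree at most \(k-1\) with \(\limsup_{r\to0+}r^{-k-n}(T-S_P)(\phi_{a,r})<\infty\) for every \(\phi\in\mathscr D(\mathbf R^n,Y)\); * *\(\nu^i\) pointwise differentiable of order \(k\)* if there is a polynomial function \(P:\mathbf R^n\to Y^\ast\) of degree at most \(k\) with \[\lim_{r\to0+}\sup\{r^{-k-n}(T-S_P)(\phi_{a,r}):\phi\in\mathscr D_{\mathbf B(0,1)}(\mathbf R^n,Y),\ \nu^i(\phi)\le1\}=0;\] * *\(\nu^i\) pointwise differentiable of order \((k-1,1)\)* if there is a polynomial function \(P:\mathbf R^n\to Y^\ast\) of degree at most \(k-1\) with \[\limsup_{r\to0+}\sup\{r^{-k-n}(T-S_P)(\phi_{a,r}):\phi\in\mathscr D_{\mathbf B(0,1)}(\mathbf R^n,Y),\ \nu^i(\phi)\le1\}<\infty.\]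 Then the following two statements hold. 1. At \(\mathscr L^n\) almost every point at which \(T\) is pointwise differentiable of order \((k-1,1)\), the distribution \(T\) is pointwise differentiable of order \(k\). 2. For every nonnegative integer \(i\), at \(\mathscr L^n\) almost every point at which \(T\) is \(\nu^i\) pointwise differentiable of order \((k-1,1)\), the distribution \(T\) is pointwise differentiable of order \(k\) and, if \(Y^\ast\) is separable (in its norm topology), \(T\) is also \(\nu^i\) pointwise differentiable of order \(k\). -/

import Mathlib

open MeasureTheory Filter Topology TopologicalSpace
open scoped Distributions

noncomputable section

namespace PointwiseDiff

/-- The space `𝒟(ℝⁿ, Y)` of smooth compactly supported functions with its usual locally convex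
(inductive limit) topology. -/
abbrev TestFun (n : ℕ) (Y : Type*) [NormedAddCommGroup Y] [NormedSpace ℝ Y] : Type _ :=
  𝓓((⊤ : Opens (EuclideanSpace ℝ (Fin n))), Y)

/-- The space `𝒟'(ℝⁿ, Y)` of distributions: continuous linear maps `𝒟(ℝⁿ, Y) → ℝ`. -/
abbrev Distrib (n : ℕ) (Y : Type*) [NormedAddCommGroup Y] [NormedSpace ℝ Y] : Type _ :=
  TestFun n Y →L[ℝ] ℝ

variable {n : ℕ} {Y : Type*} [NormedAddCommGroup Y] [NormedSpace ℝ Y]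

/-- The test function `x ↦ φ (r⁻¹ (x - a))` for `r ≠ 0`. For `r = 0`, where that formula does not
give a test function, it is set to be zero; only `r > 0` is ever used. -/
def rescale (φ : TestFun n Y) (a : EuclideanSpace ℝ (Fin n)) (r : ℝ) : TestFun n Y :=
  if hr : r = 0 then 0 else
    { toFun := fun x => φ (r⁻¹ • (x - a))
      contDiff' := φ.contDiff.comp (by fun_prop)
      hasCompactSupport' := φ.hasCompactSupport.comp_homeomorph
        ((Homeomorph.subRight a).trans (Homeomorph.smulOfNeZero r⁻¹ (inv_ne_zero hr)))
      tsupport_subset' := fun _ _ => trivial }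

/-- `P : ℝⁿ → Z` is a polynomial function of degree at most `k`, that is, a sum of homogeneous
polynomial functions `x ↦ pₘ (x, …, x)` of degrees `0 ≤ m ≤ k`, with `pₘ` an `m`-linear map.
For `k = -1`, this means that `P` is the zero function. -/
def IsPolynomialOfDegreeLE {Z : Type*} [NormedAddCommGroup Z] [NormedSpace ℝ Z] (k : ℤ)
    (P : EuclideanSpace ℝ (Fin n) → Z) : Prop :=
  ∃ p : (m : ℕ) → ContinuousMultilinearMap ℝ (fun _ : Fin m => EuclideanSpace ℝ (Fin n)) Z,
    ∀ x, P x = ∑ m ∈ Finset.range (k + 1).toNat, p m (fun _ => x)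

/-- The distribution `φ ↦ ∫ ⟨φ(x), P(x)⟩ dℒⁿ x` associated with a locally integrable function
`P : ℝⁿ → Y*`. -/
def ofFunction (P : EuclideanSpace ℝ (Fin n) → StrongDual ℝ Y) : Distrib n Y :=
  TestFunction.integralAgainstBilinCLM (ContinuousLinearMap.id ℝ (StrongDual ℝ Y)).flip volume P

theorem IsPolynomialOfDegreeLE.continuous {Z : Type*} [NormedAddCommGroup Z] [NormedSpace ℝ Z]
    {k : ℤ} {P : EuclideanSpace ℝ (Fin n) → Z} (hP : IsPolynomialOfDegreeLE k P) :
    Continuous P := by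
  obtain ⟨p, hp⟩ := hP
  rw [funext hp]
  exact continuous_finsetSum _ fun m _ => (p m).cont.comp (continuous_pi fun _ => continuous_id)

theorem ofFunction_apply {k : ℤ} {P : EuclideanSpace ℝ (Fin n) → StrongDual ℝ Y}
    (hP : IsPolynomialOfDegreeLE k P) (φ : TestFun n Y) :
    ofFunction P φ = ∫ x, P x (φ x) := by
  rw [ofFunction, TestFunction.integralAgainstBilinCLM_eq_integral
    (hP.continuous.locallyIntegrable.locallyIntegrableOn _)]
  rfl

theorem bddAbove_range_norm_iteratedFDeriv (K : Compacts (EuclideanSpace ℝ (Fin n))) (j : ℕ)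
    (φ : TestFun n Y) :
    BddAbove (Set.range fun x : K => ‖iteratedFDeriv ℝ j φ (x : EuclideanSpace ℝ (Fin n))‖) := by
  have h : Continuous fun x => ‖iteratedFDeriv ℝ j φ x‖ :=
    (φ.contDiff.continuous_iteratedFDeriv (by exact_mod_cast le_top)).norm
  obtain ⟨C, hC⟩ := K.isCompact.bddAbove_image h.continuousOn
  exact ⟨C, by rintro _ ⟨x, rfl⟩; exact hC ⟨x, x.2, rfl⟩⟩

/-- The seminorm `φ ↦ sup {‖D^j φ(x)‖ : x ∈ K}` on `𝒟(ℝⁿ, Y)`. -/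
def derivSeminorm (K : Compacts (EuclideanSpace ℝ (Fin n))) (j : ℕ) : Seminorm ℝ (TestFun n Y) :=
  Seminorm.ofSMulLE (fun φ => ⨆ x : K, ‖iteratedFDeriv ℝ j φ (x : EuclideanSpace ℝ (Fin n))‖)
    (by simp)
    (fun φ ψ => by
      refine Real.iSup_le (fun x => ?_) (add_nonneg (Real.iSup_nonneg fun _ => norm_nonneg _)
        (Real.iSup_nonneg fun _ => norm_nonneg _))
      have : ((φ + ψ : TestFun n Y) : EuclideanSpace ℝ (Fin n) → Y) = φ + ψ := rfl
      rw [this, iteratedFDeriv_add_apply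
        (φ.contDiff.contDiffAt.of_le (by exact_mod_cast le_top))
        (ψ.contDiff.contDiffAt.of_le (by exact_mod_cast le_top))]
      exact (norm_add_le _ _).trans (add_le_add
        (le_ciSup (bddAbove_range_norm_iteratedFDeriv K j φ) x)
        (le_ciSup (bddAbove_range_norm_iteratedFDeriv K j ψ) x)))
    (fun c φ => by
      refine Real.iSup_le (fun x => ?_) (mul_nonneg (norm_nonneg _)
        (Real.iSup_nonneg fun _ => norm_nonneg _))
      have : ((c • φ : TestFun n Y) : EuclideanSpace ℝ (Fin n) → Y) = c • φ := rfl
      rw [this, iteratedFDeriv_const_smul_apply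
        (φ.contDiff.contDiffAt.of_le (by exact_mod_cast le_top)), norm_smul]
      exact mul_le_mul_of_nonneg_left
        (le_ciSup (bddAbove_range_norm_iteratedFDeriv K j φ) x) (norm_nonneg _))

/-- The seminorm `ν_K^i(φ) = sup {‖D^j φ(x)‖ : 0 ≤ j ≤ i, x ∈ K}` on `𝒟(ℝⁿ, Y)`. -/
def nu (K : Compacts (EuclideanSpace ℝ (Fin n))) (i : ℕ) : Seminorm ℝ (TestFun n Y) :=
  (Finset.range (i + 1)).sup (derivSeminorm K)

/-- The closed unit ball `B(0,1)` of `ℝⁿ`. -/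
def unitBall (n : ℕ) : Compacts (EuclideanSpace ℝ (Fin n)) :=
  ⟨Metric.closedBall 0 1, isCompact_closedBall 0 1⟩

/-- `T` is pointwise differentiable of order `k` at `a` (`k ≥ -1`). -/
def PtDiffAt (T : Distrib n Y) (k : ℤ) (a : EuclideanSpace ℝ (Fin n)) : Prop :=
  ∃ P : EuclideanSpace ℝ (Fin n) → StrongDual ℝ Y, IsPolynomialOfDegreeLE k P ∧
    ∀ φ : TestFun n Y,
      Tendsto (fun r : ℝ => r ^ (-k - n : ℤ) * (T - ofFunction P) (rescale φ a r))
        (𝓝[>] 0) (𝓝 0)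

/-- `T` is `ν` pointwise differentiable of order `k` at `a`. The suprema are
formed in the extended real numbers. -/
def SeminormPtDiffAt (ν : Seminorm ℝ (TestFun n Y)) (T : Distrib n Y) (k : ℤ)
    (a : EuclideanSpace ℝ (Fin n)) : Prop :=
  ∃ P : EuclideanSpace ℝ (Fin n) → StrongDual ℝ Y, IsPolynomialOfDegreeLE k P ∧
    Tendsto (fun r : ℝ => sSup {s : EReal | ∃ φ : TestFun n Y,
        tsupport φ ⊆ Metric.closedBall (0 : EuclideanSpace ℝ (Fin n)) 1 ∧ ν φ ≤ 1 ∧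
        s = ((r ^ (-k - n : ℤ) * (T - ofFunction P) (rescale φ a r) : ℝ) : EReal)})
      (𝓝[>] 0) (𝓝 0)

/-- `T` is pointwise differentiable of order `(k, α)` at `a` (`0 < α ≤ 1`, `k + α ≥ 0`). The upper
limit is formed in the extended real numbers. -/
def HolderPtDiffAt (T : Distrib n Y) (k : ℤ) (α : ℝ) (a : EuclideanSpace ℝ (Fin n)) : Prop :=
  ∃ P : EuclideanSpace ℝ (Fin n) → StrongDual ℝ Y, IsPolynomialOfDegreeLE k P ∧
    ∀ φ : TestFun n Y,
      limsup (fun r : ℝ =>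
        ((r ^ (-k - α - n : ℝ) * (T - ofFunction P) (rescale φ a r) : ℝ) : EReal)) (𝓝[>] 0) < ⊤

/-- `T` is `ν` pointwise differentiable of order `(k, α)` at `a` (`0 < α ≤ 1`, `k + α ≥ 0`). The
suprema and the upper limit are formed in the extended real numbers. -/
def SeminormHolderPtDiffAt (ν : Seminorm ℝ (TestFun n Y)) (T : Distrib n Y) (k : ℤ) (α : ℝ)
    (a : EuclideanSpace ℝ (Fin n)) : Prop :=
  ∃ P : EuclideanSpace ℝ (Fin n) → StrongDual ℝ Y, IsPolynomialOfDegreeLE k P ∧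
    limsup (fun r : ℝ => sSup {s : EReal | ∃ φ : TestFun n Y,
        tsupport φ ⊆ Metric.closedBall (0 : EuclideanSpace ℝ (Fin n)) 1 ∧ ν φ ≤ 1 ∧
        s = ((r ^ (-k - α - n : ℝ) * (T - ofFunction P) (rescale φ a r) : ℝ) : EReal)})
      (𝓝[>] 0) < ⊤

end PointwiseDiff

end

noncomputable section

namespace PointwiseDiff

open scoped ContDiff

variable {n : ℕ} {Y : Type*} [NormedAddCommGroup Y] [NormedSpace ℝ Y]

/-! At a point `a` the hypothesis is first made quantitative: there are an order `i`, constants `N`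
and `δ`, and a polynomial `P` of degree at most `k - 1` such that `T - P` is bounded by `N r ^ (k +
n)` on test functions supported in `B(a,r)` and of size one at the scale `r`, for all `r < δ`
(`UniformOrderAt`). For the `ν^i` hypothesis this is a reformulation. For the pointwise hypothesis
it is the Banach–Steinhaus theorem in the Fréchet space of test functions supported in a ball
(`UniformOrderAt.of_holderPtDiffAt`). Both statements then follow from
`ae_ptDiffAt_and_strongOrderAt`, which fixes `i`, splits the points into countably many bounded sets
`A` with uniform `N` and `δ`, and proceeds by induction on `k`.

Order zero. Here `P = 0`. Let `ψ` be cut off to the `s`-neighbourhood of `A`. Halving `s` changes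
the value of `T` by at most a multiple of the volume of a shell around `A`, because the difference
splits into pieces of size `s`, each close to a point of `A`. The shells have bounded overlap, so
the values converge to some `F ψ` as `s → 0`. The functional `F` is bounded in `L¹`, and `T - F` on
`B(a,r)` is controlled by the volume of `B(a,2r) \ closure A`, which is `o(r ^ n)` at density points
(`exists_near_limit`). Being bounded in `L¹`, `F` has scalar densities against a dense sequence of
`Y`. At common Lebesgue points these values extend to an element of `Y*` (`ae_exists_weak_density`).
If `Y*` is separable, the density is a locally integrable `Y*`-valued function, and its Lebesgue
points give uniform estimates (`exists_strong_density`).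

Induction step. The partial derivatives `D_j T` satisfy the hypothesis with `k` in place of `k + 1`
and `i + 1` in place of `i`, so they have polynomials `W_j` almost everywhere. The identity `d/dr
(r^(-n) T(φ_{a,r})) = r^(-n) ∑ D_j T((x_j φ)_{a,r})` allows integration in `r`. The polynomial `Q`
for `T` is the one with radial derivative `∑ (x - a)_j W_j` and `Q a = P a`; the `W_j` need not form
a gradient.

This costs one derivative in the seminorm: the result holds for `ν^(i+1)`.
`StrongOrderAt.of_density` recovers `ν^i` at density points of `A`. There a test function at the
scale `r` is cut into pieces of size `η r`, on which `T` is compared with its polynomial at a nearby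
point of `A`. The resulting error is `(N B₁ η ^ k + ε B₂(η)) r ^ (k + n)`, where `ε` comes from the
higher order seminorm; for `k ≥ 1` one chooses `η` first and `ε` afterwards. -/

theorem TestFun.contDiff (φ : TestFun n Y) : ContDiff ℝ ∞ φ := TestFunction.contDiff φ

theorem TestFun.integrable (φ : TestFun n Y) : Integrable φ volume :=
  φ.continuous.integrable_of_hasCompactSupport φ.hasCompactSupport

/-- Smooth functions with support in a compact set, as test functions. -/
def TestFun.ofSupport (f : EuclideanSpace ℝ (Fin n) → Y) (hf : ContDiff ℝ ∞ f)
    (hs : HasCompactSupport f) : TestFun n Y :=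
  ⟨f, hf, hs, fun _ _ => trivial⟩

@[simp] theorem TestFun.ofSupport_apply (f : EuclideanSpace ℝ (Fin n) → Y) (hf : ContDiff ℝ ∞ f)
    (hs : HasCompactSupport f) (x : EuclideanSpace ℝ (Fin n)) : TestFun.ofSupport f hf hs x = f x :=
  rfl

/-- The product of a smooth function and a test function. -/
def TestFun.mulFun (g : EuclideanSpace ℝ (Fin n) → ℝ) (hg : ContDiff ℝ ∞ g) (φ : TestFun n Y) :
    TestFun n Y :=
  TestFun.ofSupport (fun x => g x • φ x) (hg.smul φ.contDiff) φ.hasCompactSupport.smul_left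

@[simp] theorem TestFun.mulFun_apply (g : EuclideanSpace ℝ (Fin n) → ℝ) (hg : ContDiff ℝ ∞ g)
    (φ : TestFun n Y) (x : EuclideanSpace ℝ (Fin n)) : φ.mulFun g hg x = g x • φ x :=
  rfl

/-- The test function `x ↦ g x • y`. -/
def TestFun.tensor (g : TestFun n ℝ) (y : Y) : TestFun n Y :=
  TestFun.ofSupport (fun x => g x • y) (g.contDiff.smul contDiff_const)
    g.hasCompactSupport.smul_right

@[simp] theorem TestFun.tensor_apply (g : TestFun n ℝ) (y : Y) (x : EuclideanSpace ℝ (Fin n)) :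
    g.tensor y x = g x • y :=
  rfl

/-! ### Rescaling of test functions. -/

theorem rescale_apply (φ : TestFun n Y) (a : EuclideanSpace ℝ (Fin n)) {r : ℝ} (hr : r ≠ 0)
    (x : EuclideanSpace ℝ (Fin n)) : rescale φ a r x = φ (r⁻¹ • (x - a)) := by
  simp only [rescale, dif_neg hr]
  rfl

theorem rescale_add (φ ψ : TestFun n Y) (a : EuclideanSpace ℝ (Fin n)) (r : ℝ) :
    rescale (φ + ψ) a r = rescale φ a r + rescale ψ a r := by
  by_cases hr : r = 0
  · simp [rescale, hr]
  · ext x; simp [rescale_apply _ _ hr]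

theorem rescale_smul (c : ℝ) (φ : TestFun n Y) (a : EuclideanSpace ℝ (Fin n)) (r : ℝ) :
    rescale (c • φ) a r = c • rescale φ a r := by
  by_cases hr : r = 0
  · simp [rescale, hr]
  · ext x; simp [rescale_apply _ _ hr]

theorem rescale_neg (φ : TestFun n Y) (a : EuclideanSpace ℝ (Fin n)) (r : ℝ) :
    rescale (-φ) a r = -rescale φ a r := by
  have := rescale_smul (-1) φ a r
  simpa using this

theorem rescale_sub (φ ψ : TestFun n Y) (a : EuclideanSpace ℝ (Fin n)) (r : ℝ) :
    rescale (φ - ψ) a r = rescale φ a r - rescale ψ a r := by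
  rw [sub_eq_add_neg, rescale_add, rescale_neg, sub_eq_add_neg]

theorem rescale_rescale_zero (φ : TestFun n Y) (a : EuclideanSpace ℝ (Fin n)) {r s : ℝ}
    (hr : r ≠ 0) (hs : s ≠ 0) : rescale (rescale φ 0 s) a r = rescale φ a (s * r) := by
  ext x
  rw [rescale_apply _ _ hr, rescale_apply _ _ hs, rescale_apply _ _ (mul_ne_zero hs hr), sub_zero,
    smul_smul, mul_inv]

/-- The inverse of `rescale`. -/
def unscale (ψ : TestFun n Y) (a : EuclideanSpace ℝ (Fin n)) (r : ℝ) : TestFun n Y :=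
  rescale ψ (-(r⁻¹ • a)) r⁻¹

theorem unscale_apply (ψ : TestFun n Y) (a : EuclideanSpace ℝ (Fin n)) {r : ℝ} (hr : r ≠ 0)
    (x : EuclideanSpace ℝ (Fin n)) : unscale ψ a r x = ψ (r • x + a) := by
  rw [unscale, rescale_apply _ _ (inv_ne_zero hr), inv_inv, sub_neg_eq_add, smul_add, smul_smul,
    mul_inv_cancel₀ hr, one_smul]

theorem rescale_unscale (ψ : TestFun n Y) (a : EuclideanSpace ℝ (Fin n)) {r : ℝ} (hr : r ≠ 0) :
    rescale (unscale ψ a r) a r = ψ := by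
  ext x
  rw [rescale_apply _ _ hr, unscale_apply _ _ hr, smul_smul, mul_inv_cancel₀ hr, one_smul,
    sub_add_cancel]

theorem norm_iteratedFDeriv_rescale (φ : TestFun n Y) (a : EuclideanSpace ℝ (Fin n)) {r : ℝ}
    (hr : 0 < r) (m : ℕ) (x : EuclideanSpace ℝ (Fin n)) :
    r ^ m * ‖iteratedFDeriv ℝ m (rescale φ a r) x‖ = ‖iteratedFDeriv ℝ m φ (r⁻¹ • (x - a))‖ := by
  have h : (rescale φ a r : EuclideanSpace ℝ (Fin n) → Y) = fun x => φ (r⁻¹ • (x - a)) :=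
    funext (rescale_apply φ a hr.ne')
  rw [h, iteratedFDeriv_comp_sub (f := fun x => φ (r⁻¹ • x)),
    iteratedFDeriv_comp_const_smul _ (φ.contDiff.of_le (by exact_mod_cast le_top)), norm_smul,
    norm_pow, norm_inv, Real.norm_of_nonneg hr.le, ← mul_assoc, ← mul_pow, mul_inv_cancel₀ hr.ne',
    one_pow, one_mul]

theorem support_rescale {φ : TestFun n Y} {R : ℝ}
    (hφ : Function.support φ ⊆ Metric.closedBall 0 R) (a : EuclideanSpace ℝ (Fin n)) {r : ℝ}
    (hr : 0 < r) : Function.support (rescale φ a r) ⊆ Metric.closedBall a (R * r) := by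
  intro x hx
  have h1 := hφ (show r⁻¹ • (x - a) ∈ Function.support φ by
    simpa [rescale_apply _ _ hr.ne'] using hx)
  rw [mem_closedBall_zero_iff, norm_smul, norm_inv, Real.norm_of_nonneg hr.le] at h1
  rw [Metric.mem_closedBall, dist_eq_norm]
  calc ‖x - a‖ = r⁻¹ * ‖x - a‖ * r := by field_simp
    _ ≤ R * r := by gcongr

theorem TestFun.exists_support_subset (φ : TestFun n Y) :
    ∃ R : ℝ, 0 < R ∧ Function.support φ ⊆ Metric.closedBall 0 R := by
  obtain ⟨R, hR, h⟩ := φ.hasCompactSupport.isBounded.subset_closedBall_lt 0 0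
  exact ⟨R, hR, (subset_tsupport _).trans h⟩

/-! ### Supports and derivative bounds at a given scale. -/

theorem tsupport_subset_closedBall_iff {Z : Type*} [NormedAddCommGroup Z]
    {f : EuclideanSpace ℝ (Fin n) → Z}
    {a : EuclideanSpace ℝ (Fin n)} {r : ℝ} :
    tsupport f ⊆ Metric.closedBall a r ↔ Function.support f ⊆ Metric.closedBall a r :=
  Metric.isClosed_closedBall.closure_subset_iff

/-- `r ^ m ‖Dᵐ f‖ ≤ M` for `m ≤ i`: the function `f` is of size `M` at the scale `r`. -/
def DerivLE (i : ℕ) (r M : ℝ) (f : EuclideanSpace ℝ (Fin n) → Y) : Prop :=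
  ∀ m ≤ i, ∀ x, r ^ m * ‖iteratedFDeriv ℝ m f x‖ ≤ M

theorem DerivLE.norm_le {i : ℕ} {r M : ℝ} {f : EuclideanSpace ℝ (Fin n) → Y}
    (h : DerivLE i r M f) (x : EuclideanSpace ℝ (Fin n)) : ‖f x‖ ≤ M := by
  simpa using h 0 (Nat.zero_le _) x

theorem DerivLE.nonneg {i : ℕ} {r M : ℝ} {f : EuclideanSpace ℝ (Fin n) → Y}
    (h : DerivLE i r M f) : 0 ≤ M :=
  (norm_nonneg _).trans (h.norm_le 0)

theorem DerivLE.mono {i : ℕ} {r s M : ℝ} {f : EuclideanSpace ℝ (Fin n) → Y} (hs : 0 ≤ s)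
    (hsr : s ≤ r) (h : DerivLE i r M f) : DerivLE i s M f := fun m hm x =>
  (mul_le_mul_of_nonneg_right (pow_le_pow_left₀ hs hsr m) (norm_nonneg _)).trans (h m hm x)

/-- Passing to a larger scale costs at most one factor `c` per derivative. -/
theorem DerivLE.scale {i : ℕ} {r c M : ℝ} {f : EuclideanSpace ℝ (Fin n) → Y}
    (hc : 1 ≤ c) (h : DerivLE i r M f) : DerivLE i (c * r) (c ^ i * M) f := fun m hm x => by
  have h1 := h m hm x
  have h2 : c ^ m ≤ c ^ i := pow_le_pow_right₀ hc hm
  have h3 : 0 ≤ c ^ m := by positivity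
  calc (c * r) ^ m * ‖iteratedFDeriv ℝ m f x‖ = c ^ m * (r ^ m * ‖iteratedFDeriv ℝ m f x‖) := by
        rw [mul_pow, mul_assoc]
    _ ≤ c ^ m * M := by gcongr
    _ ≤ c ^ i * M := mul_le_mul_of_nonneg_right h2 h.nonneg

theorem DerivLE.add {i : ℕ} {r M M' : ℝ} {f g : EuclideanSpace ℝ (Fin n) → Y} (hr : 0 ≤ r)
    (hf : ContDiff ℝ ∞ f) (hg : ContDiff ℝ ∞ g) (h : DerivLE i r M f) (h' : DerivLE i r M' g) :
    DerivLE i r (M + M') (f + g) := fun m hm x => by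
  rw [iteratedFDeriv_add_apply (hf.contDiffAt.of_le (by exact_mod_cast le_top))
    (hg.contDiffAt.of_le (by exact_mod_cast le_top))]
  calc _ ≤ r ^ m * (‖iteratedFDeriv ℝ m f x‖ + ‖iteratedFDeriv ℝ m g x‖) := by
        gcongr; exact norm_add_le _ _
    _ ≤ _ := by rw [mul_add]; exact add_le_add (h m hm x) (h' m hm x)

theorem DerivLE.const_smul {i : ℕ} {r M : ℝ} {f : EuclideanSpace ℝ (Fin n) → Y} (c : ℝ)
    (hf : ContDiff ℝ ∞ f) (h : DerivLE i r M f) :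
    DerivLE i r (|c| * M) (c • f) := fun m hm x => by
  rw [iteratedFDeriv_const_smul_apply (hf.contDiffAt.of_le (by exact_mod_cast le_top)),
    norm_smul, Real.norm_eq_abs, mul_left_comm]
  exact mul_le_mul_of_nonneg_left (h m hm x) (abs_nonneg _)

theorem DerivLE.of_le {i j : ℕ} {r M : ℝ} {f : EuclideanSpace ℝ (Fin n) → Y} (hij : i ≤ j)
    (h : DerivLE j r M f) : DerivLE i r M f := fun m hm x => h m (hm.trans hij) x

theorem derivLE_rescale_iff {i : ℕ} {r M : ℝ} (hr : 0 < r) {φ : TestFun n Y}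
    {a : EuclideanSpace ℝ (Fin n)} : DerivLE i r M (rescale φ a r) ↔ DerivLE i 1 M φ := by
  constructor
  · intro h m hm x
    have := h m hm (r • x + a)
    rw [norm_iteratedFDeriv_rescale _ _ hr, add_sub_cancel_right, smul_smul,
      inv_mul_cancel₀ hr.ne', one_smul] at this
    simpa using this
  · intro h m hm x
    rw [norm_iteratedFDeriv_rescale _ _ hr]
    simpa using h m hm (r⁻¹ • (x - a))

theorem TestFun.exists_derivLE (φ : TestFun n Y) (i : ℕ) (r : ℝ) (hr : 0 ≤ r) :
    ∃ M, 0 < M ∧ DerivLE i r M φ := by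
  have h : ∀ m : ℕ, ∃ M, 0 ≤ M ∧ ∀ x, r ^ m * ‖iteratedFDeriv ℝ m φ x‖ ≤ M := fun m => by
    have h1 : Continuous (iteratedFDeriv ℝ m φ) :=
      φ.contDiff.continuous_iteratedFDeriv (by exact_mod_cast le_top)
    obtain ⟨C, hC⟩ := h1.bounded_above_of_compact_support (φ.hasCompactSupport.iteratedFDeriv m)
    refine ⟨r ^ m * C, mul_nonneg (by positivity) ((norm_nonneg _).trans (hC 0)), fun x => ?_⟩
    gcongr
    exact hC x
  choose M hM hM' using h
  refine ⟨∑ m ∈ Finset.range (i + 1), M m + 1,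
    add_pos_of_nonneg_of_pos (Finset.sum_nonneg fun m _ => hM m) one_pos, fun m hm x => ?_⟩
  have := Finset.single_le_sum (f := M) (fun m _ => hM m)
    (Finset.mem_range.2 (Nat.lt_succ_of_le hm))
  linarith [hM' m x]

/-- The seminorm sees only the unit ball, but outside it all derivatives vanish by the support
condition. -/
theorem nu_unitBall_le_one_iff {i : ℕ} {φ : TestFun n Y}
    (hφ : Function.support φ ⊆ Metric.closedBall 0 1) :
    nu (unitBall n) i φ ≤ 1 ↔ DerivLE i 1 1 φ := by
  have hle : nu (unitBall n) i φ ≤ 1 ↔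
      ∀ m ∈ Finset.range (i + 1), derivSeminorm (unitBall n) m φ ≤ 1 :=
    ⟨fun h m hm => (Seminorm.le_def.1 (Finset.le_sup hm) φ).trans h,
      fun h => Seminorm.finset_sup_apply_le zero_le_one h⟩
  rw [hle]
  constructor
  · intro h m hm x
    rw [one_pow, one_mul]
    by_cases hx : x ∈ Metric.closedBall (0 : EuclideanSpace ℝ (Fin n)) 1
    · exact (le_ciSup (bddAbove_range_norm_iteratedFDeriv (unitBall n) m φ) ⟨x, hx⟩).trans
        (h m (Finset.mem_range.2 (Nat.lt_succ_of_le hm)))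
    · have : iteratedFDeriv ℝ m φ x = 0 := by
        by_contra h0
        exact hx (tsupport_subset_closedBall_iff.2 hφ (support_iteratedFDeriv_subset m h0))
      simp [this]
  · intro h m hm
    refine Real.iSup_le (fun x => ?_) zero_le_one
    simpa using h m (Nat.lt_succ_iff.1 (Finset.mem_range.1 hm)) x

/-- `T` is bounded by `c` on test functions supported in the ball `B(a,r)` of size `1` at the
scale `r`, for derivatives up to order `i`. -/
def BoundAt (i : ℕ) (T : Distrib n Y) (a : EuclideanSpace ℝ (Fin n)) (r c : ℝ) : Prop :=
  ∀ (ψ : TestFun n Y) (M : ℝ), Function.support ψ ⊆ Metric.closedBall a r → DerivLE i r M ψ →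
    |T ψ| ≤ c * M

theorem BoundAt.mono {i : ℕ} {T : Distrib n Y} {a : EuclideanSpace ℝ (Fin n)} {r c c' : ℝ}
    (h : BoundAt i T a r c) (hc : c ≤ c') : BoundAt i T a r c' := fun ψ M hψ hM =>
  (h ψ M hψ hM).trans (mul_le_mul_of_nonneg_right hc hM.nonneg)

theorem BoundAt.rescale {i : ℕ} {T : Distrib n Y} {a : EuclideanSpace ℝ (Fin n)} {r c : ℝ}
    (hr : 0 < r) (h : BoundAt i T a r c) {φ : TestFun n Y} {M : ℝ}
    (hφ : Function.support φ ⊆ Metric.closedBall 0 1) (hM : DerivLE i 1 M φ) :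
    |T (rescale φ a r)| ≤ c * M :=
  h _ _ (by simpa using support_rescale hφ a hr) ((derivLE_rescale_iff hr).2 hM)

/-- Links the one-sided supremum at unit scale in the definitions with the homogeneous two-sided
bound used below. Since `-φ` is admissible together with `φ`, the one-sided bound controls absolute
values. -/
theorem boundAt_iff {i : ℕ} {T : Distrib n Y} {a : EuclideanSpace ℝ (Fin n)} {r c : ℝ}
    (hr : 0 < r) : BoundAt i T a r c ↔ ∀ φ : TestFun n Y,
      tsupport φ ⊆ Metric.closedBall (0 : EuclideanSpace ℝ (Fin n)) 1 →
      nu (unitBall n) i φ ≤ 1 → T (PointwiseDiff.rescale φ a r) ≤ c := by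
  simp only [tsupport_subset_closedBall_iff]
  constructor
  · intro h φ hφ hν
    rw [nu_unitBall_le_one_iff hφ] at hν
    simpa using (le_abs_self _).trans (h.rescale hr hφ hν)
  · intro h ψ M hψ hM
    -- Normalisation divides by the size, which may be zero. A larger positive `M'` is used instead
    -- and tends to `M` at the end.
    have key : ∀ M' : ℝ, 0 < M' → M ≤ M' → |T ψ| ≤ c * M' := by
      intro M' hM' hMM'
      set φ := M'⁻¹ • unscale ψ a r with hφdef
      have hs : Function.support φ ⊆ Metric.closedBall 0 1 := by
        intro x hx
        have h1 : ψ (r • x + a) ≠ 0 := by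
          intro h0
          apply hx
          simp [hφdef, unscale_apply _ _ hr.ne', h0]
        have h2 := hψ h1
        rw [Metric.mem_closedBall, dist_eq_norm, add_sub_cancel_right, norm_smul,
          Real.norm_of_nonneg hr.le] at h2
        rw [mem_closedBall_zero_iff]
        by_contra hcon
        nlinarith [mul_lt_mul_of_pos_left (not_le.1 hcon) hr]
      have hφ2 : PointwiseDiff.rescale φ a r = M'⁻¹ • ψ := by
        rw [hφdef, rescale_smul, rescale_unscale _ _ hr.ne']
      have hd : DerivLE i 1 1 φ := by
        rw [← derivLE_rescale_iff hr (a := a), hφ2]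
        have := (hM.const_smul M'⁻¹ ψ.contDiff)
        intro m hm x
        refine (this m hm x).trans ?_
        rw [abs_of_pos (inv_pos.2 hM'), inv_mul_le_iff₀ hM']
        simpa using hMM'
      have h1 := h φ hs ((nu_unitBall_le_one_iff hs).2 hd)
      have h2 := h (-φ) (by simpa using hs)
        (by rw [map_neg_eq_map]; exact (nu_unitBall_le_one_iff hs).2 hd)
      rw [rescale_neg, map_neg] at h2
      rw [hφ2, map_smul, smul_eq_mul, inv_mul_le_iff₀ hM'] at h1
      rw [hφ2, map_smul, smul_eq_mul, ← mul_neg, inv_mul_le_iff₀ hM'] at h2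
      rw [abs_le]
      constructor <;> linarith
    have hc : Tendsto (fun ε : ℝ => c * (M + ε)) (𝓝[>] 0) (𝓝 (c * (M + 0))) :=
      ((tendsto_const_nhds.add tendsto_id).const_mul c).mono_left nhdsWithin_le_nhds
    rw [add_zero] at hc
    refine ge_of_tendsto hc ?_
    filter_upwards [self_mem_nhdsWithin] with ε hε
    have : 0 < ε := hε
    exact key _ (by linarith [hM.nonneg]) (by linarith)

section

/-! ### The Fréchet space of test functions in a compact set; uniform boundedness. -/

section Frechet

variable {K : Compacts (EuclideanSpace ℝ (Fin n))}

theorem tendsto_contDiffMapSupportedIn_iff {ι : Type*} {l : Filter ι}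
    {u : ι → 𝓓_{K}(EuclideanSpace ℝ (Fin n), Y)} {f : 𝓓_{K}(EuclideanSpace ℝ (Fin n), Y)} :
    Tendsto u l (𝓝 f) ↔ ∀ i : ℕ, Tendsto (fun j => ContDiffMapSupportedIn.structureMapCLM ℝ ⊤ i (u j))
      l (𝓝 (ContDiffMapSupportedIn.structureMapCLM ℝ ⊤ i f)) := by
  rw [(ContDiffMapSupportedIn.isUniformEmbedding_pi_structureMapCLM ℝ).isInducing.tendsto_nhds_iff,
    tendsto_pi_nhds]
  rfl

/-- The limits `g m` form a Taylor series, because uniform convergence of derivatives permits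
differentiation of the limit. This is the core of completeness. -/
theorem contDiff_of_tendstoUniformly_iteratedFDeriv {u : ℕ → EuclideanSpace ℝ (Fin n) → Y}
    (hu : ∀ j, ContDiff ℝ ∞ (u j))
    {g : (m : ℕ) → EuclideanSpace ℝ (Fin n) → EuclideanSpace ℝ (Fin n) [×m]→L[ℝ] Y}
    (hg : ∀ m, TendstoUniformly (fun j => iteratedFDeriv ℝ m (u j)) (g m) atTop) :
    ContDiff ℝ ∞ (fun x => (g 0 x).curry0) ∧
      ∀ m x, iteratedFDeriv ℝ m (fun x => (g 0 x).curry0) x = g m x := by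
  have hd : ∀ m x, HasFDerivAt (g m) (g (m + 1) x).curryLeft x := by
    intro m x
    refine hasFDerivAt_of_tendstoUniformly (l := atTop)
      (f := fun j => iteratedFDeriv ℝ m (u j))
      (f' := fun j x => (iteratedFDeriv ℝ (m + 1) (u j) x).curryLeft)
      (g' := fun x => (g (m + 1) x).curryLeft) ?_ ?_
      (fun x => (hg m).tendsto_at x) x
    · exact (continuousMultilinearCurryLeftEquiv ℝ (fun _ : Fin (m + 1) => EuclideanSpace ℝ (Fin n))
        Y).isometry.uniformContinuous.comp_tendstoUniformly (hg (m + 1))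
    · intro j x
      have h2 : Differentiable ℝ (iteratedFDeriv ℝ m (u j)) :=
        (hu j).differentiable_iteratedFDeriv (by exact_mod_cast WithTop.coe_lt_top m)
      exact (h2 x).hasFDerivAt
  have htay : HasFTaylorSeriesUpTo ∞ (fun x => (g 0 x).curry0) (fun x m => g m x) :=
    ⟨fun x => rfl, fun m _ x => hd m x,
      fun m _ => continuous_iff_continuousAt.2 fun x => (hd m x).continuousAt⟩
  exact ⟨htay.contDiff, fun m x => (htay.eq_iteratedFDeriv (by exact_mod_cast le_top) x).symm⟩

theorem uniformity_contDiffMapSupportedIn_isCountablyGenerated :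
    (uniformity 𝓓_{K}(EuclideanSpace ℝ (Fin n), Y)).IsCountablyGenerated := by
  have := (ContDiffMapSupportedIn.withSeminorms ℝ
    (EuclideanSpace ℝ (Fin n)) Y ⊤ K).firstCountableTopology
  exact IsUniformAddGroup.uniformity_countably_generated

theorem uniformContinuous_structureMapCLM (i : ℕ) :
    UniformContinuous (ContDiffMapSupportedIn.structureMapCLM ℝ ⊤ i :
      𝓓_{K}(EuclideanSpace ℝ (Fin n), Y) → _) := by
  have h := (ContDiffMapSupportedIn.isUniformEmbedding_pi_structureMapCLM ℝ
    (E := EuclideanSpace ℝ (Fin n)) (F := Y) (K := K) (n := ⊤)).uniformContinuous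
  exact uniformContinuous_pi.1 h i

/-- Completeness, with the countably generated uniformity, makes the Baire category argument behind
Banach–Steinhaus available. -/
theorem completeSpace_contDiffMapSupportedIn [CompleteSpace Y] :
    CompleteSpace 𝓓_{K}(EuclideanSpace ℝ (Fin n), Y) := by
  have hcg := uniformity_contDiffMapSupportedIn_isCountablyGenerated (K := K) (Y := Y)
  refine UniformSpace.complete_of_cauchySeq_tendsto fun u hu => ?_
  have hlim : ∀ i : ℕ, ∃ g, Tendsto (fun j => ContDiffMapSupportedIn.structureMapCLM ℝ ⊤ i (u j))
      atTop (𝓝 g) := fun i =>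
    cauchySeq_tendsto_of_complete
      (hu.map (uniformContinuous_structureMapCLM i))
  let g := fun i => Classical.choose (hlim i)
  have hg : ∀ i, Tendsto (fun j => ContDiffMapSupportedIn.structureMapCLM ℝ ⊤ i (u j))
      atTop (𝓝 (g i)) := fun i => Classical.choose_spec (hlim i)
  have hu' : ∀ i j, (ContDiffMapSupportedIn.structureMapCLM ℝ ⊤ i (u j) :
      EuclideanSpace ℝ (Fin n) → _) = iteratedFDeriv ℝ i (u j) := fun i j =>
    ContDiffMapSupportedIn.structureMapCLM_top_apply ℝ (u j)
  have hunif : ∀ i, TendstoUniformly (fun j => iteratedFDeriv ℝ i (u j)) (g i) atTop := by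
    intro i
    have := BoundedContinuousFunction.tendsto_iff_tendstoUniformly.1 (hg i)
    simpa only [hu'] using this
  obtain ⟨hsm, hder⟩ := contDiff_of_tendstoUniformly_iteratedFDeriv
    (fun j => (u j).contDiff) hunif
  have hzero : Set.EqOn (fun x => (g 0 x).curry0) 0 (K : Set (EuclideanSpace ℝ (Fin n)))ᶜ := by
    intro x hx
    have h1 : g 0 x = 0 := by
      refine tendsto_nhds_unique ((hunif 0).tendsto_at x) ?_
      simp only [(u _).iteratedFDeriv_zero_on_compl hx]
      exact tendsto_const_nhds
    simp [h1]
  refine ⟨⟨_, hsm, hzero⟩, ?_⟩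
  rw [tendsto_contDiffMapSupportedIn_iff]
  intro i
  convert hg i
  ext1 x
  rw [ContDiffMapSupportedIn.structureMapCLM_top_apply]
  exact hder i x

theorem exists_le_of_continuous_seminorm
    {q : Seminorm ℝ 𝓓_{K}(EuclideanSpace ℝ (Fin n), Y)} (hq : Continuous q) :
    ∃ (i : ℕ) (C : ℝ), 0 ≤ C ∧ ∀ (f : 𝓓_{K}(EuclideanSpace ℝ (Fin n), Y)) (M : ℝ),
      DerivLE i 1 M f → q f ≤ C * M := by
  obtain ⟨s, C, -, h⟩ := Seminorm.bound_of_continuous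
    (ContDiffMapSupportedIn.withSeminorms ℝ (EuclideanSpace ℝ (Fin n)) Y ⊤ K) q hq
  refine ⟨s.sup id, C, C.2, fun f M hM => ?_⟩
  refine (h f).trans ?_
  rw [_root_.smul_apply, NNReal.smul_def, smul_eq_mul]
  refine mul_le_mul_of_nonneg_left ?_ C.2
  refine Seminorm.finset_sup_apply_le hM.nonneg fun m hm => ?_
  rw [ContDiffMapSupportedIn.seminorm_top_le_iff ℝ hM.nonneg]
  intro x _
  simpa using hM m (Finset.le_sup (f := id) hm) x

/-- Distributions have locally finite order. -/
theorem Distrib.exists_order (T : Distrib n Y) (R : ℝ) :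
    ∃ (i : ℕ) (C : ℝ), 0 ≤ C ∧ ∀ (ψ : TestFun n Y) (M : ℝ),
      Function.support ψ ⊆ Metric.closedBall 0 R → DerivLE i 1 M ψ → |T ψ| ≤ C * M := by
  let K : Compacts (EuclideanSpace ℝ (Fin n)) := ⟨Metric.closedBall 0 R, isCompact_closedBall 0 R⟩
  let T' := T ∘L TestFunction.ofSupportedInCLM ℝ (K := K) (Ω := ⊤) (n := ⊤) (F := Y)
    (fun _ _ => trivial)
  obtain ⟨i, C, hC, h⟩ := exists_le_of_continuous_seminorm
    (q := (normSeminorm ℝ ℝ).comp T'.toLinearMap) (continuous_norm.comp T'.continuous)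
  refine ⟨i, C, hC, fun ψ M hψ hM => ?_⟩
  exact h (ContDiffMapSupportedIn.of_support_subset (K := K) ψ.contDiff hψ) M hM

/-- The uniform boundedness principle for sequences of functionals on test functions supported in
a fixed ball. -/
theorem Distrib.uniform_bounded [CompleteSpace Y] (F : ℕ → Distrib n Y) (R : ℝ)
    (hF : ∀ ψ : TestFun n Y, Function.support ψ ⊆ Metric.closedBall 0 R →
      ∃ C, ∀ j, |F j ψ| ≤ C) :
    ∃ (i : ℕ) (C : ℝ), 0 ≤ C ∧ ∀ (j : ℕ) (ψ : TestFun n Y) (M : ℝ),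
      Function.support ψ ⊆ Metric.closedBall 0 R → DerivLE i 1 M ψ → |F j ψ| ≤ C * M := by
  let K : Compacts (EuclideanSpace ℝ (Fin n)) := ⟨Metric.closedBall 0 R, isCompact_closedBall 0 R⟩
  let F' : ℕ → 𝓓_{K}(EuclideanSpace ℝ (Fin n), Y) →L[ℝ] ℝ := fun j =>
    F j ∘L TestFunction.ofSupportedInCLM ℝ (K := K) (Ω := ⊤) (n := ⊤) (F := Y)
      (fun _ _ => trivial)
  have hcg := uniformity_contDiffMapSupportedIn_isCountablyGenerated (K := K) (Y := Y)
  have hcs := completeSpace_contDiffMapSupportedIn (K := K) (Y := Y)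
  have hbs := (norm_withSeminorms ℝ ℝ).banach_steinhaus (𝓕 := F') (fun _ ψ => by
    obtain ⟨C, hC⟩ := hF (TestFunction.ofSupportedIn (Ω := ⊤) (fun _ _ => trivial) ψ)
      ψ.support_subset
    exact ⟨C, by rintro _ ⟨j, rfl⟩; exact hC j⟩)
  -- Equicontinuity means that `sup_j |F j ·|` is a continuous seminorm, hence dominated by finitely
  -- many derivatives.
  obtain ⟨hb, hc⟩ := ((norm_withSeminorms ℝ ℝ).uniformEquicontinuous_iff_bddAbove_and_continuous_iSup
    (fun j => (F' j).toLinearMap)).1 hbs 0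
  have hc' : Continuous (⨆ j, (normSeminorm ℝ ℝ).comp (F' j).toLinearMap :
    Seminorm ℝ 𝓓_{K}(EuclideanSpace ℝ (Fin n), Y)) := by
    rw [Seminorm.coe_iSup_eq hb]; exact hc
  obtain ⟨i, C, hC, h⟩ := exists_le_of_continuous_seminorm hc'
  refine ⟨i, C, hC, fun j ψ M hψ hM => ?_⟩
  refine le_trans ?_ (h (ContDiffMapSupportedIn.of_support_subset (K := K) ψ.contDiff hψ) M hM)
  exact Seminorm.le_def.1 (le_ciSup hb j)
    (ContDiffMapSupportedIn.of_support_subset (K := K) ψ.contDiff hψ)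

end Frechet

end

/-! ### Quantitative forms of the differentiability notions. -/

/-- `T - P` is bounded by `N r ^ (k + n)` on balls of radius `r < δ` about `a`. -/
def UniformOrderAt (i : ℕ) (T : Distrib n Y) (k : ℕ) (N δ : ℝ) (a : EuclideanSpace ℝ (Fin n)) :
    Prop :=
  ∃ P : EuclideanSpace ℝ (Fin n) → StrongDual ℝ Y, IsPolynomialOfDegreeLE ((k : ℤ) - 1) P ∧
    ∀ r, 0 < r → r < δ → BoundAt i (T - ofFunction P) a r (N * r ^ (k + n))

/-- `T - P` is `o(r ^ (k + n))` on balls of radius `r` about `a`. -/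
def StrongOrderAt (i : ℕ) (T : Distrib n Y) (k : ℕ) (a : EuclideanSpace ℝ (Fin n)) : Prop :=
  ∃ P : EuclideanSpace ℝ (Fin n) → StrongDual ℝ Y, IsPolynomialOfDegreeLE (k : ℤ) P ∧
    ∀ ε, 0 < ε → ∃ δ, 0 < δ ∧ ∀ r, 0 < r → r < δ →
      BoundAt i (T - ofFunction P) a r (ε * r ^ (k + n))

theorem UniformOrderAt.mono {i : ℕ} {T : Distrib n Y} {k : ℕ} {N N' δ δ' : ℝ}
    {a : EuclideanSpace ℝ (Fin n)} (h : UniformOrderAt i T k N δ a) (hN : N ≤ N') (hδ : δ' ≤ δ) :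
    UniformOrderAt i T k N' δ' a := by
  obtain ⟨P, hP, h⟩ := h
  exact ⟨P, hP, fun r hr hrδ => (h r hr (hrδ.trans_le hδ)).mono (by gcongr)⟩

theorem zpow_neg_order (k : ℕ) (r : ℝ) :
    r ^ (-(k : ℤ) - n : ℤ) = (r ^ (k + n))⁻¹ := by
  rw [← zpow_natCast, ← zpow_neg]
  congr 1
  push_cast
  ring

theorem rpow_neg_order (k : ℕ) (r : ℝ) :
    r ^ (-(((k : ℤ) - 1 : ℤ) : ℝ) - 1 - n : ℝ) = (r ^ (k + n))⁻¹ := by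
  rw [← zpow_neg_order, ← Real.rpow_intCast]
  congr 1
  push_cast
  ring

theorem UniformOrderAt.of_seminormHolderPtDiffAt {i : ℕ} {T : Distrib n Y} {k : ℕ}
    {a : EuclideanSpace ℝ (Fin n)}
    (h : SeminormHolderPtDiffAt (nu (unitBall n) i) T ((k : ℤ) - 1) 1 a) :
    ∃ N δ : ℝ, 0 < δ ∧ UniformOrderAt i T k N δ a := by
  obtain ⟨P, hP, hlim⟩ := h
  obtain ⟨N, hN, -⟩ := EReal.lt_iff_exists_real_btwn.1 hlim
  have hev := eventually_lt_of_limsup_lt hN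
  obtain ⟨δ, hδ, hev⟩ := mem_nhdsGT_iff_exists_Ioo_subset.1 hev
  refine ⟨N, δ, hδ, P, hP, fun r hr hrδ => (boundAt_iff hr).2 fun φ hφ hν => ?_⟩
  have h1 : ((r ^ (-(((k : ℤ) - 1 : ℤ) : ℝ) - 1 - n : ℝ) *
      (T - ofFunction P) (rescale φ a r) : ℝ) : EReal) < N :=
    lt_of_le_of_lt (le_sSup (by exact ⟨φ, hφ, hν, rfl⟩)) (hev ⟨hr, hrδ⟩)
  rw [EReal.coe_lt_coe_iff, rpow_neg_order k r, inv_mul_lt_iff₀ (by positivity)] at h1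
  linarith

theorem StrongOrderAt.seminormPtDiffAt {i : ℕ} {T : Distrib n Y} {k : ℕ}
    {a : EuclideanSpace ℝ (Fin n)} (h : StrongOrderAt i T k a) :
    SeminormPtDiffAt (nu (unitBall n) i) T k a := by
  obtain ⟨P, hP, h⟩ := h
  refine ⟨P, hP, tendsto_order.2 ⟨fun b hb => ?_, fun b hb => ?_⟩⟩
  -- The zero test function is admissible, so the supremum is never negative.
  · refine Eventually.of_forall fun r => hb.trans_le (le_sSup ⟨0, ?_, ?_, ?_⟩)
    · simp
    · simp
    · have := rescale_smul (0 : ℝ) (0 : TestFun n Y) a r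
      simp only [zero_smul] at this
      simp [this]
  · obtain ⟨ε, hε, hεb⟩ := EReal.lt_iff_exists_real_btwn.1 hb
    have hε' : 0 < ε := by exact_mod_cast hε
    obtain ⟨δ, hδ, h⟩ := h ε hε'
    filter_upwards [Ioo_mem_nhdsGT hδ] with r hr
    refine (sSup_le ?_).trans_lt hεb
    rintro _ ⟨φ, hφ, hν, rfl⟩
    rw [EReal.coe_le_coe_iff, zpow_neg_order, inv_mul_le_iff₀ (pow_pos hr.1 _), mul_comm]
    exact (boundAt_iff hr.1).1 (h r hr.1 hr.2) φ hφ hν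

theorem ptDiffAt_of_forall {T : Distrib n Y} {k : ℕ} {a : EuclideanSpace ℝ (Fin n)}
    {P : EuclideanSpace ℝ (Fin n) → StrongDual ℝ Y} (hP : IsPolynomialOfDegreeLE (k : ℤ) P)
    (h : ∀ φ : TestFun n Y, ∀ ε, 0 < ε → ∃ δ, 0 < δ ∧ ∀ r, 0 < r → r < δ →
      |(T - ofFunction P) (rescale φ a r)| ≤ ε * r ^ (k + n)) : PtDiffAt T k a := by
  refine ⟨P, hP, fun φ => ?_⟩
  rw [Metric.tendsto_nhds]
  intro ε hε
  obtain ⟨δ, hδ, h⟩ := h φ (ε / 2) (half_pos hε)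
  filter_upwards [Ioo_mem_nhdsGT hδ] with r hr
  have h1 := h r hr.1 hr.2
  have h2 : 0 < r ^ (k + n) := pow_pos hr.1 _
  rw [dist_zero_right, norm_mul, zpow_neg_order, norm_inv, Real.norm_of_nonneg h2.le,
    inv_mul_lt_iff₀ h2, Real.norm_eq_abs]
  nlinarith

theorem PtDiffAt.exists_forall {T : Distrib n Y} {k : ℕ} {a : EuclideanSpace ℝ (Fin n)}
    (h : PtDiffAt T k a) :
    ∃ P : EuclideanSpace ℝ (Fin n) → StrongDual ℝ Y, IsPolynomialOfDegreeLE (k : ℤ) P ∧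
      ∀ φ : TestFun n Y, ∀ ε, 0 < ε → ∃ δ, 0 < δ ∧ ∀ r, 0 < r → r < δ →
        |(T - ofFunction P) (rescale φ a r)| ≤ ε * r ^ (k + n) := by
  obtain ⟨P, hP, h⟩ := h
  refine ⟨P, hP, fun φ ε hε => ?_⟩
  obtain ⟨δ, hδ, h1⟩ := mem_nhdsGT_iff_exists_Ioo_subset.1 (Metric.tendsto_nhds.1 (h φ) ε hε)
  refine ⟨δ, hδ, fun r hr hrδ => ?_⟩
  have h2 : 0 < r ^ (k + n) := pow_pos hr _
  have h3 := h1 ⟨hr, hrδ⟩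
  simp only [Set.mem_ofPred_eq] at h3
  rw [dist_zero_right, norm_mul, zpow_neg_order, norm_inv, Real.norm_of_nonneg h2.le,
    inv_mul_lt_iff₀ h2, Real.norm_eq_abs] at h3
  linarith

/-- Linear functionals on test functions with locally finite order are continuous. -/
theorem exists_distrib_of_bound (F : TestFun n Y →ₗ[ℝ] ℝ)
    (hF : ∀ R : ℝ, ∃ (i : ℕ) (C : ℝ), ∀ (ψ : TestFun n Y) (M : ℝ),
      Function.support ψ ⊆ Metric.closedBall 0 R → DerivLE i 1 M ψ → |F ψ| ≤ C * M) :
    ∃ T : Distrib n Y, ∀ ψ, T ψ = F ψ := by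
  refine ⟨⟨F, (TestFunction.continuous_iff_continuous_comp F).2 fun K hK => ?_⟩, fun _ => rfl⟩
  obtain ⟨R, hR⟩ := K.isCompact.isBounded.subset_closedBall 0
  obtain ⟨i, C, h⟩ := hF R
  let G : 𝓓_{K}(EuclideanSpace ℝ (Fin n), Y) →ₗ[ℝ] ℝ :=
    F ∘ₗ (TestFunction.ofSupportedInCLM ℝ (n := ⊤) hK).toLinearMap
  change Continuous G
  refine WithSeminorms.continuous_normedSpace_rng ℝ
    (ContDiffMapSupportedIn.withSeminorms ℝ (EuclideanSpace ℝ (Fin n)) Y ⊤ K)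
    G ⟨Finset.range (i + 1), ⟨max C 0, le_max_right _ _⟩, ?_⟩
  intro f
  set p := (Finset.range (i + 1)).sup
    (ContDiffMapSupportedIn.seminorm ℝ (EuclideanSpace ℝ (Fin n)) Y ⊤ K) with hp
  change |G f| ≤ max C 0 * p f
  have h1 : |G f| ≤ C * p f := by
    refine h (TestFunction.ofSupportedIn hK f) (p f) (f.support_subset.trans hR)
      fun m hm x => ?_
    rw [one_pow, one_mul]
    exact (ContDiffMapSupportedIn.norm_iteratedFDeriv_apply_le_seminorm_top ℝ).trans
      (Seminorm.le_def.1 (Finset.le_sup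
        (f := ContDiffMapSupportedIn.seminorm ℝ (EuclideanSpace ℝ (Fin n)) Y ⊤ K)
        (Finset.mem_range.2 (Nat.lt_succ_of_le hm))) f)
  exact h1.trans (mul_le_mul_of_nonneg_right (le_max_left _ _) (apply_nonneg p f))

/-- The functional `φ ↦ T (rescale φ a r)` is a distribution. -/
theorem exists_distrib_rescale (T : Distrib n Y) (a : EuclideanSpace ℝ (Fin n)) {r : ℝ}
    (hr : 0 < r) : ∃ F : Distrib n Y, ∀ φ, F φ = T (rescale φ a r) := by
  refine exists_distrib_of_bound
    { toFun := fun φ => T (rescale φ a r)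
      map_add' := fun φ ψ => by rw [rescale_add, map_add]
      map_smul' := fun c φ => by rw [rescale_smul, map_smul]; rfl } fun R => ?_
  obtain ⟨i, C, hC, h⟩ := T.exists_order (‖a‖ + R * r)
  refine ⟨i, C * (max 1 r⁻¹) ^ i, fun ψ M hψ hM => ?_⟩
  rw [mul_assoc]
  refine h _ _ ((support_rescale hψ a hr).trans ?_) ?_
  · refine Metric.closedBall_subset_closedBall' ?_
    rw [dist_zero_right]; linarith
  · have h1 := (((derivLE_rescale_iff hr (a := a)).2 hM).scale (c := max 1 r⁻¹) (le_max_left _ _))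
    refine h1.mono zero_le_one ?_
    calc (1 : ℝ) = r⁻¹ * r := (inv_mul_cancel₀ hr.ne').symm
      _ ≤ _ := by gcongr; exact le_max_right _ _

/-- Bounds for each single test function become uniform by Banach–Steinhaus, applied along a
sequence of radii that would violate every order. -/
theorem UniformOrderAt.of_holderPtDiffAt [CompleteSpace Y] {T : Distrib n Y} {k : ℕ}
    {a : EuclideanSpace ℝ (Fin n)} (h : HolderPtDiffAt T ((k : ℤ) - 1) 1 a) :
    ∃ (i : ℕ) (N δ : ℝ), 0 < δ ∧ UniformOrderAt i T k N δ a := by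
  obtain ⟨P, hP, h⟩ := h
  have hup : ∀ φ : TestFun n Y, ∃ N δ : ℝ, 0 < δ ∧ ∀ r, 0 < r → r < δ →
      (r ^ (k + n))⁻¹ * (T - ofFunction P) (rescale φ a r) ≤ N := fun φ => by
    obtain ⟨N, hN, -⟩ := EReal.lt_iff_exists_real_btwn.1 (h φ)
    obtain ⟨δ, hδ, hev⟩ := mem_nhdsGT_iff_exists_Ioo_subset.1 (eventually_lt_of_limsup_lt hN)
    refine ⟨N, δ, hδ, fun r hr hrδ => ?_⟩
    have h1 : (_ : EReal) < _ := hev ⟨hr, hrδ⟩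
    rw [EReal.coe_lt_coe_iff, rpow_neg_order k r] at h1
    exact h1.le
  by_contra! hcon
  -- The index `j` serves as order, as constant and as inverse radius, so that any order and
  -- constant are eventually exceeded while `r j → 0`.
  have hbad : ∀ j : ℕ, ∃ r, 0 < r ∧ r < 1 / ((j : ℝ) + 1) ∧
      ¬ BoundAt j (T - ofFunction P) a r (j * r ^ (k + n)) := by
    intro j
    by_contra! hj
    exact hcon j j (1 / ((j : ℝ) + 1)) (by positivity) ⟨P, hP, hj⟩
  choose r hr hrj hb using hbad
  choose F hF using fun j => exists_distrib_rescale (T - ofFunction P) a (hr j)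
  obtain ⟨i, C, hC, hbd⟩ := Distrib.uniform_bounded (fun j => (r j ^ (k + n))⁻¹ • F j) 1
    (fun ψ _ => by
      obtain ⟨N₁, δ₁, hδ₁, h₁⟩ := hup ψ
      -- The upper limit is one-sided; applying it to `-ψ` bounds the values from below.
      obtain ⟨N₂, δ₂, hδ₂, h₂⟩ := hup (-ψ)
      have hev : ∀ᶠ j : ℕ in atTop, |((r j ^ (k + n))⁻¹ • F j) ψ| ≤ max N₁ N₂ := by
        have hlim : Tendsto (fun j : ℕ => 1 / ((j : ℝ) + 1)) atTop (𝓝 0) :=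
          tendsto_one_div_add_atTop_nhds_zero_nat
        filter_upwards [hlim.eventually_lt_const hδ₁, hlim.eventually_lt_const hδ₂] with j h3 h4
        have h5 := h₁ (r j) (hr j) ((hrj j).trans h3)
        have h6 := h₂ (r j) (hr j) ((hrj j).trans h4)
        rw [rescale_neg, map_neg, mul_neg] at h6
        rw [_root_.smul_apply, hF, smul_eq_mul, abs_le]
        exact ⟨by linarith [le_max_right N₁ N₂], h5.trans (le_max_left _ _)⟩
      obtain ⟨j₀, hj₀⟩ := eventually_atTop.1 hev
      refine ⟨max N₁ N₂ + ∑ j ∈ Finset.range j₀, |((r j ^ (k + n))⁻¹ • F j) ψ|, fun j => ?_⟩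
      have hs : 0 ≤ ∑ j ∈ Finset.range j₀, |((r j ^ (k + n))⁻¹ • F j) ψ| :=
        Finset.sum_nonneg fun _ _ => abs_nonneg _
      by_cases hj : j₀ ≤ j
      · linarith [hj₀ j hj]
      · have h7 := Finset.single_le_sum (f := fun j => |((r j ^ (k + n))⁻¹ • F j) ψ|)
          (fun _ _ => abs_nonneg _) (Finset.mem_range.2 (not_le.1 hj))
        have h8 := (abs_nonneg _).trans (hj₀ j₀ le_rfl)
        exact h7.trans (by linarith))
  obtain ⟨j, hj⟩ := exists_nat_ge (max (i : ℝ) C)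
  have hij : i ≤ j := by exact_mod_cast (le_max_left _ _).trans hj
  have hCj : C ≤ j := (le_max_right _ _).trans hj
  refine hb j (((boundAt_iff (hr j)).2 fun φ hφ hν => ?_ : BoundAt j _ a (r j) _))
  rw [tsupport_subset_closedBall_iff] at hφ
  rw [nu_unitBall_le_one_iff hφ] at hν
  have h9 := hbd j φ 1 hφ (hν.of_le hij)
  have h10 : 0 < r j ^ (k + n) := pow_pos (hr j) _
  have h11 := (le_abs_self _).trans h9
  rw [_root_.smul_apply, hF, smul_eq_mul, inv_mul_le_iff₀ h10] at h11
  nlinarith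

section

/-! ### Mollified characteristic functions and localization. -/

section Convolution

/-- The convolution of the characteristic function of `Q` with `g`. -/
def indConv {F : Type*} [NormedAddCommGroup F] [NormedSpace ℝ F] (Q : Set (EuclideanSpace ℝ (Fin n)))
    (g : EuclideanSpace ℝ (Fin n) → F) (x : EuclideanSpace ℝ (Fin n)) : F :=
  ∫ t in Q, g (x - t)

variable {F : Type*} [NormedAddCommGroup F] [NormedSpace ℝ F] {Q : Set (EuclideanSpace ℝ (Fin n))}
  {g : EuclideanSpace ℝ (Fin n) → F}

theorem indConv_eq_convolution (hQ : MeasurableSet Q) :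
    indConv Q g = convolution (Q.indicator fun _ => (1 : ℝ)) g
      (ContinuousLinearMap.lsmul ℝ ℝ) volume := by
  ext x
  rw [indConv, convolution_def, ← integral_indicator hQ]
  congr 1
  ext t
  by_cases ht : t ∈ Q <;> simp [ht]

theorem locallyIntegrable_indicator_one (hQ : MeasurableSet Q) :
    LocallyIntegrable (Q.indicator fun _ => (1 : ℝ)) volume :=
  (locallyIntegrable_const 1).indicator hQ

theorem contDiff_indConv (hQ : MeasurableSet Q) (hg : ContDiff ℝ ∞ g) (hs : HasCompactSupport g) :
    ContDiff ℝ ∞ (indConv Q g) := by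
  rw [indConv_eq_convolution hQ]
  exact hs.contDiff_convolution_right _ (locallyIntegrable_indicator_one hQ) hg

theorem fderiv_indConv (hQ : MeasurableSet Q) (hg : ContDiff ℝ ∞ g) (hs : HasCompactSupport g) :
    fderiv ℝ (indConv Q g) = indConv Q (fderiv ℝ g) := by
  ext1 x
  have h := hs.hasFDerivAt_convolution_right (ContinuousLinearMap.lsmul ℝ ℝ : ℝ →L[ℝ] F →L[ℝ] F)
    (locallyIntegrable_indicator_one hQ) (hg.of_le (by exact_mod_cast le_top)) x
  rw [← indConv_eq_convolution hQ] at h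
  rw [h.fderiv, indConv_eq_convolution hQ, convolution_def, convolution_def]
  congr 1

theorem norm_indConv_le {s C : ℝ} (hQ : MeasurableSet Q) (hC : ∀ x, ‖g x‖ ≤ C)
    (hs : Function.support g ⊆ Metric.closedBall 0 s) (x : EuclideanSpace ℝ (Fin n)) :
    ‖indConv Q g x‖ ≤ C * volume.real (Q ∩ Metric.closedBall x s) := by
  have h1 : indConv Q g x = ∫ t in Q ∩ Metric.closedBall x s, g (x - t) := by
    refine setIntegral_eq_of_subset_of_forall_sdiff_eq_zero hQ Set.inter_subset_left fun t ht => ?_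
    by_contra h0
    refine ht.2 ⟨ht.1, ?_⟩
    have := hs h0
    rwa [mem_closedBall_zero_iff, ← dist_eq_norm, dist_comm] at this
  rw [h1]
  exact norm_setIntegral_le_of_norm_le_const
    ((measure_mono Set.inter_subset_right).trans_lt measure_closedBall_lt_top) fun t _ => hC _

theorem norm_iteratedFDeriv_indConv_le {s C : ℝ} (hQ : MeasurableSet Q) (hg : ContDiff ℝ ∞ g)
    (hs : Function.support g ⊆ Metric.closedBall 0 s) (m : ℕ)
    (hC : ∀ x, ‖iteratedFDeriv ℝ m g x‖ ≤ C) (x : EuclideanSpace ℝ (Fin n)) :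
    ‖iteratedFDeriv ℝ m (indConv Q g) x‖ ≤ C * volume.real (Q ∩ Metric.closedBall x s) := by
  have hcs : ∀ {F : Type _} [NormedAddCommGroup F] {g : EuclideanSpace ℝ (Fin n) → F},
      Function.support g ⊆ Metric.closedBall 0 s → HasCompactSupport g := fun hs =>
    HasCompactSupport.of_support_subset_isCompact (isCompact_closedBall _ _) hs
  induction m generalizing F with
  | zero =>
    rw [norm_iteratedFDeriv_zero]
    exact norm_indConv_le hQ (fun x => by simpa using hC x) hs x
  | succ m ih =>
    rw [← norm_iteratedFDeriv_fderiv, fderiv_indConv hQ hg (hcs hs)]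
    refine ih (hg.fderiv_right (by exact_mod_cast le_top)) ?_ fun x => ?_
    · exact (support_fderiv_subset ℝ).trans (tsupport_subset_closedBall_iff.2 hs)
    · rw [norm_iteratedFDeriv_fderiv]
      exact hC x

end Convolution

/-- A smooth mollifier supported in the unit ball, with integral one. -/
def mollifier (n : ℕ) : TestFun n ℝ :=
  let b : ContDiffBump (0 : EuclideanSpace ℝ (Fin n)) := ⟨1 / 2, 1, by norm_num, by norm_num⟩
  TestFun.ofSupport (b.normed volume) b.contDiff_normed b.hasCompactSupport_normed

theorem mollifier_nonneg (x : EuclideanSpace ℝ (Fin n)) : 0 ≤ mollifier n x :=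
  ContDiffBump.nonneg_normed _ _

theorem integral_mollifier : ∫ x, mollifier n x = 1 :=
  ContDiffBump.integral_normed _

theorem support_mollifier : Function.support (mollifier n) ⊆ Metric.closedBall 0 1 := by
  have h := ContDiffBump.support_normed_eq (μ := volume)
    (⟨1 / 2, 1, by norm_num, by norm_num⟩ : ContDiffBump (0 : EuclideanSpace ℝ (Fin n)))
  exact h.le.trans Metric.ball_subset_closedBall

/-- The mollifier at the scale `s`. -/
def kern (n : ℕ) (s : ℝ) : TestFun n ℝ :=
  (s ^ n)⁻¹ • rescale (mollifier n) 0 s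

theorem kern_apply {s : ℝ} (hs : 0 < s) (x : EuclideanSpace ℝ (Fin n)) :
    kern n s x = (s ^ n)⁻¹ * mollifier n (s⁻¹ • x) := by
  simp [kern, rescale_apply _ _ hs.ne']

theorem kern_nonneg {s : ℝ} (hs : 0 < s) (x : EuclideanSpace ℝ (Fin n)) : 0 ≤ kern n s x := by
  rw [kern_apply hs]
  exact mul_nonneg (by positivity) (mollifier_nonneg _)

theorem integral_kern {s : ℝ} (hs : 0 < s) : ∫ x, kern n s x = 1 := by
  simp only [kern_apply hs]
  rw [integral_const_mul, Measure.integral_comp_inv_smul, integral_mollifier]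
  simp only [finrank_euclideanSpace, Fintype.card_fin, smul_eq_mul, mul_one]
  rw [abs_of_pos (by positivity), inv_mul_cancel₀ (by positivity)]

theorem support_kern {s : ℝ} (hs : 0 < s) :
    Function.support (kern n s) ⊆ Metric.closedBall 0 s := by
  have h1 := support_rescale support_mollifier (0 : EuclideanSpace ℝ (Fin n)) hs
  rw [one_mul] at h1
  refine (fun x hx => h1 ?_)
  intro h0
  exact hx (by simp [kern, h0])

/-- The mollification at the scale `s` of the characteristic function of `Q`. -/
def moll (s : ℝ) (Q : Set (EuclideanSpace ℝ (Fin n))) : EuclideanSpace ℝ (Fin n) → ℝ :=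
  indConv Q (kern n s)

variable {s : ℝ} {Q : Set (EuclideanSpace ℝ (Fin n))}

theorem contDiff_moll (s : ℝ) (hQ : MeasurableSet Q) : ContDiff ℝ ∞ (moll s Q) :=
  contDiff_indConv hQ (kern n s).contDiff (kern n s).hasCompactSupport

theorem integrable_kern_sub (s : ℝ) (x : EuclideanSpace ℝ (Fin n)) :
    Integrable (fun t => kern n s (x - t)) volume :=
  (kern n s).integrable.comp_sub_left x

theorem integral_kern_sub (hs : 0 < s) (x : EuclideanSpace ℝ (Fin n)) :
    ∫ t, kern n s (x - t) = 1 := by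
  rw [integral_sub_left_eq_self (fun t => kern n s t), integral_kern hs]

theorem moll_nonneg (hs : 0 < s) (x : EuclideanSpace ℝ (Fin n)) : 0 ≤ moll s Q x :=
  integral_nonneg fun _ => kern_nonneg hs _

theorem moll_le_one (hs : 0 < s) (x : EuclideanSpace ℝ (Fin n)) : moll s Q x ≤ 1 := by
  rw [← integral_kern_sub hs x]
  exact setIntegral_le_integral (integrable_kern_sub s x) (ae_of_all _ fun _ => kern_nonneg hs _)

/-- Additivity in `Q` lets measurable partitions play the role of smooth partitions of unity. -/
theorem moll_union {Q' : Set (EuclideanSpace ℝ (Fin n))} (hQ' : MeasurableSet Q')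
    (h : Disjoint Q Q') (x : EuclideanSpace ℝ (Fin n)) :
    moll s (Q ∪ Q') x = moll s Q x + moll s Q' x :=
  setIntegral_union h hQ' (integrable_kern_sub s x).integrableOn
    (integrable_kern_sub s x).integrableOn

theorem moll_eq_zero (hs : 0 < s) {x : EuclideanSpace ℝ (Fin n)}
    (h : ∀ t ∈ Q, s < dist x t) : moll s Q x = 0 := by
  refine setIntegral_eq_zero_of_forall_eq_zero fun t ht => ?_
  by_contra h0
  have := support_kern hs h0
  rw [mem_closedBall_zero_iff, ← dist_eq_norm] at this
  exact absurd (h t ht) (not_lt.2 this)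

theorem moll_eq_one (hs : 0 < s) {x : EuclideanSpace ℝ (Fin n)}
    (h : Metric.closedBall x s ⊆ Q) : moll s Q x = 1 := by
  rw [← integral_kern_sub hs x, moll, indConv]
  refine setIntegral_eq_integral_of_forall_compl_eq_zero fun t ht => ?_
  by_contra h0
  have := support_kern hs h0
  rw [mem_closedBall_zero_iff, ← dist_eq_norm, dist_comm] at this
  exact ht (h this)

theorem support_moll_subset (hs : 0 < s) {x₀ : EuclideanSpace ℝ (Fin n)} {r : ℝ}
    (hQ : Q ⊆ Metric.closedBall x₀ r) :
    Function.support (moll s Q) ⊆ Metric.closedBall x₀ (r + s) := by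
  intro x hx
  by_contra hcon
  refine hx (moll_eq_zero hs fun t ht => ?_)
  have h1 := Metric.mem_closedBall.1 (hQ ht)
  rw [Metric.mem_closedBall, not_le] at hcon
  linarith [dist_triangle x t x₀]

/-- The volume of `Q` near `x` is kept in the bound, instead of being estimated by `s ^ n`. Bounds
on pieces are then proportional to volume, and sum to an integral however fine the partition is. -/
theorem exists_norm_iteratedFDeriv_moll_le (n i : ℕ) :
    ∃ C : ℝ, 0 < C ∧ ∀ (s : ℝ) (Q : Set (EuclideanSpace ℝ (Fin n))), 0 < s → MeasurableSet Q →
      ∀ m ≤ i, ∀ x, s ^ m * ‖iteratedFDeriv ℝ m (moll s Q) x‖ ≤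
        C * (s ^ n)⁻¹ * volume.real (Q ∩ Metric.closedBall x s) := by
  obtain ⟨C, hC, h⟩ := (mollifier n).exists_derivLE i 1 zero_le_one
  refine ⟨C, hC, fun s Q hs hQ m hm x => ?_⟩
  have h1 := ((derivLE_rescale_iff hs (a := (0 : EuclideanSpace ℝ (Fin n)))).2 h).const_smul
    ((s ^ n)⁻¹) (rescale (mollifier n) 0 s).contDiff
  rw [abs_of_pos (by positivity)] at h1
  have h2 : ∀ x, ‖iteratedFDeriv ℝ m (kern n s) x‖ ≤ (s ^ m)⁻¹ * ((s ^ n)⁻¹ * C) := fun x => by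
    rw [le_inv_mul_iff₀ (by positivity)]
    exact h1 m hm x
  have h3 := norm_iteratedFDeriv_indConv_le hQ (kern n s).contDiff (support_kern hs) m h2 x
  calc s ^ m * ‖iteratedFDeriv ℝ m (moll s Q) x‖
      ≤ s ^ m * ((s ^ m)⁻¹ * ((s ^ n)⁻¹ * C) * volume.real (Q ∩ Metric.closedBall x s)) := by
        gcongr; exact h3
    _ = _ := by field_simp

theorem exists_derivLE_moll (n i : ℕ) :
    ∃ C : ℝ, 0 < C ∧ ∀ (s : ℝ) (Q : Set (EuclideanSpace ℝ (Fin n))), 0 < s → MeasurableSet Q →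
      DerivLE i s C (moll s Q) := by
  obtain ⟨C, hC, h⟩ := exists_norm_iteratedFDeriv_moll_le n i
  refine ⟨C * volume.real (Metric.closedBall (0 : EuclideanSpace ℝ (Fin n)) 1), ?_,
    fun s Q hs hQ m hm x => (h s Q hs hQ m hm x).trans ?_⟩
  · refine mul_pos hC (ENNReal.toReal_pos (Metric.measure_closedBall_pos _ _ one_pos).ne'
      measure_closedBall_lt_top.ne)
  · have h1 : volume.real (Q ∩ Metric.closedBall x s) ≤
        s ^ n * volume.real (Metric.closedBall (0 : EuclideanSpace ℝ (Fin n)) 1) := by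
      refine (measureReal_mono Set.inter_subset_right measure_closedBall_lt_top.ne).trans_eq ?_
      rw [Measure.addHaar_real_closedBall' _ _ hs.le]
      simp
    calc C * (s ^ n)⁻¹ * volume.real (Q ∩ Metric.closedBall x s)
        ≤ C * (s ^ n)⁻¹ *
          (s ^ n * volume.real (Metric.closedBall (0 : EuclideanSpace ℝ (Fin n)) 1)) := by gcongr
      _ = _ := by field_simp

theorem norm_iteratedFDeriv_smul_le_of_le {i : ℕ} {g : EuclideanSpace ℝ (Fin n) → ℝ}
    {f : EuclideanSpace ℝ (Fin n) → Y} (hg : ContDiff ℝ ∞ g) (hf : ContDiff ℝ ∞ f)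
    (hs : 0 ≤ s) {A B : ℝ} {x : EuclideanSpace ℝ (Fin n)}
    (hA : ∀ m ≤ i, s ^ m * ‖iteratedFDeriv ℝ m g x‖ ≤ A)
    (hB : ∀ m ≤ i, s ^ m * ‖iteratedFDeriv ℝ m f x‖ ≤ B) {m : ℕ} (hm : m ≤ i) :
    s ^ m * ‖iteratedFDeriv ℝ m (fun y => g y • f y) x‖ ≤ 2 ^ i * (A * B) := by
  have hA0 : 0 ≤ A := le_trans (by positivity) (hA 0 (Nat.zero_le _))
  have hB0 : 0 ≤ B := le_trans (by positivity) (hB 0 (Nat.zero_le _))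
  have h1 := norm_iteratedFDeriv_smul_le hg hf x (n := m) (by exact_mod_cast le_top)
  calc s ^ m * ‖iteratedFDeriv ℝ m (fun y => g y • f y) x‖
      ≤ s ^ m * ∑ l ∈ Finset.range (m + 1), (m.choose l : ℝ) * ‖iteratedFDeriv ℝ l g x‖ *
        ‖iteratedFDeriv ℝ (m - l) f x‖ := by gcongr
    _ = ∑ l ∈ Finset.range (m + 1), (m.choose l : ℝ) * ((s ^ l * ‖iteratedFDeriv ℝ l g x‖) *
        (s ^ (m - l) * ‖iteratedFDeriv ℝ (m - l) f x‖)) := by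
        rw [Finset.mul_sum]
        refine Finset.sum_congr rfl fun l hl => ?_
        rw [show s ^ m = s ^ l * s ^ (m - l) by
          rw [← pow_add, Nat.add_sub_cancel' (Nat.lt_succ_iff.1 (Finset.mem_range.1 hl))]]
        ring
    _ ≤ ∑ l ∈ Finset.range (m + 1), (m.choose l : ℝ) * (A * B) := by
        gcongr with l hl
        · exact hA l ((Nat.lt_succ_iff.1 (Finset.mem_range.1 hl)).trans hm)
        · exact hB _ ((Nat.sub_le _ _).trans hm)
    _ = 2 ^ m * (A * B) := by
        rw [← Finset.sum_mul]
        congr 1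
        exact_mod_cast Nat.sum_range_choose m
    _ ≤ 2 ^ i * (A * B) := by
        gcongr
        exact one_le_two

theorem DerivLE.smul {i : ℕ} {g : EuclideanSpace ℝ (Fin n) → ℝ}
    {f : EuclideanSpace ℝ (Fin n) → Y} (hg : ContDiff ℝ ∞ g) (hf : ContDiff ℝ ∞ f)
    (hs : 0 ≤ s) {A B : ℝ} (hA : DerivLE i s A g) (hB : DerivLE i s B f) :
    DerivLE i s (2 ^ i * (A * B)) (fun y => g y • f y) := fun _ hm x =>
  norm_iteratedFDeriv_smul_le_of_le hg hf hs (fun m hm => hA m hm x) (fun m hm => hB m hm x) hm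

/-- The product of a test function with a mollified characteristic function. -/
def cut (s : ℝ) (Q : Set (EuclideanSpace ℝ (Fin n))) (hQ : MeasurableSet Q) (ψ : TestFun n Y) :
    TestFun n Y :=
  ψ.mulFun (moll s Q) (contDiff_moll s hQ)

@[simp] theorem cut_apply (hQ : MeasurableSet Q) (ψ : TestFun n Y) (x : EuclideanSpace ℝ (Fin n)) :
    cut s Q hQ ψ x = moll s Q x • ψ x :=
  rfl

theorem support_cut_subset (hQ : MeasurableSet Q) (ψ : TestFun n Y) :
    Function.support (cut s Q hQ ψ) ⊆ Function.support (moll s Q) ∩ Function.support ψ := by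
  intro x hx
  constructor <;> intro h0 <;> exact hx (by simp [h0])

/-- The Leibniz rule. Since the piece is supported in `B(x₀, 2s)`, bounds for `ψ` are needed only
there. -/
theorem exists_derivLE_cut (n i : ℕ) :
    ∃ C : ℝ, 0 < C ∧ ∀ {Y : Type*} [NormedAddCommGroup Y] [NormedSpace ℝ Y] (ψ : TestFun n Y)
      (s : ℝ) (x₀ : EuclideanSpace ℝ (Fin n)) (w : ℝ) (Q : Set (EuclideanSpace ℝ (Fin n)))
      (hQ : MeasurableSet Q), 0 < s → Q ⊆ Metric.closedBall x₀ s →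
      (∀ y ∈ Metric.closedBall x₀ (2 * s), ∀ m ≤ i, s ^ m * ‖iteratedFDeriv ℝ m ψ y‖ ≤ w) →
      DerivLE i s (C * (s ^ n)⁻¹ * volume.real Q * w) (cut s Q hQ ψ) := by
  obtain ⟨C, hC, h⟩ := exists_norm_iteratedFDeriv_moll_le n i
  refine ⟨2 ^ i * C, by positivity, ?_⟩
  intro Y _ _ ψ s x₀ w Q hQ hs hQs hw m hm x
  have hw0 : 0 ≤ w := le_trans (by positivity)
    (hw x₀ (Metric.mem_closedBall_self (by positivity)) 0 (Nat.zero_le _))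
  by_cases hx : x ∈ Metric.closedBall x₀ (2 * s)
  · refine (norm_iteratedFDeriv_smul_le_of_le (contDiff_moll s hQ) ψ.contDiff hs.le
      (fun m hm => (h s Q hs hQ m hm x).trans (?_ : _ ≤ C * (s ^ n)⁻¹ * volume.real Q))
      (hw x hx) hm).trans_eq (by ring)
    gcongr
    · exact ((measure_mono hQs).trans_lt measure_closedBall_lt_top).ne
    · exact Set.inter_subset_left
  · have h0 : iteratedFDeriv ℝ m (cut s Q hQ ψ) x = 0 := by
      by_contra h0
      refine hx (tsupport_subset_closedBall_iff.2 ?_ (support_iteratedFDeriv_subset m h0))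
      refine (support_cut_subset hQ ψ).trans (Set.inter_subset_left.trans ?_)
      rw [two_mul]
      exact support_moll_subset hs hQs
    rw [h0, norm_zero, mul_zero]
    positivity

/-- Localization: a bound on the pieces of a test function yields a bound on the test function. -/
theorem abs_le_integral_of_cut {R : Distrib n Y} {ψ : TestFun n Y} (hs : 0 < s)
    {w : EuclideanSpace ℝ (Fin n) → ℝ} (hw : Integrable w) (hw0 : ∀ x, 0 ≤ w x)
    (h : ∀ (Q : Set (EuclideanSpace ℝ (Fin n))) (hQ : MeasurableSet Q), ∀ x₀ ∈ Q,
      Q ⊆ Metric.closedBall x₀ s → |R (cut s Q hQ ψ)| ≤ volume.real Q * w x₀) :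
    |R ψ| ≤ ∫ x, w x := by
  obtain ⟨r, -, hr⟩ := ψ.exists_support_subset
  -- Induction over the compact ball. Quantifying over all measurable `Q ⊆ U` makes the property
  -- stable under unions, since both `cut` and the integral are additive in `Q`.
  have key : ∃ U, MeasurableSet U ∧ Metric.closedBall 0 (r + s) ⊆ U ∧ ∀ Q,
      ∀ hQ : MeasurableSet Q, Q ⊆ U → |R (cut s Q hQ ψ)| ≤ ∫ x in Q, w x := by
    refine (isCompact_closedBall (0 : EuclideanSpace ℝ (Fin n)) (r + s)).induction_on
      (p := fun S => ∃ U, MeasurableSet U ∧ S ⊆ U ∧ ∀ Q, ∀ hQ : MeasurableSet Q, Q ⊆ U →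
        |R (cut s Q hQ ψ)| ≤ ∫ x in Q, w x) ?_ ?_ ?_ ?_
    · refine ⟨∅, MeasurableSet.empty, le_rfl, fun Q hQ hQe => ?_⟩
      have hQe := Set.subset_empty_iff.1 hQe
      subst hQe
      have : cut s ∅ hQ ψ = 0 := by ext x; simp [moll, indConv]
      simp [this]
    · rintro S S' hS ⟨U, hU, hSU, h⟩
      exact ⟨U, hU, hS.trans hSU, h⟩
    · rintro S S' ⟨U, hU, hSU, h⟩ ⟨U', hU', hSU', h'⟩
      refine ⟨U ∪ U', hU.union hU', Set.union_subset_union hSU hSU', fun Q hQ hQU => ?_⟩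
      have h1 : cut s Q hQ ψ = cut s (Q ∩ U) (hQ.inter hU) ψ + cut s (Q \ U) (hQ.diff hU) ψ := by
        ext x
        have := moll_union (s := s) (hQ.diff hU)
          (Set.disjoint_sdiff_left.symm.mono_left Set.inter_subset_right : Disjoint (Q ∩ U) (Q \ U)) x
        rw [Set.inter_union_sdiff] at this
        simp [this, add_smul]
      rw [h1, map_add]
      have h2 := h (Q ∩ U) (hQ.inter hU) Set.inter_subset_right
      have h3 := h' (Q \ U) (hQ.diff hU) fun x hx => (hQU hx.1).resolve_left hx.2
      have h4 := integral_inter_add_sdiff hU (hw.integrableOn (s := Q))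
      exact (abs_add_le _ _).trans (by linarith)
    · intro x _
      refine ⟨Metric.closedBall x (s / 2), mem_nhdsWithin_of_mem_nhds
        (Metric.closedBall_mem_nhds _ (half_pos hs)), _, measurableSet_closedBall, le_rfl,
        fun Q hQ hQx => ?_⟩
      have h1 : ∀ x₀ ∈ Q, |R (cut s Q hQ ψ)| ≤ volume.real Q * w x₀ := fun x₀ hx₀ => by
        refine h Q hQ x₀ hx₀ fun z hz => ?_
        have h2 := Metric.mem_closedBall.1 (hQx hz)
        have h3 := Metric.mem_closedBall'.1 (hQx hx₀)
        rw [Metric.mem_closedBall]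
        linarith [dist_triangle z x x₀]
      have hfin : volume Q ≠ ⊤ := ((measure_mono hQx).trans_lt measure_closedBall_lt_top).ne
      rcases Q.eq_empty_or_nonempty with rfl | ⟨x₀, hx₀⟩
      · have : cut s ∅ hQ ψ = 0 := by ext x; simp [moll, indConv]
        simp [this]
      · rcases (measureReal_nonneg (μ := volume) (s := Q)).eq_or_lt with h0 | h0
        · have := h1 x₀ hx₀
          rw [← h0, zero_mul] at this
          exact this.trans (integral_nonneg hw0)
        -- Averaging the hypothesis over `x₀ ∈ Q` turns `vol(Q) w(x₀)` into the integral of `w` over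
        -- `Q`.
        · have h2 : ∫ _ in Q, (volume.real Q)⁻¹ * |R (cut s Q hQ ψ)| ≤ ∫ x in Q, w x := by
            refine setIntegral_mono_on (integrableOn_const hfin) hw.integrableOn hQ fun z hz => ?_
            rw [inv_mul_le_iff₀ h0]
            exact h1 z hz
          rwa [setIntegral_const, smul_eq_mul, mul_inv_cancel_left₀ h0.ne'] at h2
  obtain ⟨U, hU, hKU, h⟩ := key
  have h1 : cut s U hU ψ = ψ := by
    ext x
    by_cases hx : ψ x = 0
    · simp [hx]
    · rw [cut_apply, moll_eq_one hs, one_smul]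
      refine subset_trans (Metric.closedBall_subset_closedBall' ?_) hKU
      have := Metric.mem_closedBall.1 (hr hx)
      linarith
  have h2 := h U hU le_rfl
  rw [h1] at h2
  exact h2.trans (setIntegral_le_integral hw (ae_of_all _ hw0))

end

/-! ### Cutoffs near the set of uniform bounds and their limit. -/

section

/-- Five interleaved telescoping sums; hence the factor `5`. -/
theorem exists_tendsto_of_telescoping {u g : ℕ → ℝ} {K : ℝ} {j₀ : ℕ} (hK : 0 ≤ K)
    (hg : Antitone g) (hg0 : ∀ j, 0 ≤ g j)
    (h : ∀ j, j₀ ≤ j → |u j - u (j + 1)| ≤ K * (g j - g (j + 5))) :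
    ∃ L, Tendsto u atTop (𝓝 L) ∧ |u j₀ - L| ≤ 5 * K * g j₀ := by
  set v : ℕ → ℝ := fun j => u (j + j₀) with hv
  have hsum : ∀ J, ∑ j ∈ Finset.range J, dist (v j) (v (j + 1)) ≤ 5 * K * g j₀ := by
    intro J
    have h1 : ∀ J, ∑ j ∈ Finset.range J, dist (v j) (v (j + 1)) ≤
        K * ((g j₀ + g (j₀ + 1) + g (j₀ + 2) + g (j₀ + 3) + g (j₀ + 4)) -
          (g (J + j₀) + g (J + j₀ + 1) + g (J + j₀ + 2) + g (J + j₀ + 3) + g (J + j₀ + 4))) := by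
      intro J
      induction J with
      | zero => simp
      | succ J ih =>
        rw [Finset.sum_range_succ]
        have h2 := h (J + j₀) (Nat.le_add_left _ _)
        have h3 : dist (v J) (v (J + 1)) = |u (J + j₀) - u (J + j₀ + 1)| := by
          rw [Real.dist_eq, hv]
          simp only [Nat.add_right_comm J 1 j₀]
        rw [h3, show J + 1 + j₀ = J + j₀ + 1 by ring]
        simp only [add_assoc] at *
        norm_num at *
        linarith
    refine (h1 J).trans ?_
    have := hg (Nat.le_add_right j₀ 1)
    have := hg (Nat.le_add_right j₀ 2)
    have := hg (Nat.le_add_right j₀ 3)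
    have := hg (Nat.le_add_right j₀ 4)
    have := hg0 (J + j₀)
    have := hg0 (J + j₀ + 1)
    have := hg0 (J + j₀ + 2)
    have := hg0 (J + j₀ + 3)
    have := hg0 (J + j₀ + 4)
    rw [mul_comm 5 K, mul_assoc]
    refine mul_le_mul_of_nonneg_left ?_ hK
    linarith
  have hs : Summable fun j => dist (v j) (v (j + 1)) :=
    summable_of_sum_range_le (fun _ => dist_nonneg) hsum
  obtain ⟨L, hL⟩ := cauchySeq_tendsto_of_complete (cauchySeq_of_summable_dist hs)
  refine ⟨L, (tendsto_add_atTop_iff_nat j₀).1 hL, ?_⟩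
  have h4 := dist_le_tsum_dist_of_tendsto₀ hs hL
  rw [hv] at h4
  simp only [zero_add, Real.dist_eq] at h4
  refine h4.trans ?_
  exact Real.tsum_le_of_sum_range_le (fun _ => abs_nonneg _) hsum

/-- `T` is bounded by `N r ^ n` on balls of radius `r < δ` centred at points of `A`. -/
def UniformBoundOn (i : ℕ) (T : Distrib n Y) (N δ : ℝ) (A : Set (EuclideanSpace ℝ (Fin n))) :
    Prop :=
  ∀ a ∈ A, ∀ r, 0 < r → r < δ → BoundAt i T a r (N * r ^ n)

variable {i : ℕ} {T : Distrib n Y} {N δ s : ℝ} {A : Set (EuclideanSpace ℝ (Fin n))}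

/-- A nonzero piece lies in `B(x₀, 2s)` and meets the support of `ψ`, which is within `32s` of some
`a ∈ A`. It therefore lies in `B(a, 36s)`, as `36 = 2 + 2 + 32`. The factor `(36s) ^ n` from the
hypothesis cancels the `s ^ (-n)` of `exists_derivLE_cut`. -/
theorem exists_abs_le_integral (n i : ℕ) :
    ∃ C : ℝ, 0 < C ∧ ∀ {Y : Type*} [NormedAddCommGroup Y] [NormedSpace ℝ Y] (T : Distrib n Y)
      (N δ s : ℝ) (A : Set (EuclideanSpace ℝ (Fin n))) (ψ : TestFun n Y)
      (w : EuclideanSpace ℝ (Fin n) → ℝ), 0 ≤ N → UniformBoundOn i T N δ A → 0 < s → 36 * s < δ →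
      (∀ x ∈ Function.support ψ, ∃ a ∈ A, dist x a ≤ 32 * s) →
      Integrable w → (∀ x, ∀ y ∈ Metric.closedBall x (2 * s), ∀ m ≤ i,
        s ^ m * ‖iteratedFDeriv ℝ m ψ y‖ ≤ w x) →
      |T ψ| ≤ C * N * ∫ x, w x := by
  obtain ⟨C, hC, h⟩ := exists_derivLE_cut n i
  refine ⟨36 ^ n * 36 ^ i * C, by positivity, ?_⟩
  intro Y _ _ T N δ s A ψ w hN hT hs hsδ hψ hw hψw
  have hw0 : ∀ x, 0 ≤ w x := fun x => le_trans (by positivity)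
    (hψw x x (Metric.mem_closedBall_self (by positivity)) 0 (Nat.zero_le _))
  rw [← integral_const_mul]
  refine abs_le_integral_of_cut hs (hw.const_mul _) (fun x => mul_nonneg (by positivity) (hw0 x))
    fun Q hQ x₀ hx₀ hQs => ?_
  by_cases h0 : cut s Q hQ ψ = 0
  · rw [h0, map_zero, abs_zero]
    have := hw0 x₀
    positivity
  · have hne : ∃ x, cut s Q hQ ψ x ≠ 0 := by
      by_contra! hcon
      exact h0 (by ext x; simpa using hcon x)
    obtain ⟨x, hx⟩ := hne
    obtain ⟨hx1, hx2⟩ := support_cut_subset hQ ψ hx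
    obtain ⟨a, ha, hxa⟩ := hψ x hx2
    have hsup := support_moll_subset hs hQs
    have hx3 := Metric.mem_closedBall.1 (hsup hx1)
    have h1 := (h ψ s x₀ (w x₀) Q hQ hs hQs (hψw x₀)).scale (c := 36) (by norm_num)
    have h2 := hT a ha (36 * s) (by positivity) hsδ (cut s Q hQ ψ) _ ?_ h1
    · refine h2.trans_eq ?_
      rw [mul_pow]
      field_simp
    · refine ((support_cut_subset hQ ψ).trans (Set.inter_subset_left.trans hsup)).trans
        (Metric.closedBall_subset_closedBall' ?_)
      linarith [dist_triangle x₀ x a, dist_comm x x₀]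

/-- The weight is `M` on `V`. As `V` contains the `2s`-neighbourhood of `Z`, all derivatives of `ψ`
vanish on `B(x, 2s)` when `x` is not in `V`. -/
theorem exists_abs_le_measure (n i : ℕ) :
    ∃ C : ℝ, 0 < C ∧ ∀ {Y : Type*} [NormedAddCommGroup Y] [NormedSpace ℝ Y] (T : Distrib n Y)
      (N δ s M : ℝ) (A Z V : Set (EuclideanSpace ℝ (Fin n))) (ψ : TestFun n Y),
      0 ≤ N → UniformBoundOn i T N δ A → 0 < s → 36 * s < δ → IsClosed Z →
      Function.support ψ ⊆ Z → (∀ x ∈ Z, ∃ a ∈ A, dist x a ≤ 32 * s) →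
      MeasurableSet V → volume V ≠ ⊤ → (∀ z ∈ Z, Metric.closedBall z (2 * s) ⊆ V) →
      DerivLE i s M ψ → |T ψ| ≤ C * N * (M * volume.real V) := by
  obtain ⟨C, hC, h⟩ := exists_abs_le_integral n i
  refine ⟨C, hC, ?_⟩
  intro Y _ _ T N δ s M A Z V ψ hN hT hs hsδ hZ hψZ hZA hV hVfin hZV hM
  have h1 := h T N δ s A ψ (V.indicator fun _ => M) hN hT hs hsδ (fun x hx => hZA x (hψZ hx))
    ((integrable_indicator_iff hV).2 (integrableOn_const hVfin)) ?_
  · rwa [integral_indicator hV, setIntegral_const, smul_eq_mul, mul_comm (volume.real V)] at h1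
  · intro x y hy m hm
    by_cases hx : x ∈ V
    · rw [Set.indicator_of_mem hx]
      exact hM m hm y
    · have h0 : iteratedFDeriv ℝ m ψ y = 0 := by
        by_contra h0
        have hyZ : y ∈ Z := closure_minimal hψZ hZ (support_iteratedFDeriv_subset m h0)
        exact hx (hZV y hyZ (Metric.mem_closedBall_comm.1 hy))
      simp [h0, Set.indicator_of_notMem hx]

/-- A smooth cutoff to the `3s`-neighbourhood of `A`, equal to one on the `s`-neighbourhood. -/
def near (A : Set (EuclideanSpace ℝ (Fin n))) (s : ℝ) (ψ : TestFun n Y) : TestFun n Y :=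
  cut s (Metric.thickening (2 * s) A) Metric.isOpen_thickening.measurableSet ψ

theorem near_apply_of_lt (hA : A.Nonempty) (hs : 0 < s) (ψ : TestFun n Y)
    {x : EuclideanSpace ℝ (Fin n)} (hx : Metric.infDist x A < s) : near A s ψ x = ψ x := by
  rw [near, cut_apply, moll_eq_one hs, one_smul]
  intro t ht
  rw [Metric.mem_thickening_iff_infDist_lt hA]
  have := Metric.infDist_le_infDist_add_dist (x := t) (y := x) (s := A)
  rw [Metric.mem_closedBall] at ht
  linarith

theorem near_apply_of_gt (hA : A.Nonempty) (hs : 0 < s) (ψ : TestFun n Y)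
    {x : EuclideanSpace ℝ (Fin n)} (hx : 3 * s < Metric.infDist x A) : near A s ψ x = 0 := by
  rw [near, cut_apply, moll_eq_zero hs, zero_smul]
  intro t ht
  rw [Metric.mem_thickening_iff_infDist_lt hA] at ht
  have := Metric.infDist_le_infDist_add_dist (x := x) (y := t) (s := A)
  linarith

theorem near_add (s : ℝ) (φ ψ : TestFun n Y) : near A s (φ + ψ) = near A s φ + near A s ψ := by
  ext x; simp [near]

theorem near_smul (s c : ℝ) (ψ : TestFun n Y) : near A s (c • ψ) = c • near A s ψ := by
  ext x; simp [near, smul_comm c]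

theorem exists_derivLE_near (n i : ℕ) :
    ∃ C : ℝ, 0 < C ∧ ∀ {Y : Type*} [NormedAddCommGroup Y] [NormedSpace ℝ Y]
      (s M : ℝ) (A : Set (EuclideanSpace ℝ (Fin n))) (ψ : TestFun n Y), 0 < s → DerivLE i s M ψ →
        DerivLE i s (C * M) (near A s ψ) := by
  obtain ⟨C, hC, h⟩ := exists_derivLE_moll n i
  refine ⟨2 ^ i * C, by positivity, ?_⟩
  intro Y _ _ s M A ψ hs hM
  have := DerivLE.smul (contDiff_moll s Metric.isOpen_thickening.measurableSet) ψ.contDiff hs.le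
    (h s _ hs (Metric.isOpen_thickening (δ := 2 * s) (E := A)).measurableSet) hM
  rw [← mul_assoc] at this
  exact this

theorem DerivLE.sub {i : ℕ} {r M M' : ℝ} {f g : TestFun n Y} (hr : 0 ≤ r)
    (h : DerivLE i r M f) (h' : DerivLE i r M' g) :
    DerivLE i r (M + M') (f - g : TestFun n Y) := by
  have h1 := h'.const_smul (-1) g.contDiff
  have h2 := h.add hr f.contDiff (contDiff_const_smul (-1 : ℝ) |>.comp g.contDiff) h1
  simp only [abs_neg, abs_one, one_mul] at h2
  convert h2 using 1
  ext x
  simp [sub_eq_add_neg]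

/-- The volume of the part of the ball `B(a,R)` at positive distance at most `t` from `A`. -/
def shellVol (A : Set (EuclideanSpace ℝ (Fin n))) (a : EuclideanSpace ℝ (Fin n)) (R t : ℝ) : ℝ :=
  volume.real (Metric.closedBall a R ∩ {x | 0 < Metric.infDist x A ∧ Metric.infDist x A ≤ t})

theorem measurableSet_shell (A : Set (EuclideanSpace ℝ (Fin n))) (a : EuclideanSpace ℝ (Fin n))
    (R t : ℝ) : MeasurableSet (Metric.closedBall a R ∩
      {x | 0 < Metric.infDist x A ∧ Metric.infDist x A ≤ t}) := by
  have hd : Measurable fun x => Metric.infDist x A := (Metric.continuous_infDist_pt A).measurable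
  exact measurableSet_closedBall.inter
    ((measurableSet_lt measurable_const hd).inter (measurableSet_le hd measurable_const))

theorem measure_closedBall_inter_ne_top (a : EuclideanSpace ℝ (Fin n)) (R : ℝ)
    (S : Set (EuclideanSpace ℝ (Fin n))) : volume (Metric.closedBall a R ∩ S) ≠ ⊤ :=
  ((measure_mono Set.inter_subset_left).trans_lt measure_closedBall_lt_top).ne

theorem shellVol_mono (A : Set (EuclideanSpace ℝ (Fin n))) (a : EuclideanSpace ℝ (Fin n)) (R : ℝ) :
    Monotone (shellVol A a R) := fun _ _ htt =>
  measureReal_mono (Set.inter_subset_inter_right _ fun _ hx => ⟨hx.1, hx.2.trans htt⟩)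
    (measure_closedBall_inter_ne_top _ _ _)

theorem shellVol_le (hA : A.Nonempty) (a : EuclideanSpace ℝ (Fin n)) (R t : ℝ) :
    shellVol A a R t ≤ volume.real (Metric.closedBall a R \ closure A) := by
  refine measureReal_mono (fun x hx => ⟨hx.1, fun hxA => ?_⟩) (measure_closedBall_inter_ne_top _ _ _)
  have := hx.2.1
  rw [(Metric.mem_closure_iff_infDist_zero hA).1 hxA] at this
  exact lt_irrefl _ this

/-- Both cutoffs equal `ψ` closer than `s/2` to `A` and vanish beyond `3s`. The difference lives in
a shell, and only the volume of a slightly larger shell is charged. -/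
theorem exists_abs_near_sub_near_le (n i : ℕ) :
    ∃ C : ℝ, 0 < C ∧ ∀ {Y : Type*} [NormedAddCommGroup Y] [NormedSpace ℝ Y] (T : Distrib n Y)
      (N δ s M R R' : ℝ) (A : Set (EuclideanSpace ℝ (Fin n))) (a : EuclideanSpace ℝ (Fin n))
      (ψ : TestFun n Y), A.Nonempty → 0 ≤ N → UniformBoundOn i T N δ A → 0 < s → 5 * s < δ →
      Function.support ψ ⊆ Metric.closedBall a R → R + s ≤ R' → DerivLE i s M ψ →
      |T (near A s ψ) - T (near A (s / 2) ψ)| ≤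
        C * N * M * (shellVol A a R' (4 * s) - shellVol A a R' (s / 8)) := by
  obtain ⟨C₁, hC₁, h₁⟩ := exists_abs_le_measure n i
  obtain ⟨C₂, hC₂, h₂⟩ := exists_derivLE_near n i
  refine ⟨C₁ * (C₂ + C₂), by positivity, ?_⟩
  intro Y _ _ T N δ s M R R' A a ψ hA hN hT hs hsδ hψ hR hM
  rw [← map_sub]
  have hdc : Continuous fun x => Metric.infDist x A := Metric.continuous_infDist_pt A
  have hM' : DerivLE i (s / 8) (C₂ * M + C₂ * M) (near A s ψ - near A (s / 2) ψ : TestFun n Y) :=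
    DerivLE.sub (by positivity) ((h₂ s M A ψ hs hM).mono (by positivity) (by linarith))
      ((h₂ (s / 2) M A ψ (by positivity) (hM.mono (by positivity) (by linarith))).mono
        (by positivity) (by linarith))
  -- At the scale `s/8` the admissible distance to `A` is `32 (s/8) = 4s`, while the margin `2 (s/8)
  -- = s/4` leads from distances in `[s/2, 3s]` into `(s/8, 4s]`.
  have h3 := h₁ T N δ (s / 8) _ A
    (Metric.closedBall a R ∩ {x | s / 2 ≤ Metric.infDist x A ∧ Metric.infDist x A ≤ 3 * s})
    ((Metric.closedBall a R' ∩ {x | 0 < Metric.infDist x A ∧ Metric.infDist x A ≤ 4 * s}) \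
      (Metric.closedBall a R' ∩ {x | 0 < Metric.infDist x A ∧ Metric.infDist x A ≤ s / 8}))
    (near A s ψ - near A (s / 2) ψ) hN hT (by positivity) (by linarith) ?_ ?_ ?_ ?_ ?_ ?_ hM'
  · refine h3.trans_eq ?_
    have hsub : {x | 0 < Metric.infDist x A ∧ Metric.infDist x A ≤ s / 8} ⊆
        {x | 0 < Metric.infDist x A ∧ Metric.infDist x A ≤ 4 * s} := fun x hx =>
      ⟨hx.1, by linarith [hx.2]⟩
    rw [measureReal_sdiff (Set.inter_subset_inter_right _ hsub)
      (measurableSet_shell _ _ _ _) (measure_closedBall_inter_ne_top _ _ _)]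
    unfold shellVol
    ring
  · exact Metric.isClosed_closedBall.inter
      ((isClosed_le continuous_const hdc).inter (isClosed_le hdc continuous_const))
  · intro x hx
    have hx' : near A s ψ x - near A (s / 2) ψ x ≠ 0 := hx
    refine ⟨hψ ?_, ?_, ?_⟩
    · intro h0
      exact hx' (by simp [near, h0])
    · by_contra hcon
      rw [near_apply_of_lt hA hs ψ (by linarith), near_apply_of_lt hA (half_pos hs) ψ (by linarith),
        sub_self] at hx'
      exact hx' rfl
    · by_contra hcon
      rw [near_apply_of_gt hA hs ψ (by linarith), near_apply_of_gt hA (half_pos hs) ψ (by linarith),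
        sub_self] at hx'
      exact hx' rfl
  · intro x hx
    obtain ⟨b, hb, hxb⟩ := (Metric.infDist_lt_iff hA (r := 4 * s)).1
      (lt_of_le_of_lt hx.2.2 (by linarith))
    exact ⟨b, hb, by linarith⟩
  · exact (measurableSet_shell _ _ _ _).diff (measurableSet_shell _ _ _ _)
  · exact ((measure_mono Set.sdiff_subset).trans_lt
      (measure_closedBall_inter_ne_top _ _ _).lt_top).ne
  · intro z hz x hx
    rw [Metric.mem_closedBall] at hx
    have h4 := Metric.infDist_le_infDist_add_dist (x := x) (y := z) (s := A)
    have h5 := Metric.infDist_le_infDist_add_dist (x := z) (y := x) (s := A)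
    rw [dist_comm] at h5
    have h6 := Metric.mem_closedBall.1 hz.1
    have h7 := hz.2.1
    have h8 := hz.2.2
    refine ⟨⟨Metric.mem_closedBall.2 ?_, ?_, ?_⟩, fun hcon => ?_⟩
    · linarith [dist_triangle x z a]
    · linarith
    · linarith
    · linarith [hcon.2.2]

end

theorem exists_tendsto_near (n i : ℕ) :
    ∃ C : ℝ, 0 < C ∧ ∀ {Y : Type*} [NormedAddCommGroup Y] [NormedSpace ℝ Y] (T : Distrib n Y)
      (N δ M R R' r : ℝ) (A : Set (EuclideanSpace ℝ (Fin n))) (a : EuclideanSpace ℝ (Fin n))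
      (ψ : TestFun n Y) (j₀ : ℕ), A.Nonempty → 0 ≤ N → UniformBoundOn i T N δ A →
      (1 / 2 : ℝ) ^ j₀ ≤ r → 5 * (1 / 2 : ℝ) ^ j₀ < δ →
      Function.support ψ ⊆ Metric.closedBall a R → R + (1 / 2 : ℝ) ^ j₀ ≤ R' → DerivLE i r M ψ →
      ∃ L, Tendsto (fun j : ℕ => T (near A ((1 / 2) ^ j) ψ)) atTop (𝓝 L) ∧
        |T (near A ((1 / 2) ^ j₀) ψ) - L| ≤
          C * N * M * volume.real (Metric.closedBall a R' \ closure A) := by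
  obtain ⟨C, hC, h⟩ := exists_abs_near_sub_near_le n i
  refine ⟨5 * C, by positivity, ?_⟩
  intro Y _ _ T N δ M R R' r A a ψ j₀ hA hN hT hr hδ hψ hR hM
  have hM0 := hM.nonneg
  have hanti : Antitone fun j : ℕ => (1 / 2 : ℝ) ^ j :=
    pow_right_anti₀ (by norm_num) (by norm_num)
  obtain ⟨L, hL, hL'⟩ := exists_tendsto_of_telescoping
    (u := fun j : ℕ => T (near A ((1 / 2) ^ j) ψ))
    (g := fun j : ℕ => shellVol A a R' (4 * (1 / 2) ^ j)) (K := C * N * M) (j₀ := j₀)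
    (by positivity)
    (fun j j' hj => shellVol_mono A a R' (mul_le_mul_of_nonneg_left (hanti hj) (by norm_num)))
    (fun _ => measureReal_nonneg) (fun j hj => by
      have h1 := hanti hj
      simp only at h1
      have h2 := h T N δ ((1 / 2) ^ j) M R R' A a ψ hA hN hT (by positivity) (by linarith) hψ
        (by linarith) (hM.mono (by positivity) (h1.trans hr))
      -- The inner radius `s/8` is `4 · 2^(-(j+5))` for `s = 2^(-j)`; this is the shift by five in
      -- the telescoping.
      rw [show (1 / 2 : ℝ) ^ j / 2 = (1 / 2) ^ (j + 1) by ring,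
        show (1 / 2 : ℝ) ^ j / 8 = 4 * (1 / 2) ^ (j + 5) by ring] at h2
      exact h2)
  refine ⟨L, hL, hL'.trans ?_⟩
  have := shellVol_le hA a R' (4 * (1 / 2) ^ j₀)
  calc 5 * (C * N * M) * shellVol A a R' (4 * (1 / 2) ^ j₀)
      ≤ 5 * (C * N * M) * volume.real (Metric.closedBall a R' \ closure A) := by gcongr
    _ = _ := by ring

/-- The part removed by the cutoff keeps distance at least `s` from `A`. As `r` is comparable to
`s`, it still lies within `r + s ≤ 4s` of `A`, so its cost is the volume outside `closure A`. -/
theorem exists_abs_sub_near_le (n i : ℕ) :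
    ∃ C : ℝ, 0 < C ∧ ∀ {Y : Type*} [NormedAddCommGroup Y] [NormedSpace ℝ Y] (T : Distrib n Y)
      (N δ s r M : ℝ) (A : Set (EuclideanSpace ℝ (Fin n))) (a : EuclideanSpace ℝ (Fin n))
      (ψ : TestFun n Y), A.Nonempty → 0 ≤ N → UniformBoundOn i T N δ A → 0 < s → s ≤ r →
      r ≤ 2 * s → 5 * s < δ → a ∈ closure A →
      Function.support ψ ⊆ Metric.closedBall a r → DerivLE i r M ψ →
      |T ψ - T (near A s ψ)| ≤ C * N * M * volume.real (Metric.closedBall a (2 * r) \ closure A) := by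
  obtain ⟨C₁, hC₁, h₁⟩ := exists_abs_le_measure n i
  obtain ⟨C₂, hC₂, h₂⟩ := exists_derivLE_near n i
  refine ⟨C₁ * (1 + C₂), by positivity, ?_⟩
  intro Y _ _ T N δ s r M A a ψ hA hN hT hs hsr hrs hsδ ha hψ hM
  rw [← map_sub]
  have hdc : Continuous fun x => Metric.infDist x A := Metric.continuous_infDist_pt A
  have hM' : DerivLE i (s / 8) (M + C₂ * M) (ψ - near A s ψ : TestFun n Y) :=
    DerivLE.sub (by positivity) (hM.mono (by positivity) (by linarith))
      ((h₂ s M A ψ hs (hM.mono hs.le hsr)).mono (by positivity) (by linarith))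
  have h3 := h₁ T N δ (s / 8) _ A
    (Metric.closedBall a r ∩ {x | s ≤ Metric.infDist x A})
    (Metric.closedBall a (2 * r) \ closure A)
    (ψ - near A s ψ) hN hT (by positivity) (by linarith) ?_ ?_ ?_ ?_ ?_ ?_ hM'
  · exact h3.trans_eq (by ring)
  · exact Metric.isClosed_closedBall.inter (isClosed_le continuous_const hdc)
  · intro x hx
    have hx' : ψ x - near A s ψ x ≠ 0 := hx
    refine ⟨hψ ?_, ?_⟩
    · intro h0
      exact hx' (by simp [near, h0])
    · by_contra hcon
      rw [Set.mem_ofPred_eq, not_le] at hcon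
      rw [near_apply_of_lt hA hs ψ hcon, sub_self] at hx'
      exact hx' rfl
  · intro x hx
    obtain ⟨b, hb, hab⟩ := Metric.mem_closure_iff.1 ha s hs
    refine ⟨b, hb, ?_⟩
    have := Metric.mem_closedBall.1 hx.1
    linarith [dist_triangle x a b]
  · exact measurableSet_closedBall.diff isClosed_closure.measurableSet
  · exact measure_closedBall_inter_ne_top _ _ _
  · intro z hz x hx
    rw [Metric.mem_closedBall] at hx
    have h5 := Metric.infDist_le_infDist_add_dist (x := z) (y := x) (s := A)
    rw [dist_comm] at h5
    have h6 := Metric.mem_closedBall.1 hz.1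
    have h7 : s ≤ Metric.infDist z A := hz.2
    refine ⟨Metric.mem_closedBall.2 (by linarith [dist_triangle x z a]), fun hxA => ?_⟩
    rw [Metric.mem_closure_iff_infDist_zero hA] at hxA
    linarith

theorem TestFun.exists_lipschitz_bound (ψ : TestFun n Y) (i : ℕ) :
    ∃ K : ℝ, 0 < K ∧ (∀ x y, ‖ψ y‖ ≤ ‖ψ x‖ + K * dist x y) ∧
      ∀ m, 1 ≤ m → m ≤ i → ∀ x, ‖iteratedFDeriv ℝ m ψ x‖ ≤ K := by
  obtain ⟨K, hK, h⟩ := ψ.exists_derivLE (i + 1) 1 zero_le_one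
  refine ⟨K, hK, fun x y => ?_, fun m _ hm x => by simpa using h m (by omega) x⟩
  have h1 : ‖ψ y - ψ x‖ ≤ K * ‖y - x‖ :=
    convex_univ.norm_image_sub_le_of_norm_fderiv_le (𝕜 := ℝ)
      (fun z _ => (ψ.contDiff.differentiable (by simp)) z)
      (fun z _ => by simpa using h 1 (by omega) z) (Set.mem_univ x) (Set.mem_univ y)
  rw [dist_comm, dist_eq_norm]
  linarith [norm_le_norm_add_norm_sub' (ψ y) (ψ x)]

/-- At the scale `s` derivatives of `ψ` of positive order contribute only `O(s)`, and `ψ` varies by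
`O(s)` on `B(x, 2s)`. As `s → 0` only the `L¹` norm survives. The radius `ρ + 6` covers `4s + 2s`
beyond `A` for `s ≤ 1`. -/
theorem exists_abs_near_le_integral (n i : ℕ) :
    ∃ C : ℝ, 0 < C ∧ ∀ {Y : Type*} [NormedAddCommGroup Y] [NormedSpace ℝ Y] (T : Distrib n Y)
      (N δ ρ : ℝ) (A : Set (EuclideanSpace ℝ (Fin n))) (ψ : TestFun n Y), A.Nonempty → 0 ≤ N →
      UniformBoundOn i T N δ A → A ⊆ Metric.closedBall 0 ρ → ∃ K, ∀ s, 0 < s → s ≤ 1 → 36 * s < δ →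
      |T (near A s ψ)| ≤ C * N * ∫ x in Metric.closedBall 0 (ρ + 6), (‖ψ x‖ + K * s) := by
  obtain ⟨C₁, hC₁, h₁⟩ := exists_abs_le_integral n i
  obtain ⟨C₂, hC₂, h₂⟩ := exists_derivLE_moll n i
  refine ⟨C₁ * (2 ^ i * C₂), by positivity, ?_⟩
  intro Y _ _ T N δ ρ A ψ hA hN hT hAρ
  obtain ⟨K, hK, hlip, hder⟩ := ψ.exists_lipschitz_bound i
  refine ⟨2 * K, fun s hs hs1 hsδ => ?_⟩
  have hcont : Continuous fun x => ‖ψ x‖ + 2 * K * s := by fun_prop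
  have hint : IntegrableOn (fun x => 2 ^ i * C₂ * (‖ψ x‖ + 2 * K * s))
      (Metric.closedBall 0 (ρ + 6)) :=
    (continuous_const.mul hcont).continuousOn.integrableOn_compact (isCompact_closedBall _ _)
  have h3 := h₁ T N δ s A (near A s ψ) ((Metric.closedBall 0 (ρ + 6)).indicator
    fun x => 2 ^ i * C₂ * (‖ψ x‖ + 2 * K * s)) hN hT hs hsδ ?_
    ((integrable_indicator_iff measurableSet_closedBall).2 hint) ?_
  · rw [integral_indicator measurableSet_closedBall, integral_const_mul] at h3
    exact h3.trans_eq (by ring)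
  · intro x hx
    have hx3 : ¬ 3 * s < Metric.infDist x A := fun hcon =>
      hx (near_apply_of_gt hA hs ψ hcon)
    obtain ⟨b, hb, hxb⟩ := (Metric.infDist_lt_iff hA (r := 4 * s)).1
      (lt_of_le_of_lt (not_lt.1 hx3) (by linarith))
    exact ⟨b, hb, by linarith⟩
  · intro x y hy m hm
    rw [Metric.mem_closedBall] at hy
    by_cases hx : x ∈ Metric.closedBall 0 (ρ + 6)
    · rw [Set.indicator_of_mem hx, mul_assoc]
      refine norm_iteratedFDeriv_smul_le_of_le
        (contDiff_moll s Metric.isOpen_thickening.measurableSet) ψ.contDiff hs.le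
        (fun m hm => h₂ s _ hs Metric.isOpen_thickening.measurableSet m hm y) (fun l hl => ?_) hm
      rcases Nat.eq_zero_or_pos l with rfl | hl0
      · simp only [pow_zero, norm_iteratedFDeriv_zero, one_mul]
        have := hlip x y
        rw [dist_comm] at this
        nlinarith
      · have h4 : s ^ l ≤ s := by
          simpa using pow_le_pow_of_le_one hs.le hs1 hl0
        have h5 := hder l hl0 hl y
        have h6 := norm_nonneg (ψ x)
        have h7 : s ^ l * ‖iteratedFDeriv ℝ l ψ y‖ ≤ s * K := by gcongr
        nlinarith [mul_pos hs hK]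
    · have h0 : iteratedFDeriv ℝ m (near A s ψ) y = 0 := by
        by_contra h0
        have hyZ : y ∈ {z | Metric.infDist z A ≤ 3 * s} := by
          refine closure_minimal ?_ (isClosed_le (Metric.continuous_infDist_pt A) continuous_const)
            (support_iteratedFDeriv_subset m h0)
          intro z hz
          by_contra hcon
          exact hz (near_apply_of_gt hA hs ψ (not_le.1 hcon))
        obtain ⟨b, hb, hyb⟩ := (Metric.infDist_lt_iff hA (r := 4 * s)).1
          (lt_of_le_of_lt hyZ (by linarith))
        have h8 := Metric.mem_closedBall.1 (hAρ hb)
        apply hx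
        rw [Metric.mem_closedBall]
        linarith [dist_triangle x y 0, dist_triangle y b 0, dist_comm x y]
      rw [h0, Set.indicator_of_notMem hx, norm_zero, mul_zero]

/-- The part of a distribution that lives on a bounded set of uniform bounds. -/
theorem exists_near_limit (n i : ℕ) :
    ∃ C : ℝ, 0 < C ∧ ∀ {Y : Type*} [NormedAddCommGroup Y] [NormedSpace ℝ Y] (T : Distrib n Y)
      (N δ ρ : ℝ) (A : Set (EuclideanSpace ℝ (Fin n))), A.Nonempty → 0 ≤ N → 0 < δ →
      UniformBoundOn i T N δ A → A ⊆ Metric.closedBall 0 ρ →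
      ∃ F : TestFun n Y →ₗ[ℝ] ℝ,
        (∀ ψ, |F ψ| ≤ C * N * ∫ x in Metric.closedBall 0 (ρ + 6), ‖ψ x‖) ∧
        ∀ a ∈ closure A, ∀ r, 0 < r → r ≤ 1 → 5 * r < δ → ∀ (ψ : TestFun n Y) (M : ℝ),
          Function.support ψ ⊆ Metric.closedBall a r → DerivLE i r M ψ →
          |T ψ - F ψ| ≤ C * N * M * volume.real (Metric.closedBall a (2 * r) \ closure A) := by
  obtain ⟨C₁, hC₁, h₁⟩ := exists_tendsto_near n i
  obtain ⟨C₂, hC₂, h₂⟩ := exists_abs_sub_near_le n i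
  obtain ⟨C₃, hC₃, h₃⟩ := exists_abs_near_le_integral n i
  refine ⟨max (C₂ + C₁) C₃, by positivity, ?_⟩
  intro Y _ _ T N δ ρ A hA hN hδ hT hAρ
  have hpow : Tendsto (fun j : ℕ => (1 / 2 : ℝ) ^ j) atTop (𝓝 0) :=
    tendsto_pow_atTop_nhds_zero_of_lt_one (by norm_num) (by norm_num)
  have hex : ∀ ψ : TestFun n Y, ∃ L, Tendsto (fun j : ℕ => T (near A ((1 / 2) ^ j) ψ))
      atTop (𝓝 L) := fun ψ => by
    obtain ⟨R, hR, hψ⟩ := ψ.exists_support_subset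
    obtain ⟨M, hM, hψM⟩ := ψ.exists_derivLE i 1 zero_le_one
    obtain ⟨j₀, h4, h5⟩ := ((hpow.eventually_lt_const one_pos).and
      (hpow.eventually_lt_const (show 0 < δ / 5 by positivity))).exists
    obtain ⟨L, hL, -⟩ := h₁ T N δ M R (R + 1) 1 A 0 ψ j₀ hA hN hT h4.le (by linarith) hψ
      (by linarith) hψM
    exact ⟨L, hL⟩
  choose F hF using hex
  let F' : TestFun n Y →ₗ[ℝ] ℝ :=
    { toFun := F
      map_add' := fun φ ψ => tendsto_nhds_unique (hF (φ + ψ)) (by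
        simp only [near_add, map_add]
        exact (hF φ).add (hF ψ))
      map_smul' := fun c ψ => tendsto_nhds_unique (hF (c • ψ)) (by
        simp only [near_smul, map_smul]
        exact (hF ψ).const_smul c) }
  refine ⟨F', fun ψ => ?_, ?_⟩
  · obtain ⟨K, hK⟩ := h₃ T N δ ρ A ψ hA hN hT hAρ
    have hint : IntegrableOn (fun x => ‖ψ x‖) (Metric.closedBall 0 (ρ + 6)) :=
      ψ.integrable.norm.integrableOn
    have hlim : Tendsto (fun j : ℕ => C₃ * N * ∫ x in Metric.closedBall 0 (ρ + 6),
        (‖ψ x‖ + K * (1 / 2) ^ j)) atTop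
        (𝓝 (C₃ * N * ∫ x in Metric.closedBall 0 (ρ + 6), ‖ψ x‖)) := by
      have h6 : ∀ j : ℕ, ∫ x in Metric.closedBall (0 : EuclideanSpace ℝ (Fin n)) (ρ + 6),
          (‖ψ x‖ + K * (1 / 2) ^ j) = (∫ x in Metric.closedBall 0 (ρ + 6), ‖ψ x‖) +
            volume.real (Metric.closedBall (0 : EuclideanSpace ℝ (Fin n)) (ρ + 6)) *
              (K * (1 / 2) ^ j) := fun j => by
        rw [integral_add hint (integrableOn_const measure_closedBall_lt_top.ne),
          setIntegral_const, smul_eq_mul]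
      simp only [h6]
      refine Tendsto.const_mul _ ?_
      have h7 := (hpow.const_mul K).const_mul
        (volume.real (Metric.closedBall (0 : EuclideanSpace ℝ (Fin n)) (ρ + 6)))
      simp only [mul_zero] at h7
      simpa using h7.const_add (∫ x in Metric.closedBall 0 (ρ + 6), ‖ψ x‖)
    have h8 : |F ψ| ≤ C₃ * N * ∫ x in Metric.closedBall 0 (ρ + 6), ‖ψ x‖ := by
      refine le_of_tendsto_of_tendsto (hF ψ).abs hlim ?_
      filter_upwards [hpow.eventually_lt_const one_pos,
        hpow.eventually_lt_const (show 0 < δ / 36 by positivity)] with j h4 h5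
      exact hK _ (by positivity) h4.le (by linarith)
    have h9 : 0 ≤ ∫ x in Metric.closedBall 0 (ρ + 6), ‖ψ x‖ := integral_nonneg fun _ => norm_nonneg _
    refine h8.trans ?_
    gcongr
    exact le_max_right _ _
  · intro a ha r hr hr1 hrδ ψ M hψ hM
    -- A dyadic scale `s = 2^(-(m+1))` with `s ≤ r ≤ 2s`.
    obtain ⟨m, hm1, hm2⟩ := exists_nat_pow_near_of_lt_one hr hr1 (show (0 : ℝ) < 1 / 2 by norm_num)
      (by norm_num)
    have hm3 : (1 / 2 : ℝ) ^ m = 2 * (1 / 2) ^ (m + 1) := by ring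
    have h4 := h₂ T N δ ((1 / 2) ^ (m + 1)) r M A a ψ hA hN hT (by positivity) hm1.le
      (by linarith) (by linarith) ha hψ hM
    obtain ⟨L, hL, h5⟩ := h₁ T N δ M r (2 * r) r A a ψ (m + 1) hA hN hT hm1.le (by linarith) hψ
      (by linarith) hM
    have h6 : F ψ = L := tendsto_nhds_unique (hF ψ) hL
    have hM0 := hM.nonneg
    have h7 : 0 ≤ volume.real (Metric.closedBall a (2 * r) \ closure A) := measureReal_nonneg
    change |T ψ - F ψ| ≤ _
    rw [h6]
    calc |T ψ - L| ≤ |T ψ - T (near A ((1 / 2) ^ (m + 1)) ψ)| +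
          |T (near A ((1 / 2) ^ (m + 1)) ψ) - L| := abs_sub_le _ _ _
      _ ≤ (C₂ + C₁) * N * M * volume.real (Metric.closedBall a (2 * r) \ closure A) := by
        linarith
      _ ≤ _ := by gcongr; exact le_max_left _ _

/-! ### Lebesgue points and densities of functionals bounded in `L¹`. -/

/-- Lebesgue points. -/
theorem ae_integral_norm_sub_le {Z : Type*} [NormedAddCommGroup Z]
    {g : EuclideanSpace ℝ (Fin n) → Z} (hg : LocallyIntegrable g volume) :
    ∀ᵐ a ∂(volume : Measure (EuclideanSpace ℝ (Fin n))), ∀ ε, 0 < ε → ∃ δ, 0 < δ ∧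
      ∀ r, 0 < r → r < δ → ∫ x in Metric.closedBall a r, ‖g x - g a‖ ≤ ε * r ^ n := by
  filter_upwards [(Besicovitch.vitaliFamily volume).ae_tendsto_average_norm_sub hg] with a ha ε hε
  have h1 := ha.comp (Besicovitch.tendsto_filterAt volume a)
  set v := volume.real (Metric.closedBall (0 : EuclideanSpace ℝ (Fin n)) 1) with hv
  have hv0 : 0 < v := ENNReal.toReal_pos (Metric.measure_closedBall_pos _ _ one_pos).ne'
      measure_closedBall_lt_top.ne
  obtain ⟨δ, hδ, h2⟩ := mem_nhdsGT_iff_exists_Ioo_subset.1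
    (h1.eventually_lt_const (show 0 < ε / v by positivity))
  refine ⟨δ, hδ, fun r hr hrδ => ?_⟩
  have h3 : ⨍ y in Metric.closedBall a r, ‖g y - g a‖ < ε / v := h2 ⟨hr, hrδ⟩
  have h4 : volume.real (Metric.closedBall a r) = r ^ n * v := by
    rw [Measure.addHaar_real_closedBall' _ _ hr.le]
    simp [hv]
  rw [setAverage_eq, smul_eq_mul, h4, inv_mul_lt_iff₀ (by positivity)] at h3
  refine h3.le.trans_eq ?_
  field_simp

/-- Lebesgue points of the indicator of the complement of `S`, which vanishes at `a ∈ S`. -/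
theorem ae_measure_diff_le {S : Set (EuclideanSpace ℝ (Fin n))} (hS : MeasurableSet S) :
    ∀ᵐ a ∂(volume : Measure (EuclideanSpace ℝ (Fin n))), a ∈ S → ∀ ε, 0 < ε → ∃ δ, 0 < δ ∧
      ∀ r, 0 < r → r < δ → volume.real (Metric.closedBall a r \ S) ≤ ε * r ^ n := by
  have hg : LocallyIntegrable (Sᶜ.indicator fun _ : EuclideanSpace ℝ (Fin n) => (1 : ℝ)) volume :=
    (locallyIntegrable_const 1).indicator hS.compl
  filter_upwards [ae_integral_norm_sub_le hg] with a ha haS ε hε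
  obtain ⟨δ, hδ, h⟩ := ha ε hε
  refine ⟨δ, hδ, fun r hr hrδ => (h r hr hrδ).trans' (le_of_eq ?_)⟩
  have h1 : ∀ x, ‖Sᶜ.indicator (fun _ => (1 : ℝ)) x - Sᶜ.indicator (fun _ => (1 : ℝ)) a‖ =
      Sᶜ.indicator (fun _ => (1 : ℝ)) x := fun x => by
    rw [Set.indicator_of_notMem (a := a) (by simpa using haS), sub_zero, Real.norm_of_nonneg]
    exact Set.indicator_nonneg (fun _ _ => zero_le_one) _
  simp only [h1]
  rw [setIntegral_indicator hS.compl, setIntegral_const, smul_eq_mul, mul_one, Set.sdiff_eq]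

/-- A linear functional on `V` which is bounded by the norm of the image in `H` extends to `H`. -/
theorem exists_dual_of_bound {V H : Type*} [AddCommGroup V] [Module ℝ V] [NormedAddCommGroup H]
    [NormedSpace ℝ H] (ι : V →ₗ[ℝ] H) (ℓ : V →ₗ[ℝ] ℝ) {C : ℝ} (hC : 0 ≤ C)
    (h : ∀ v, |ℓ v| ≤ C * ‖ι v‖) : ∃ G : StrongDual ℝ H, ‖G‖ ≤ C ∧ ∀ v, ℓ v = G (ι v) := by
  have hker : LinearMap.ker ι ≤ LinearMap.ker ℓ := fun v hv => by
    have := h v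
    rw [LinearMap.mem_ker.1 hv, norm_zero, mul_zero] at this
    exact abs_nonpos_iff.1 this
  let ℓ' : LinearMap.range ι →ₗ[ℝ] ℝ :=
    (LinearMap.ker ι).liftQ ℓ hker ∘ₗ ι.quotKerEquivRange.symm.toLinearMap
  have hℓ' : ∀ v, ℓ' ⟨ι v, LinearMap.mem_range_self ι v⟩ = ℓ v := fun v => by
    have : ι.quotKerEquivRange.symm ⟨ι v, LinearMap.mem_range_self ι v⟩ =
        (LinearMap.ker ι).mkQ v := by
      rw [LinearEquiv.symm_apply_eq]
      rfl
    change (LinearMap.ker ι).liftQ ℓ hker (ι.quotKerEquivRange.symm _) = _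
    rw [this]
    simp
  have hb : ∀ x, ‖ℓ' x‖ ≤ C * ‖x‖ := by
    rintro ⟨_, v, rfl⟩
    rw [hℓ' v]
    exact h v
  obtain ⟨G, hG, hn⟩ := exists_extension_norm_eq (LinearMap.range ι) (ℓ'.mkContinuous C hb)
  refine ⟨G, hn.trans_le (LinearMap.mkContinuous_norm_le _ hC _), fun v => ?_⟩
  rw [← hℓ' v]
  exact (hG ⟨ι v, LinearMap.mem_range_self ι v⟩).symm

theorem TestFun.memLp_two (ψ : TestFun n ℝ) : MemLp ψ 2 volume :=
  ψ.continuous.memLp_of_hasCompactSupport ψ.hasCompactSupport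

/-- A functional on scalar test functions that is bounded in `L¹` of a ball is given by a locally
integrable function. -/
theorem exists_density (F : TestFun n ℝ →ₗ[ℝ] ℝ) {C R : ℝ} (hC : 0 ≤ C)
    (hF : ∀ ψ, |F ψ| ≤ C * ∫ x in Metric.closedBall 0 R, ‖ψ x‖) :
    ∃ g : EuclideanSpace ℝ (Fin n) → ℝ, Measurable g ∧ LocallyIntegrable g volume ∧
      ∀ ψ, F ψ = ∫ x, g x * ψ x := by
  let ι : TestFun n ℝ →ₗ[ℝ] Lp ℝ 2 (volume : Measure (EuclideanSpace ℝ (Fin n))) :=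
    { toFun := fun ψ => ψ.memLp_two.toLp ψ
      map_add' := fun φ ψ => MemLp.toLp_add φ.memLp_two ψ.memLp_two
      map_smul' := fun c ψ => MemLp.toLp_const_smul c ψ.memLp_two }
  have hι : ∀ ψ, ι ψ =ᵐ[volume] ψ := fun ψ => ψ.memLp_two.coeFn_toLp
  let B := Metric.closedBall (0 : EuclideanSpace ℝ (Fin n)) R
  let e := indicatorConstLp 2 (measurableSet_closedBall (x := (0 : EuclideanSpace ℝ (Fin n)))
    (ε := R)) (μ := volume) measure_closedBall_lt_top.ne (1 : ℝ)
  -- On a ball the `L¹` norm is at most the `L²` norm times that of the indicator `e`, so the Riesz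
  -- representation in the Hilbert space `L²` provides the density.
  obtain ⟨G, -, hG⟩ := exists_dual_of_bound ι F (C := C * ‖e‖) (by positivity) (fun ψ => by
    have h1 : ∫ x in Metric.closedBall 0 R, ‖ψ x‖ = inner ℝ e |ι ψ| := by
      rw [L2.inner_indicatorConstLp_one]
      refine integral_congr_ae (ae_restrict_of_ae ?_)
      filter_upwards [hι ψ, Lp.coeFn_abs (ι ψ)] with x h2 h3
      rw [h3, h2, Real.norm_eq_abs]
    have h4 := real_inner_le_norm e |ι ψ|
    rw [norm_abs_eq_norm] at h4
    refine (hF ψ).trans ?_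
    rw [h1, mul_assoc]
    gcongr)
  let g := (InnerProductSpace.toDual ℝ _).symm G
  refine ⟨g, (Lp.stronglyMeasurable g).measurable,
    (Lp.memLp g).locallyIntegrable one_le_two, fun ψ => ?_⟩
  rw [hG ψ, ← InnerProductSpace.toDual_symm_apply, L2.inner_def]
  refine integral_congr_ae ?_
  filter_upwards [hι ψ] with x hx
  rw [hx]
  simp [g, mul_comm]

theorem moll_empty (s : ℝ) (x : EuclideanSpace ℝ (Fin n)) : moll s ∅ x = 0 := by
  simp [moll, indConv]

/-- Uniform approximation of test functions by sums of test functions of the form `g • y`. -/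
theorem TestFun.induction_on_tensor {D : Set Y} (hD : Dense D) {p : TestFun n Y → Prop}
    (tensor : ∀ (g : TestFun n ℝ), ∀ y ∈ D, p (g.tensor y))
    (add : ∀ φ ψ : TestFun n Y, p φ → p ψ → p (φ + ψ))
    (closed : ∀ (φ : TestFun n Y) (R : ℝ), Function.support φ ⊆ Metric.closedBall 0 R → (∀ ε, 0 < ε → ∃ ψ, p ψ ∧
      Function.support ψ ⊆ Metric.closedBall 0 R ∧ ∀ x, ‖φ x - ψ x‖ ≤ ε) → p φ)
    (φ : TestFun n Y) : p φ := by
  obtain ⟨R, hR, hφ⟩ := φ.exists_support_subset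
  obtain ⟨K, hK, hder⟩ := φ.exists_derivLE 1 1 zero_le_one
  have hlip' : ∀ x y, ‖φ x - φ y‖ ≤ K * dist x y := fun x y => by
    rw [dist_eq_norm]
    exact convex_univ.norm_image_sub_le_of_norm_fderiv_le (𝕜 := ℝ)
      (fun z _ => (φ.contDiff.differentiable (by simp)) z)
      (fun z _ => by simpa using hder 1 le_rfl z) (Set.mem_univ y) (Set.mem_univ x)
  refine closed φ (R + 2) (hφ.trans (Metric.closedBall_subset_closedBall (by linarith)))
    fun ε hε => ?_
  obtain ⟨s, hs, hs1, hsK⟩ : ∃ s : ℝ, 0 < s ∧ s ≤ 1 ∧ K * (2 * s) ≤ ε / 2 := by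
    refine ⟨min 1 (ε / (4 * K)), by positivity, min_le_left _ _, ?_⟩
    calc K * (2 * min 1 (ε / (4 * K))) ≤ K * (2 * (ε / (4 * K))) := by
          gcongr; exact min_le_right _ _
      _ = ε / 2 := by field_simp; norm_num
  -- The permitted error `ε * moll s Q x` is additive in `Q`, so errors of the pieces sum to at most
  -- `ε`. On a small `Q` the approximant is `moll s Q` times an element of `D` close to a value of
  -- `φ`.
  obtain ⟨U, hU, hKU, h⟩ : ∃ U, MeasurableSet U ∧ Metric.closedBall 0 (R + s) ⊆ U ∧
      ∀ Q, MeasurableSet Q → Q ⊆ U → ∃ χ : TestFun n Y, p χ ∧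
        ∀ x, ‖moll s Q x • φ x - χ x‖ ≤ ε * moll s Q x := by
    refine (isCompact_closedBall (0 : EuclideanSpace ℝ (Fin n)) (R + s)).induction_on
      (p := fun S => ∃ U, MeasurableSet U ∧ S ⊆ U ∧
      ∀ Q, MeasurableSet Q → Q ⊆ U → ∃ χ : TestFun n Y, p χ ∧
        ∀ x, ‖moll s Q x • φ x - χ x‖ ≤ ε * moll s Q x) ?_ ?_ ?_ ?_
    · refine ⟨∅, MeasurableSet.empty, le_rfl, fun Q hQ hQe => ?_⟩
      have hQe := Set.subset_empty_iff.1 hQe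
      subst hQe
      obtain ⟨y, hy⟩ := hD.nonempty
      exact ⟨_, tensor 0 y hy, fun x => by simp [moll_empty]⟩
    · rintro S S' hS ⟨U, hU, hSU, h⟩
      exact ⟨U, hU, hS.trans hSU, h⟩
    · rintro S S' ⟨U, hU, hSU, h⟩ ⟨U', hU', hSU', h'⟩
      refine ⟨U ∪ U', hU.union hU', Set.union_subset_union hSU hSU', fun Q hQ hQU => ?_⟩
      obtain ⟨χ, hχ, h1⟩ := h (Q ∩ U) (hQ.inter hU) Set.inter_subset_right
      obtain ⟨χ', hχ', h2⟩ := h' (Q \ U) (hQ.diff hU) fun x hx => (hQU hx.1).resolve_left hx.2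
      refine ⟨χ + χ', add _ _ hχ hχ', fun x => ?_⟩
      have h3 := moll_union (s := s) (hQ.diff hU)
        (Set.disjoint_sdiff_left.symm.mono_left Set.inter_subset_right : Disjoint (Q ∩ U) (Q \ U)) x
      rw [Set.inter_union_sdiff] at h3
      rw [h3, add_smul, mul_add]
      calc _ = ‖(moll s (Q ∩ U) x • φ x - χ x) + (moll s (Q \ U) x • φ x - χ' x)‖ := by
            congr 1
            rw [_root_.add_apply]
            abel
        _ ≤ _ := (norm_add_le _ _).trans (add_le_add (h1 x) (h2 x))
    · intro x₀ _
      refine ⟨Metric.closedBall x₀ (s / 2), mem_nhdsWithin_of_mem_nhds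
        (Metric.closedBall_mem_nhds _ (half_pos hs)), _, measurableSet_closedBall, le_rfl,
        fun Q hQ hQx => ?_⟩
      obtain ⟨y, hy, hyD⟩ := Metric.mem_closure_iff.1 (hD (φ x₀)) (ε / 2) (half_pos hε)
      have hsup := support_moll_subset hs hQx
      refine ⟨_, tensor (TestFun.ofSupport (moll s Q) (contDiff_moll s hQ)
        (HasCompactSupport.of_support_subset_isCompact (isCompact_closedBall _ _) hsup)) y hy,
        fun x => ?_⟩
      rw [TestFun.tensor_apply, TestFun.ofSupport_apply, ← smul_sub, norm_smul,
        Real.norm_of_nonneg (moll_nonneg hs x), mul_comm]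
      by_cases hx : moll s Q x = 0
      · simp [hx]
      · refine mul_le_mul_of_nonneg_right ?_ (moll_nonneg hs x)
        have h4 := Metric.mem_closedBall.1 (hsup hx)
        rw [dist_eq_norm] at hyD
        calc ‖φ x - y‖ ≤ ‖φ x - φ x₀‖ + ‖φ x₀ - y‖ := norm_sub_le_norm_sub_add_norm_sub _ _ _
          _ ≤ K * (2 * s) + ε / 2 := by
              refine add_le_add ((hlip' x x₀).trans ?_) hyD.le
              gcongr
              linarith
          _ ≤ ε := by linarith
  obtain ⟨χ, hχ, h1⟩ := h _ measurableSet_closedBall hKU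
  refine ⟨χ, hχ, fun x hx => ?_, fun x => ?_⟩
  · by_contra hcon
    have h2 : moll s (Metric.closedBall 0 (R + s)) x = 0 := by
      by_contra h2
      refine hcon (Metric.closedBall_subset_closedBall ?_ (support_moll_subset hs le_rfl h2))
      linarith
    have h3 := h1 x
    rw [h2, zero_smul, zero_sub, norm_neg, mul_zero, norm_le_zero_iff] at h3
    exact hx h3
  · have h2 : moll s (Metric.closedBall 0 (R + s)) x • φ x = φ x := by
      by_cases hx : φ x = 0
      · simp [hx]
      · rw [moll_eq_one hs, one_smul]
        refine Metric.closedBall_subset_closedBall' ?_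
        have := Metric.mem_closedBall.1 (hφ hx)
        linarith
    have h3 := h1 x
    rw [h2] at h3
    exact h3.trans (mul_le_of_le_one_right hε.le (moll_le_one hs x))

theorem volume_real_closedBall (a : EuclideanSpace ℝ (Fin n)) {r : ℝ} (hr : 0 ≤ r) :
    volume.real (Metric.closedBall a r) =
      r ^ n * volume.real (Metric.closedBall (0 : EuclideanSpace ℝ (Fin n)) 1) := by
  rw [Measure.addHaar_real_closedBall' _ _ hr]
  simp

theorem integral_norm_le_of_support {ψ : TestFun n Y} {a : EuclideanSpace ℝ (Fin n)} {r M : ℝ}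
    (hr : 0 ≤ r) (hψ : Function.support ψ ⊆ Metric.closedBall a r) (hM : ∀ x, ‖ψ x‖ ≤ M) :
    ∫ x, ‖ψ x‖ ≤
      M * (r ^ n * volume.real (Metric.closedBall (0 : EuclideanSpace ℝ (Fin n)) 1)) := by
  rw [← volume_real_closedBall a hr, ← setIntegral_eq_integral_of_forall_compl_eq_zero
    (s := Metric.closedBall a r)]
  · refine (le_abs_self _).trans ?_
    rw [← Real.norm_eq_abs]
    exact norm_setIntegral_le_of_norm_le_const measure_closedBall_lt_top
      (fun x _ => by simpa using hM x)
  · intro x hx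
    rw [norm_eq_zero]
    by_contra h
    exact hx (hψ h)

/-- Pairing of a locally integrable function with test functions near a point. -/
theorem abs_integral_sub_le_of_support {Z : Type*} [NormedAddCommGroup Z] [NormedSpace ℝ Z]
    (B : Z →L[ℝ] Y →L[ℝ] ℝ) (hB : ∀ z y, ‖B z y‖ ≤ ‖z‖ * ‖y‖)
    {g : EuclideanSpace ℝ (Fin n) → Z} (hg : LocallyIntegrable g volume) {ψ : TestFun n Y}
    {a : EuclideanSpace ℝ (Fin n)} {r M : ℝ}
    (hψ : Function.support ψ ⊆ Metric.closedBall a r) (hM : ∀ x, ‖ψ x‖ ≤ M) :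
    |(∫ x, B (g x) (ψ x)) - ∫ x, B (g a) (ψ x)| ≤
      M * ∫ x in Metric.closedBall a r, ‖g x - g a‖ := by
  have hgi : IntegrableOn g (Metric.closedBall a r) :=
    hg.integrableOn_isCompact (isCompact_closedBall _ _)
  have hsub : ∀ f : EuclideanSpace ℝ (Fin n) → Z, ∀ x ∉ Metric.closedBall a r,
      B (f x) (ψ x) = 0 := fun f x hx => by
    have : ψ x = 0 := by
      by_contra h
      exact hx (hψ h)
    rw [this, map_zero]
  have hint : ∀ f : EuclideanSpace ℝ (Fin n) → Z, IntegrableOn f (Metric.closedBall a r) →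
      IntegrableOn (fun x => B (f x) (ψ x)) (Metric.closedBall a r) := fun f hf => by
    refine Integrable.mono' (hf.norm.mul_const M) ?_ ?_
    · exact B.aestronglyMeasurable_comp₂ hf.aestronglyMeasurable
        ψ.continuous.aestronglyMeasurable
    · exact Eventually.of_forall fun x => (hB _ _).trans
        (mul_le_mul_of_nonneg_left (hM x) (norm_nonneg _))
  have hconst : IntegrableOn (fun _ : EuclideanSpace ℝ (Fin n) => g a) (Metric.closedBall a r) :=
    integrableOn_const measure_closedBall_lt_top.ne
  rw [← setIntegral_eq_integral_of_forall_compl_eq_zero (hsub g),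
    ← setIntegral_eq_integral_of_forall_compl_eq_zero (hsub fun _ => g a),
    ← integral_sub (hint g hgi) (hint _ hconst), ← integral_const_mul]
  rw [← Real.norm_eq_abs]
  refine norm_integral_le_of_norm_le ((hgi.sub hconst).norm.const_mul M)
    (Eventually.of_forall fun x => ?_)
  rw [← _root_.sub_apply, ← map_sub, mul_comm]
  exact (hB _ _).trans (mul_le_mul_of_nonneg_left (hM x) (norm_nonneg _))

theorem TestFun.exists_norm_le (φ : TestFun n Y) : ∃ M : ℝ, 0 < M ∧ ∀ x, ‖φ x‖ ≤ M := by
  obtain ⟨M, hM, h⟩ := φ.exists_derivLE 0 1 zero_le_one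
  exact ⟨M, hM, fun x => by simpa using h 0 le_rfl x⟩

theorem norm_rescale_le {φ : TestFun n Y} {M : ℝ} (hM : ∀ x, ‖φ x‖ ≤ M)
    (a : EuclideanSpace ℝ (Fin n)) {r : ℝ} (hr : r ≠ 0) (x : EuclideanSpace ℝ (Fin n)) :
    ‖rescale φ a r x‖ ≤ M := by
  rw [rescale_apply _ _ hr]
  exact hM _

theorem rescale_tensor (φ : TestFun n ℝ) (y : Y) (a : EuclideanSpace ℝ (Fin n)) {r : ℝ}
    (hr : r ≠ 0) : rescale (φ.tensor y) a r = (rescale φ a r).tensor y := by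
  ext x
  simp [rescale_apply _ _ hr]

theorem integral_rescale (φ : TestFun n ℝ) (a : EuclideanSpace ℝ (Fin n)) {r : ℝ} (hr : 0 < r) :
    ∫ x, rescale φ a r x = r ^ n * ∫ x, φ x := by
  simp only [rescale_apply _ _ hr.ne']
  rw [integral_sub_right_eq_self (fun x => φ (r⁻¹ • x)) a, Measure.integral_comp_inv_smul]
  simp [abs_of_pos hr]

theorem integral_dual_tensor (f : StrongDual ℝ Y) (φ : TestFun n ℝ) (y : Y) :
    ∫ x, f (φ.tensor y x) = f y * ∫ x, φ x := by
  simp only [TestFun.tensor_apply, map_smul, smul_eq_mul]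
  rw [integral_mul_const, mul_comm]

/-- Approximation of the integral near a Lebesgue point. -/
theorem exists_abs_integral_rescale_sub_le {Z : Type*} [NormedAddCommGroup Z] [NormedSpace ℝ Z]
    (B : Z →L[ℝ] Y →L[ℝ] ℝ) (hB : ∀ z y, ‖B z y‖ ≤ ‖z‖ * ‖y‖)
    {g : EuclideanSpace ℝ (Fin n) → Z} (hg : LocallyIntegrable g volume)
    {a : EuclideanSpace ℝ (Fin n)} (ha : ∀ ε, 0 < ε → ∃ δ, 0 < δ ∧
      ∀ r, 0 < r → r < δ → ∫ x in Metric.closedBall a r, ‖g x - g a‖ ≤ ε * r ^ n)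
    (φ : TestFun n Y) {ε : ℝ} (hε : 0 < ε) : ∃ δ, 0 < δ ∧ ∀ r, 0 < r → r < δ →
      |(∫ x, B (g x) (rescale φ a r x)) - ∫ x, B (g a) (rescale φ a r x)| ≤ ε * r ^ n := by
  obtain ⟨R, hR, hφ⟩ := φ.exists_support_subset
  obtain ⟨M, hM, hφM⟩ := φ.exists_norm_le
  obtain ⟨δ, hδ, h⟩ := ha (ε / (M * R ^ n)) (by positivity)
  refine ⟨δ / R, by positivity, fun r hr hrδ => ?_⟩
  have h1 := abs_integral_sub_le_of_support B hB hg (support_rescale hφ a hr)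
    (norm_rescale_le hφM a hr.ne')
  refine h1.trans ?_
  calc M * ∫ x in Metric.closedBall a (R * r), ‖g x - g a‖
      ≤ M * (ε / (M * R ^ n) * (R * r) ^ n) := by
        gcongr
        exact h _ (by positivity) (by rwa [lt_div_iff₀ hR, mul_comm] at hrδ)
    _ = ε * r ^ n := by
        rw [mul_pow]
        field_simp

/-- Existence of weak densities of functionals that are bounded in `L¹`. -/
theorem ae_exists_weak_density [SeparableSpace Y] (F : TestFun n Y →ₗ[ℝ] ℝ) {C : ℝ} (hC : 0 ≤ C)
    (hF : ∀ ψ, |F ψ| ≤ C * ∫ x, ‖ψ x‖) (g : ℕ → EuclideanSpace ℝ (Fin n) → ℝ)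
    (hg : ∀ m, LocallyIntegrable (g m) volume)
    (hgF : ∀ m (ψ : TestFun n ℝ), F (ψ.tensor (denseSeq Y m)) = ∫ x, g m x * ψ x) :
    ∀ᵐ a ∂(volume : Measure (EuclideanSpace ℝ (Fin n))), ∃ f : StrongDual ℝ Y, ‖f‖ ≤ C ∧
      (∀ m, f (denseSeq Y m) = g m a) ∧ ∀ φ : TestFun n Y, ∀ ε, 0 < ε → ∃ δ, 0 < δ ∧
        ∀ r, 0 < r → r < δ → |F (rescale φ a r) - ∫ x, f (rescale φ a r x)| ≤ ε * r ^ n := by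
  filter_upwards [ae_all_iff.2 fun m => ae_integral_norm_sub_le (hg m)] with a ha
  have hten : ∀ m (φ : TestFun n ℝ) ε, 0 < ε → ∃ δ, 0 < δ ∧ ∀ r, 0 < r → r < δ →
      |F (rescale (φ.tensor (denseSeq Y m)) a r) - g m a * ∫ x, rescale φ a r x| ≤ ε * r ^ n := by
    intro m φ ε hε
    obtain ⟨δ, hδ, h⟩ := exists_abs_integral_rescale_sub_le (ContinuousLinearMap.mul ℝ ℝ)
      (fun z y => by simp) (hg m) (ha m) φ hε
    refine ⟨δ, hδ, fun r hr hrδ => ?_⟩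
    rw [rescale_tensor _ _ _ hr.ne', hgF, ← integral_const_mul]
    exact h r hr hrδ
  -- Formal combinations are used because the dense sequence may be linearly dependent; the bound by
  -- the norm of the image makes the values consistent.
  let ι : (ℕ →₀ ℝ) →ₗ[ℝ] Y := Finsupp.linearCombination ℝ (denseSeq Y)
  let ℓ : (ℕ →₀ ℝ) →ₗ[ℝ] ℝ := Finsupp.linearCombination ℝ fun m => g m a
  -- Rescaled mollifiers recover `ℓ v` as a limit of values of `F` divided by `r ^ n`. As the
  -- mollifier is nonnegative with integral one, the `L¹` bound of `F` passes to `|ℓ v| ≤ C ‖ι v‖`.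
  have happ : ∀ v : ℕ →₀ ℝ, ∀ ε, 0 < ε → ∃ δ, 0 < δ ∧ ∀ r, 0 < r → r < δ →
      |F (rescale ((mollifier n).tensor (ι v)) a r) - ℓ v * r ^ n| ≤ ε * r ^ n := by
    intro v
    induction v using Finsupp.induction_linear with
    | zero =>
      intro ε hε
      refine ⟨1, one_pos, fun r hr _ => ?_⟩
      have : rescale ((mollifier n).tensor (ι 0)) a r = 0 := by
        ext x
        simp [rescale_apply _ _ hr.ne']
      rw [this]
      simp only [map_zero, zero_mul, sub_zero, abs_zero]
      positivity
    | add v w hv hw =>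
      intro ε hε
      obtain ⟨δ, hδ, h1⟩ := hv (ε / 2) (half_pos hε)
      obtain ⟨δ', hδ', h2⟩ := hw (ε / 2) (half_pos hε)
      refine ⟨min δ δ', lt_min hδ hδ', fun r hr hrδ => ?_⟩
      have h3 := h1 r hr (hrδ.trans_le (min_le_left _ _))
      have h4 := h2 r hr (hrδ.trans_le (min_le_right _ _))
      have h5 : rescale ((mollifier n).tensor (ι (v + w))) a r =
          rescale ((mollifier n).tensor (ι v)) a r + rescale ((mollifier n).tensor (ι w)) a r := by
        rw [← rescale_add]
        congr 1
        ext x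
        simp
      rw [h5, map_add, map_add, abs_le] at *
      constructor <;> linarith [h3.1, h3.2, h4.1, h4.2]
    | single m c =>
      intro ε hε
      obtain ⟨δ, hδ, h⟩ := hten m (mollifier n) (ε / (|c| + 1)) (by positivity)
      refine ⟨δ, hδ, fun r hr hrδ => ?_⟩
      have h1 : rescale ((mollifier n).tensor (ι (Finsupp.single m c))) a r =
          c • rescale ((mollifier n).tensor (denseSeq Y m)) a r := by
        rw [← rescale_smul]
        congr 1
        ext x
        simp [ι, smul_comm c]
      have h2 := h r hr hrδ
      rw [integral_rescale _ _ hr, integral_mollifier, mul_one] at h2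
      rw [h1, map_smul, smul_eq_mul]
      have h3 : c * F (rescale ((mollifier n).tensor (denseSeq Y m)) a r) -
          ℓ (Finsupp.single m c) * r ^ n =
          c * (F (rescale ((mollifier n).tensor (denseSeq Y m)) a r) - g m a * r ^ n) := by
        simp [ℓ]
        ring
      rw [h3, abs_mul]
      calc |c| * _ ≤ |c| * (ε / (|c| + 1) * r ^ n) := by gcongr
        _ ≤ (|c| + 1) * (ε / (|c| + 1) * r ^ n) := by gcongr; linarith
        _ = ε * r ^ n := by field_simp
  obtain ⟨f, hf, hfv⟩ := exists_dual_of_bound ι ℓ hC (fun v => by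
    refine le_of_forall_pos_le_add fun ε hε => ?_
    obtain ⟨δ, hδ, h⟩ := happ v ε hε
    have h1 := h (δ / 2) (half_pos hδ) (half_lt_self hδ)
    have h2 := hF (rescale ((mollifier n).tensor (ι v)) a (δ / 2))
    have hδ2 : 0 < δ / 2 := half_pos hδ
    have h3 : ∫ x, ‖rescale ((mollifier n).tensor (ι v)) a (δ / 2) x‖ = (δ / 2) ^ n * ‖ι v‖ := by
      rw [rescale_tensor _ _ _ hδ2.ne']
      simp only [TestFun.tensor_apply, norm_smul]
      rw [integral_mul_const]
      congr 1
      have := integral_rescale (mollifier n) a hδ2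
      rw [integral_mollifier, mul_one] at this
      rw [← this]
      congr 1 with x
      rw [rescale_apply _ _ hδ2.ne', Real.norm_of_nonneg (mollifier_nonneg _)]
    rw [h3] at h2
    have h4 : 0 < (δ / 2) ^ n := by positivity
    have h5 : |ℓ v| * (δ / 2) ^ n ≤ (C * ‖ι v‖ + ε) * (δ / 2) ^ n := by
      rw [← abs_of_pos h4, ← abs_mul, abs_of_pos h4]
      have := abs_sub_abs_le_abs_sub (ℓ v * (δ / 2) ^ n)
        (F (rescale ((mollifier n).tensor (ι v)) a (δ / 2)))
      rw [abs_sub_comm] at this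
      nlinarith
    exact le_of_mul_le_mul_right h5 h4)
  have hfm : ∀ m, f (denseSeq Y m) = g m a := fun m => by
    have := hfv (Finsupp.single m 1)
    simpa [ι, ℓ] using this.symm
  refine ⟨f, hf, hfm, fun φ => ?_⟩
  set v₁ := volume.real (Metric.closedBall (0 : EuclideanSpace ℝ (Fin n)) 1)
  -- Uniform approximation within a fixed ball changes both terms by a small multiple of `r ^ n`,
  -- uniformly in `r`, thanks to the `L¹` bounds of `F` and of `f`.
  refine φ.induction_on_tensor (denseRange_denseSeq Y) (p := fun φ => ∀ ε, 0 < ε → ∃ δ, 0 < δ ∧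
    ∀ r, 0 < r → r < δ → |F (rescale φ a r) - ∫ x, f (rescale φ a r x)| ≤ ε * r ^ n) ?_ ?_ ?_
  · rintro φ _ ⟨m, rfl⟩ ε hε
    obtain ⟨δ, hδ, h⟩ := hten m φ ε hε
    refine ⟨δ, hδ, fun r hr hrδ => ?_⟩
    have := h r hr hrδ
    rw [rescale_tensor _ _ _ hr.ne'] at this ⊢
    rwa [integral_dual_tensor, hfm]
  · intro φ ψ hφ hψ ε hε
    obtain ⟨δ, hδ, h1⟩ := hφ (ε / 2) (half_pos hε)
    obtain ⟨δ', hδ', h2⟩ := hψ (ε / 2) (half_pos hε)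
    refine ⟨min δ δ', lt_min hδ hδ', fun r hr hrδ => ?_⟩
    have h3 := h1 r hr (hrδ.trans_le (min_le_left _ _))
    have h4 := h2 r hr (hrδ.trans_le (min_le_right _ _))
    have h5 : ∫ x, f (rescale (φ + ψ) a r x) =
        (∫ x, f (rescale φ a r x)) + ∫ x, f (rescale ψ a r x) := by
      rw [← integral_add (f.integrable_comp (rescale φ a r).integrable)
        (f.integrable_comp (rescale ψ a r).integrable)]
      simp [rescale_add]
    rw [h5, rescale_add, map_add]
    rw [abs_le] at *
    constructor <;> linarith [h3.1, h3.2, h4.1, h4.2]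
  · intro φ R hφ hcl ε hε
    have hR : 0 ≤ |R| := abs_nonneg R
    have hv : 0 ≤ v₁ := measureReal_nonneg
    obtain ⟨ψ, hψ, hψR, hφψ⟩ := hcl (ε / (4 * ((C + 1) * (|R| ^ n * v₁ + 1)))) (by positivity)
    obtain ⟨δ, hδ, h⟩ := hψ (ε / 2) (half_pos hε)
    refine ⟨δ, hδ, fun r hr hrδ => ?_⟩
    have h1 := h r hr hrδ
    have hsup : Function.support (φ - ψ : TestFun n Y) ⊆ Metric.closedBall 0 |R| := fun x hx => by
      refine Metric.closedBall_subset_closedBall (le_abs_self R) ?_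
      by_contra hcon
      refine hx ?_
      have e1 : φ x = 0 := by
        by_contra h
        exact hcon (hφ h)
      have e2 : ψ x = 0 := by
        by_contra h
        exact hcon (hψR h)
      simp [e1, e2]
    have h2 := integral_norm_le_of_support (by positivity) (support_rescale hsup a hr)
      (norm_rescale_le (M := ε / (4 * ((C + 1) * (|R| ^ n * v₁ + 1)))) (fun x => hφψ x) a hr.ne')
    have h3 : (C + 1) * ∫ x, ‖rescale (φ - ψ) a r x‖ ≤ ε / 4 * r ^ n := by
      calc _ ≤ (C + 1) * (ε / (4 * ((C + 1) * (|R| ^ n * v₁ + 1))) * ((|R| * r) ^ n * v₁)) := by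
            gcongr
        _ = ε / 4 * r ^ n * ((|R| ^ n * v₁) / (|R| ^ n * v₁ + 1)) := by
            rw [mul_pow]
            field_simp
        _ ≤ ε / 4 * r ^ n * 1 := by
            gcongr
            rw [div_le_one (by positivity)]
            linarith
        _ = _ := mul_one _
    have hI : 0 ≤ ∫ x, ‖rescale (φ - ψ) a r x‖ := integral_nonneg fun _ => norm_nonneg _
    have h4 := hF (rescale (φ - ψ) a r)
    have h5 : |∫ x, f (rescale (φ - ψ) a r x)| ≤ C * ∫ x, ‖rescale (φ - ψ) a r x‖ := by
      rw [← integral_const_mul]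
      rw [← Real.norm_eq_abs]
      exact norm_integral_le_of_norm_le ((rescale (φ - ψ) a r).integrable.norm.const_mul C)
        (Eventually.of_forall fun x => f.le_of_opNorm_le hf _)
    have h6 : ∫ x, f (rescale (φ - ψ) a r x) =
        (∫ x, f (rescale φ a r x)) - ∫ x, f (rescale ψ a r x) := by
      rw [← integral_sub (f.integrable_comp (rescale φ a r).integrable)
        (f.integrable_comp (rescale ψ a r).integrable)]
      simp [rescale_sub]
    rw [rescale_sub, map_sub] at h4
    rw [h6] at h5
    rw [rescale_sub] at h3 h5 hI
    rw [abs_le] at *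
    constructor <;> nlinarith [h1.1, h1.2, h4.1, h4.2, h5.1, h5.2]

/-- A weakly measurable map into a separable dual space is measurable. -/
theorem measurable_of_measurable_eval [SeparableSpace Y] [SeparableSpace (StrongDual ℝ Y)]
    [MeasurableSpace (StrongDual ℝ Y)] [BorelSpace (StrongDual ℝ Y)] {α : Type*}
    [MeasurableSpace α] {f : α → StrongDual ℝ Y}
    (hf : ∀ m, Measurable fun x => f x (denseSeq Y m)) : Measurable f := by
  have hball : ∀ z c, MeasurableSet (f ⁻¹' Metric.closedBall z c) := by
    intro z c
    by_cases hc : 0 ≤ c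
    -- The dual norm is tested on the dense sequence, which makes the preimage a countable
    -- intersection.
    · have : f ⁻¹' Metric.closedBall z c =
          ⋂ m, {x | |f x (denseSeq Y m) - z (denseSeq Y m)| ≤ c * ‖denseSeq Y m‖} := by
        ext x
        simp only [Set.mem_preimage, mem_closedBall_iff_norm, Set.mem_iInter, Set.mem_ofPred_eq]
        refine ⟨fun h m => (f x - z).le_of_opNorm_le h _, fun h => ?_⟩
        refine ContinuousLinearMap.opNorm_le_bound _ hc fun y => ?_
        refine (denseRange_denseSeq Y).induction_on
          (p := fun y => ‖(f x - z) y‖ ≤ c * ‖y‖) y ?_ fun m => h m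
        exact isClosed_le (by fun_prop) (by fun_prop)
      rw [this]
      exact MeasurableSet.iInter fun m =>
        measurableSet_le (((hf m).sub_const _).abs) measurable_const
    · rw [Metric.closedBall_eq_empty.2 (not_le.1 hc)]
      exact MeasurableSet.empty
  refine measurable_of_isOpen fun U hU => ?_
  have : U = ⋃ (m : ℕ) (q : ℚ)
      (_ : Metric.closedBall (denseSeq (StrongDual ℝ Y) m) (q : ℝ) ⊆ U),
      Metric.closedBall (denseSeq (StrongDual ℝ Y) m) (q : ℝ) := by
    refine Set.Subset.antisymm (fun z hz => ?_) (by simp)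
    obtain ⟨ε, hε, h⟩ := Metric.isOpen_iff.1 hU z hz
    obtain ⟨q, hq0, hqε⟩ := exists_rat_btwn (half_pos hε)
    obtain ⟨m, hm⟩ := (denseRange_denseSeq (StrongDual ℝ Y)).exists_dist_lt z hq0
    simp only [Set.mem_iUnion]
    refine ⟨m, q, fun w hw => h ?_, hm.le⟩
    have := Metric.mem_closedBall.1 hw
    rw [Metric.mem_ball]
    rw [dist_comm] at hm
    linarith [dist_triangle w (denseSeq (StrongDual ℝ Y) m) z]
  rw [this]
  simp only [Set.preimage_iUnion]
  exact MeasurableSet.iUnion fun m => MeasurableSet.iUnion fun q => MeasurableSet.iUnion fun _ =>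
    hball _ _

/-- Functionals that are bounded in `L¹` have densities if the dual space is separable. -/
theorem exists_strong_density [SeparableSpace Y] [SeparableSpace (StrongDual ℝ Y)]
    (F : TestFun n Y →ₗ[ℝ] ℝ) {C : ℝ} (hC : 0 ≤ C)
    (hF : ∀ ψ, |F ψ| ≤ C * ∫ x, ‖ψ x‖) (g : ℕ → EuclideanSpace ℝ (Fin n) → ℝ)
    (hgm : ∀ m, Measurable (g m)) (hg : ∀ m, LocallyIntegrable (g m) volume)
    (hgF : ∀ m (ψ : TestFun n ℝ), F (ψ.tensor (denseSeq Y m)) = ∫ x, g m x * ψ x) :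
    ∃ f : EuclideanSpace ℝ (Fin n) → StrongDual ℝ Y, LocallyIntegrable f volume ∧
      ∀ φ, F φ = ∫ x, f x (φ x) := by
  classical
  borelize (StrongDual ℝ Y)
  have hae := ae_exists_weak_density F hC hF g hg hgF
  -- The pointwise functionals exist off a null set. Setting them to zero on a measurable null set
  -- `S` keeps the evaluations at the dense sequence measurable.
  obtain ⟨S, hS, hSm, hS0⟩ := exists_measurable_superset_of_null (ae_iff.1 hae)
  have hS' : ∀ a, a ∉ S → ∃ f : StrongDual ℝ Y, ‖f‖ ≤ C ∧ ∀ m, f (denseSeq Y m) = g m a := by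
    intro a ha
    by_contra hcon
    refine ha (hS fun ⟨f, h1, h2, _⟩ => hcon ⟨f, h1, h2⟩)
  choose! f hfC hfg using hS'
  have hfm : Measurable (Sᶜ.indicator f) := by
    refine measurable_of_measurable_eval fun m => ?_
    have : (fun x => Sᶜ.indicator f x (denseSeq Y m)) = Sᶜ.indicator (g m) := by
      ext x
      by_cases hx : x ∈ S
      · simp [hx]
      · simp [hx, hfg x hx]
    rw [this]
    exact (hgm m).indicator hSm.compl
  have hbd : ∀ x, ‖Sᶜ.indicator f x‖ ≤ C := fun x => by
    by_cases hx : x ∈ S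
    · simpa [hx] using hC
    · simpa [hx] using hfC x hx
  have hloc : LocallyIntegrable (Sᶜ.indicator f) volume :=
    (locallyIntegrable_const C).mono hfm.aestronglyMeasurable
      (Eventually.of_forall fun x => by rw [Real.norm_of_nonneg hC]; exact hbd x)
  have hint : ∀ φ : TestFun n Y, Integrable (fun x => Sᶜ.indicator f x (φ x)) volume := fun φ => by
    refine Integrable.mono' (φ.integrable.norm.const_mul C) ?_
      (Eventually.of_forall fun x => (Sᶜ.indicator f x).le_of_opNorm_le (hbd x) _)
    exact (ContinuousLinearMap.id ℝ (StrongDual ℝ Y)).aestronglyMeasurable_comp₂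
      hfm.aestronglyMeasurable φ.continuous.aestronglyMeasurable
  refine ⟨_, hloc, fun φ => ?_⟩
  refine φ.induction_on_tensor (denseRange_denseSeq Y)
    (p := fun φ => F φ = ∫ x, Sᶜ.indicator f x (φ x)) ?_ ?_ ?_
  · rintro φ _ ⟨m, rfl⟩
    rw [hgF]
    refine integral_congr_ae ?_
    filter_upwards [compl_mem_ae_iff.2 hS0] with x hx
    rw [Set.indicator_of_mem hx, TestFun.tensor_apply, map_smul, hfg x hx, smul_eq_mul, mul_comm]
  · intro φ ψ hφ hψ
    rw [map_add, hφ, hψ, ← integral_add (hint φ) (hint ψ)]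
    simp
  · intro φ R hφ hcl
    have hR : 0 ≤ |R| := abs_nonneg R
    set v₁ := volume.real (Metric.closedBall (0 : EuclideanSpace ℝ (Fin n)) 1)
    have hv : 0 ≤ v₁ := measureReal_nonneg
    rw [← sub_eq_zero, ← abs_nonpos_iff]
    refine le_of_forall_pos_le_add fun ε hε => ?_
    obtain ⟨ψ, hψ, hψR, hφψ⟩ := hcl (ε / (2 * ((C + 1) * (|R| ^ n * v₁ + 1)))) (by positivity)
    have hsup : Function.support (φ - ψ : TestFun n Y) ⊆ Metric.closedBall 0 |R| := fun x hx => by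
      refine Metric.closedBall_subset_closedBall (le_abs_self R) ?_
      by_contra hcon
      refine hx ?_
      have e1 : φ x = 0 := by
        by_contra h
        exact hcon (hφ h)
      have e2 : ψ x = 0 := by
        by_contra h
        exact hcon (hψR h)
      simp [e1, e2]
    have h2 := integral_norm_le_of_support hR hsup
      (M := ε / (2 * ((C + 1) * (|R| ^ n * v₁ + 1)))) (fun x => hφψ x)
    have h3 : (C + 1) * ∫ x, ‖(φ - ψ) x‖ ≤ ε / 2 := by
      calc _ ≤ (C + 1) * (ε / (2 * ((C + 1) * (|R| ^ n * v₁ + 1))) * (|R| ^ n * v₁)) := by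
            gcongr
        _ = ε / 2 * ((|R| ^ n * v₁) / (|R| ^ n * v₁ + 1)) := by field_simp
        _ ≤ ε / 2 * 1 := by
            gcongr
            rw [div_le_one (by positivity)]
            linarith
        _ = _ := mul_one _
    have hI : 0 ≤ ∫ x, ‖(φ - ψ) x‖ := integral_nonneg fun _ => norm_nonneg _
    have h4 := hF (φ - ψ)
    have h5 : |∫ x, Sᶜ.indicator f x ((φ - ψ) x)| ≤ C * ∫ x, ‖(φ - ψ) x‖ := by
      rw [← integral_const_mul, ← Real.norm_eq_abs]
      exact norm_integral_le_of_norm_le ((φ - ψ).integrable.norm.const_mul C)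
        (Eventually.of_forall fun x => (Sᶜ.indicator f x).le_of_opNorm_le (hbd x) _)
    have h6 : ∫ x, Sᶜ.indicator f x ((φ - ψ) x) =
        (∫ x, Sᶜ.indicator f x (φ x)) - ∫ x, Sᶜ.indicator f x (ψ x) := by
      rw [← integral_sub (hint φ) (hint ψ)]
      simp
    rw [h6] at h5
    rw [map_sub] at h4
    rw [abs_le] at *
    constructor <;> nlinarith [h4.1, h4.2, h5.1, h5.2]

/-! ### Differentiability of order zero. -/

theorem isPolynomialOfDegreeLE_const {Z : Type*} [NormedAddCommGroup Z] [NormedSpace ℝ Z] (z : Z) :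
    IsPolynomialOfDegreeLE (n := n) 0 fun _ => z :=
  ⟨fun m => if h : m = 0 then
    h ▸ ContinuousMultilinearMap.constOfIsEmpty ℝ (fun _ => EuclideanSpace ℝ (Fin n)) z else 0,
    fun x => by simp⟩

/-- The case of order zero. -/
theorem ae_strongOrderAt_zero [SeparableSpace Y] {i : ℕ} {T : Distrib n Y} {N δ ρ : ℝ}
    {A : Set (EuclideanSpace ℝ (Fin n))} (hN : 0 ≤ N) (hδ : 0 < δ) (hT : UniformBoundOn i T N δ A)
    (hA : A ⊆ Metric.closedBall 0 ρ) :
    ∀ᵐ a ∂(volume : Measure (EuclideanSpace ℝ (Fin n))), a ∈ A → PtDiffAt T (0 : ℕ) a ∧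
      (SeparableSpace (StrongDual ℝ Y) → StrongOrderAt i T 0 a) := by
  rcases A.eq_empty_or_nonempty with rfl | hne
  · simp
  obtain ⟨C, hC, h⟩ := exists_near_limit n i
  obtain ⟨F, hF, hTF⟩ := h T N δ ρ A hne hN hδ hT hA
  have hF' : ∀ ψ, |F ψ| ≤ C * N * ∫ x, ‖ψ x‖ := fun ψ => (hF ψ).trans
    (mul_le_mul_of_nonneg_left (setIntegral_le_integral ψ.integrable.norm
      (Eventually.of_forall fun _ => norm_nonneg _)) (by positivity))
  have hdens : ∀ m, ∃ g : EuclideanSpace ℝ (Fin n) → ℝ, Measurable g ∧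
      LocallyIntegrable g volume ∧
      ∀ ψ : TestFun n ℝ, F (ψ.tensor (denseSeq Y m)) = ∫ x, g x * ψ x := fun m => by
    let F' : TestFun n ℝ →ₗ[ℝ] ℝ :=
      { toFun := fun ψ => F (ψ.tensor (denseSeq Y m))
        map_add' := fun φ ψ => by
          rw [← map_add]
          congr 1
          ext x
          simp [add_smul]
        map_smul' := fun c ψ => by
          rw [RingHom.id_apply, ← map_smul]
          congr 1
          ext x
          simp [mul_smul] }
    refine exists_density F' (C := C * N * ‖denseSeq Y m‖) (R := ρ + 6) (by positivity)
      fun ψ => (hF _).trans_eq ?_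
    simp only [TestFun.tensor_apply, norm_smul]
    rw [integral_mul_const]
    ring
  choose g hgm hg hgF using hdens
  have hstrong : ∀ᵐ a ∂(volume : Measure (EuclideanSpace ℝ (Fin n))),
      SeparableSpace (StrongDual ℝ Y) → ∃ f : StrongDual ℝ Y, ∀ ε, 0 < ε → ∃ δ, 0 < δ ∧
        ∀ r, 0 < r → r < δ → ∀ (ψ : TestFun n Y) (M : ℝ),
          Function.support ψ ⊆ Metric.closedBall a r → DerivLE i r M ψ →
          |F ψ - ∫ x, f (ψ x)| ≤ ε * r ^ n * M := by
    -- Separability does not depend on `a`, so it may be decided before the exceptional null set is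
    -- chosen.
    by_cases hsep : SeparableSpace (StrongDual ℝ Y)
    · obtain ⟨f, hf, hFf⟩ := exists_strong_density F (by positivity) hF' g hgm hg hgF
      filter_upwards [ae_integral_norm_sub_le hf] with a ha _
      refine ⟨f a, fun ε hε => ?_⟩
      obtain ⟨δ, hδ, h1⟩ := ha ε hε
      refine ⟨δ, hδ, fun r hr hrδ ψ M hψ hM => ?_⟩
      rw [hFf]
      refine (abs_integral_sub_le_of_support (ContinuousLinearMap.id ℝ (StrongDual ℝ Y))
        (fun z y => z.le_opNorm y) hf hψ hM.norm_le).trans ?_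
      rw [mul_comm]
      exact mul_le_mul_of_nonneg_right (h1 r hr hrδ) hM.nonneg
    · exact Eventually.of_forall fun a h => absurd h hsep
  filter_upwards [ae_measure_diff_le isClosed_closure.measurableSet (S := closure A),
    ae_exists_weak_density F (by positivity) hF' g hg hgF, hstrong] with a h1 h2 h3 haA
  -- At a density point of `closure A` the volume in the estimate for `T - F` is `o(r ^ n)`, so `T`
  -- may be replaced by `F`.
  have hTF' : ∀ ε, 0 < ε → ∃ δ, 0 < δ ∧ ∀ r, 0 < r → r < δ → ∀ (ψ : TestFun n Y) (M : ℝ),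
      Function.support ψ ⊆ Metric.closedBall a r → DerivLE i r M ψ →
      |T ψ - F ψ| ≤ ε * r ^ n * M := by
    intro ε hε
    obtain ⟨δ', hδ', h4⟩ := h1 (subset_closure haA) (ε / ((C * N + 1) * 2 ^ n)) (by positivity)
    refine ⟨min (min (δ' / 2) 1) (δ / 5), by positivity, fun r hr hrδ ψ M hψ hM => ?_⟩
    have hr1 := hrδ.trans_le ((min_le_left _ _).trans (min_le_left _ _))
    have hr2 := hrδ.trans_le ((min_le_left _ _).trans (min_le_right _ _))
    have hr3 := hrδ.trans_le (min_le_right _ _)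
    have hM0 := hM.nonneg
    refine (hTF a (subset_closure haA) r hr hr2.le (by linarith) ψ M hψ hM).trans ?_
    calc _ ≤ (C * N + 1) * M * (ε / ((C * N + 1) * 2 ^ n) * (2 * r) ^ n) := by
          gcongr
          · linarith
          · exact h4 _ (by positivity) (by linarith)
      _ = ε * r ^ n * M := by
          rw [mul_pow]
          field_simp
  constructor
  · obtain ⟨f, -, -, hf⟩ := h2
    refine ptDiffAt_of_forall (P := fun _ => f)
      (by exact_mod_cast isPolynomialOfDegreeLE_const f) fun φ ε hε => ?_
    obtain ⟨R, hR, hφ⟩ := φ.exists_support_subset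
    obtain ⟨M, hM, hφM⟩ := φ.exists_derivLE i R hR.le
    obtain ⟨δ₁, hδ₁, e1⟩ := hTF' (ε / (2 * R ^ n * M)) (by positivity)
    obtain ⟨δ₂, hδ₂, e2⟩ := hf φ (ε / 2) (half_pos hε)
    refine ⟨min (δ₁ / R) δ₂, by positivity, fun r hr hrδ => ?_⟩
    have hr1 := hrδ.trans_le (min_le_left _ _)
    have e3 := e1 (R * r) (by positivity) (by rwa [lt_div_iff₀ hR, mul_comm] at hr1)
      (rescale φ a r) M (support_rescale hφ a hr) (fun m hm x => by
        rw [mul_pow, mul_assoc, norm_iteratedFDeriv_rescale _ _ hr]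
        exact hφM m hm _)
    have e4 := e2 r hr (hrδ.trans_le (min_le_right _ _))
    rw [_root_.sub_apply, ofFunction_apply (isPolynomialOfDegreeLE_const f), zero_add]
    have e5 : ε / (2 * R ^ n * M) * (R * r) ^ n * M = ε / 2 * r ^ n := by
      rw [mul_pow]
      field_simp
    rw [e5] at e3
    rw [abs_le] at *
    constructor <;> linarith [e3.1, e3.2, e4.1, e4.2]
  · intro hsep
    obtain ⟨f, hf⟩ := h3 hsep
    refine ⟨fun _ => f, by exact_mod_cast isPolynomialOfDegreeLE_const f, fun ε hε => ?_⟩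
    obtain ⟨δ₁, hδ₁, e1⟩ := hTF' (ε / 2) (half_pos hε)
    obtain ⟨δ₂, hδ₂, e2⟩ := hf (ε / 2) (half_pos hε)
    refine ⟨min δ₁ δ₂, by positivity, fun r hr hrδ ψ M hψ hM => ?_⟩
    have e3 := e1 r hr (hrδ.trans_le (min_le_left _ _)) ψ M hψ hM
    have e4 := e2 r hr (hrδ.trans_le (min_le_right _ _)) ψ M hψ hM
    rw [_root_.sub_apply, ofFunction_apply (isPolynomialOfDegreeLE_const f), zero_add]
    rw [abs_le] at *
    constructor <;> linarith [e3.1, e3.2, e4.1, e4.2]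

/-! ### Polynomial functions and radial primitives. -/

namespace IsPolynomialOfDegreeLE

variable {Z : Type*} [NormedAddCommGroup Z] [NormedSpace ℝ Z] {k : ℤ}
  {P P' : EuclideanSpace ℝ (Fin n) → Z}

/-- Translation and differentiation of polynomials, with control of the degree, are inherited from
finite power series. -/
theorem iff_hasFiniteFPowerSeriesOnBall : IsPolynomialOfDegreeLE k P ↔
    ∃ p : FormalMultilinearSeries ℝ (EuclideanSpace ℝ (Fin n)) Z,
      HasFiniteFPowerSeriesOnBall P p 0 (k + 1).toNat ⊤ := by
  constructor
  · rintro ⟨p, hp⟩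
    refine ⟨fun m => if m < (k + 1).toNat then p m else 0, .mk' (fun m hm => ?_) (by simp)
      fun y _ => ?_⟩
    · simp [not_lt.2 hm]
    · rw [zero_add, hp]
      exact Finset.sum_congr rfl fun m hm => by simp [Finset.mem_range.1 hm]
  · rintro ⟨p, hp⟩
    refine ⟨p, fun x => ?_⟩
    have := hp.eq_partialSum x (by simp) _ le_rfl
    rwa [zero_add] at this

theorem mono {l : ℤ} (hP : IsPolynomialOfDegreeLE k P) (hkl : k ≤ l) :
    IsPolynomialOfDegreeLE l P := by
  obtain ⟨p, hp⟩ := iff_hasFiniteFPowerSeriesOnBall.1 hP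
  exact iff_hasFiniteFPowerSeriesOnBall.2 ⟨p, hp.of_le (by omega)⟩

theorem add (hP : IsPolynomialOfDegreeLE k P) (hP' : IsPolynomialOfDegreeLE k P') :
    IsPolynomialOfDegreeLE k fun x => P x + P' x := by
  obtain ⟨p, hp⟩ := hP
  obtain ⟨p', hp'⟩ := hP'
  exact ⟨fun m => p m + p' m, fun x => by simp [hp, hp', Finset.sum_add_distrib]⟩

theorem sub (hP : IsPolynomialOfDegreeLE k P) (hP' : IsPolynomialOfDegreeLE k P') :
    IsPolynomialOfDegreeLE k fun x => P x - P' x := by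
  obtain ⟨p, hp⟩ := hP
  obtain ⟨p', hp'⟩ := hP'
  exact ⟨fun m => p m - p' m, fun x => by simp [hp, hp', Finset.sum_sub_distrib]⟩

theorem sum {ι : Type*} (s : Finset ι) {P : ι → EuclideanSpace ℝ (Fin n) → Z}
    (hP : ∀ j ∈ s, IsPolynomialOfDegreeLE k (P j)) :
    IsPolynomialOfDegreeLE k fun x => ∑ j ∈ s, P j x := by
  classical
  induction s using Finset.induction_on with
  | empty => exact ⟨0, fun x => by simp⟩
  | insert j s hj ih =>
    simp only [Finset.sum_insert hj]
    exact (hP j (Finset.mem_insert_self j s)).add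
      (ih fun l hl => hP l (Finset.mem_insert_of_mem hl))

theorem comp_add_left (hP : IsPolynomialOfDegreeLE k P) (z : EuclideanSpace ℝ (Fin n)) :
    IsPolynomialOfDegreeLE k fun x => P (z + x) := by
  obtain ⟨p, hp⟩ := iff_hasFiniteFPowerSeriesOnBall.1 hP
  have h := (hp.changeOrigin (y := z) (by simp)).comp_sub (-z)
  refine iff_hasFiniteFPowerSeriesOnBall.2 ⟨p.changeOrigin z, ?_⟩
  simpa [add_comm] using h

theorem contDiff (hP : IsPolynomialOfDegreeLE k P) : ContDiff ℝ ∞ P := by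
  obtain ⟨p, hp⟩ := hP
  rw [funext hp]
  exact ContDiff.sum fun m _ => (p m).contDiff.comp (contDiff_pi.2 fun _ => contDiff_id)

theorem fderiv_apply (hP : IsPolynomialOfDegreeLE k P) (v : EuclideanSpace ℝ (Fin n)) :
    IsPolynomialOfDegreeLE (k - 1) fun x => fderiv ℝ P x v := by
  obtain ⟨p, hp⟩ := iff_hasFiniteFPowerSeriesOnBall.1 hP
  refine iff_hasFiniteFPowerSeriesOnBall.2 ⟨_,
    (ContinuousLinearMap.apply ℝ Z v).comp_hasFiniteFPowerSeriesOnBall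
      (hp.fderiv'.of_le (m := (k - 1 + 1).toNat) (by omega))⟩

/-- Euler's identity: the radial derivative multiplies a homogeneous function of degree `m + 1` by
`m + 1`. Hence `x_j p_m(x)` is divided by `m + 1`. -/
theorem exists_radial_primitive_coord {k : ℕ} (hP : IsPolynomialOfDegreeLE (k : ℤ) P)
    (j : Fin n) :
    ∃ Q : EuclideanSpace ℝ (Fin n) → Z, IsPolynomialOfDegreeLE ((k : ℤ) + 1) Q ∧ Q 0 = 0 ∧
      ∀ x, fderiv ℝ Q x x = x j • P x := by
  obtain ⟨p, hp⟩ := hP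
  let q : (m : ℕ) → ContinuousMultilinearMap ℝ (fun _ : Fin m => EuclideanSpace ℝ (Fin n)) Z
    | 0 => 0
    | m + 1 => ((m : ℝ) + 1)⁻¹ • ContinuousLinearMap.uncurryLeft
        ((EuclideanSpace.proj j : EuclideanSpace ℝ (Fin n) →L[ℝ] ℝ).smulRight (p m))
  have hq : ∀ m x, q (m + 1) (fun _ => x) = ((m : ℝ) + 1)⁻¹ • x j • p m fun _ => x := by
    intro m x
    simp only [q, _root_.smul_apply, ContinuousLinearMap.uncurryLeft_apply]
    rfl
  let Q : EuclideanSpace ℝ (Fin n) → Z := fun x =>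
    ∑ m ∈ Finset.range ((k : ℤ) + 1 + 1).toNat, q m fun _ => x
  have hQ : IsPolynomialOfDegreeLE ((k : ℤ) + 1) Q := ⟨q, fun x => rfl⟩
  have hk1 : ((k : ℤ) + 1 + 1).toNat = k + 1 + 1 := by omega
  have hk2 : ((k : ℤ) + 1).toNat = k + 1 := by omega
  have hQx : ∀ x, Q x = ∑ m ∈ Finset.range (k + 1), ((m : ℝ) + 1)⁻¹ • x j • p m fun _ => x := by
    intro x
    simp only [Q]
    rw [hk1, Finset.sum_range_succ']
    simp only [hq]
    simp [q]
  refine ⟨Q, hQ, by simp [hQx], fun x => ?_⟩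
  -- The radial derivative at `x` is the derivative of `t ↦ Q (t • x)` at `t = 1`; by homogeneity
  -- only powers of `t` have to be differentiated.
  have h1 : HasDerivAt (fun t : ℝ => Q (t • x)) (fderiv ℝ Q x x) 1 := by
    have h2 : HasFDerivAt Q (fderiv ℝ Q ((1 : ℝ) • x)) ((1 : ℝ) • x) :=
      (hQ.contDiff.differentiable (by simp) _).hasFDerivAt
    have h3 : HasDerivAt (fun t : ℝ => t • x) ((1 : ℝ) • x) 1 := (hasDerivAt_id 1).smul_const x
    have h4 := h2.comp_hasDerivAt 1 h3
    simp only [one_smul] at h4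
    exact h4
  have h5 : (fun t : ℝ => Q (t • x)) = fun t => ∑ m ∈ Finset.range (k + 1),
      t ^ (m + 1) • (((m : ℝ) + 1)⁻¹ • x j • p m fun _ => x) := by
    ext t
    rw [hQx]
    refine Finset.sum_congr rfl fun m _ => ?_
    have := (p m).map_smul_univ (fun _ => t) (fun _ => x)
    simp only [Finset.prod_const, Finset.card_univ, Fintype.card_fin] at this
    rw [this]
    simp only [PiLp.smul_apply, smul_eq_mul, smul_smul]
    congr 1
    ring
  have h6 : HasDerivAt (fun t : ℝ => Q (t • x)) (∑ m ∈ Finset.range (k + 1),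
      (((m + 1 : ℕ) : ℝ) * 1 ^ m) • (((m : ℝ) + 1)⁻¹ • x j • p m fun _ => x)) 1 := by
    rw [h5]
    exact HasDerivAt.fun_sum fun m _ => (hasDerivAt_pow (m + 1) (1 : ℝ)).smul_const _
  rw [h1.unique h6, hp, hk2, Finset.smul_sum]
  refine Finset.sum_congr rfl fun m _ => ?_
  rw [smul_smul, one_pow, mul_one, Nat.cast_add, Nat.cast_one, mul_inv_cancel₀ (by positivity),
    one_smul]

/-- A polynomial function with prescribed radial derivative and value at the centre. -/
theorem exists_radial_primitive {k : ℕ} {W : Fin n → EuclideanSpace ℝ (Fin n) → Z}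
    (hW : ∀ j, IsPolynomialOfDegreeLE (k : ℤ) (W j)) (a : EuclideanSpace ℝ (Fin n)) (z : Z) :
    ∃ Q : EuclideanSpace ℝ (Fin n) → Z, IsPolynomialOfDegreeLE ((k : ℤ) + 1) Q ∧ Q a = z ∧
      ∀ x, fderiv ℝ Q x (x - a) = ∑ j, (x - a) j • W j x := by
  choose Q hQ hQ0 hQd using fun j => exists_radial_primitive_coord ((hW j).comp_add_left a) j
  have hS := IsPolynomialOfDegreeLE.sum Finset.univ fun j _ => hQ j
  have hQ' : ∀ j x, DifferentiableAt ℝ (Q j) x := fun j x =>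
    (hQ j).contDiff.differentiable (by simp) x
  refine ⟨fun x => z + ∑ j, Q j (-a + x), ?_, by simp [hQ0], fun x => ?_⟩
  · exact ((isPolynomialOfDegreeLE_const z).mono (by omega)).add (hS.comp_add_left (-a))
  · have h1 : HasFDerivAt (fun x => z + ∑ j, Q j (-a + x)) (∑ j, fderiv ℝ (Q j) (-a + x)) x := by
      refine HasFDerivAt.const_add z (HasFDerivAt.fun_sum fun j _ => ?_)
      have := (hQ' j (-a + x)).hasFDerivAt.comp x ((hasFDerivAt_id x).const_add (-a))
      rwa [ContinuousLinearMap.comp_id] at this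
    rw [h1.fderiv]
    have e : -a + x = x - a := by abel
    simp [e, hQd]

end IsPolynomialOfDegreeLE

/-! ### Directional derivatives of distributions. -/

theorem ofFunction_sub {k : ℤ} {P P' : EuclideanSpace ℝ (Fin n) → StrongDual ℝ Y}
    (hP : IsPolynomialOfDegreeLE k P) (hP' : IsPolynomialOfDegreeLE k P') (φ : TestFun n Y) :
    ofFunction (fun x => P x - P' x) φ = ofFunction P φ - ofFunction P' φ := by
  have hint : ∀ {P : EuclideanSpace ℝ (Fin n) → StrongDual ℝ Y}, Continuous P →
      Integrable (fun x => P x (φ x)) volume := fun {P} hP =>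
    (hP.clm_apply φ.continuous).integrable_of_hasCompactSupport
      (φ.hasCompactSupport.mono fun x hx h => hx (by simp [h]))
  rw [ofFunction_apply (hP.sub hP'), ofFunction_apply hP, ofFunction_apply hP',
    ← integral_sub (hint hP.continuous) (hint hP'.continuous)]
  rfl

/-- The derivative of a test function in the direction `v`. -/
def TestFun.lineDeriv (v : EuclideanSpace ℝ (Fin n)) : TestFun n Y →L[ℝ] TestFun n Y :=
  TestFunction.lineDerivCLM ℝ v

theorem TestFun.lineDeriv_apply (v : EuclideanSpace ℝ (Fin n)) (φ : TestFun n Y)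
    (x : EuclideanSpace ℝ (Fin n)) : TestFun.lineDeriv v φ x = fderiv ℝ φ x v := by
  rw [TestFun.lineDeriv, TestFunction.lineDerivCLM_apply, if_pos (by simp)]
  exact (φ.contDiff.differentiable (by simp)).differentiableAt.lineDeriv_eq_fderiv

/-- The derivative of a distribution in the direction `v`. -/
def Distrib.lineDeriv (v : EuclideanSpace ℝ (Fin n)) (T : Distrib n Y) : Distrib n Y :=
  -(T ∘L TestFun.lineDeriv v)

theorem Distrib.lineDeriv_apply (v : EuclideanSpace ℝ (Fin n)) (T : Distrib n Y)
    (φ : TestFun n Y) : T.lineDeriv v φ = -T (TestFun.lineDeriv v φ) := rfl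

theorem Distrib.lineDeriv_ofFunction (v : EuclideanSpace ℝ (Fin n)) {k : ℤ}
    {P : EuclideanSpace ℝ (Fin n) → StrongDual ℝ Y} (hP : IsPolynomialOfDegreeLE k P) :
    (ofFunction P).lineDeriv v = ofFunction fun x => fderiv ℝ P x v := by
  ext φ
  have hint : ∀ {P : EuclideanSpace ℝ (Fin n) → StrongDual ℝ Y}, Continuous P →
      ∀ φ : TestFun n Y, Integrable (fun x => P x (φ x)) volume := fun {P} hP φ =>
    (hP.clm_apply φ.continuous).integrable_of_hasCompactSupport
      (φ.hasCompactSupport.mono fun x hx h => hx (by simp [h]))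
  rw [Distrib.lineDeriv_apply, ofFunction_apply hP, ofFunction_apply (hP.fderiv_apply v)]
  have h := integral_bilinear_hasFDerivAt_right_eq_neg_left_of_integrable (μ := volume)
    (f := P) (f' := fderiv ℝ P) (g := φ) (g' := fderiv ℝ φ) (v := v)
    (B := ContinuousLinearMap.id ℝ (StrongDual ℝ Y))
    (hint (hP.fderiv_apply v).continuous φ)
    (by
      have := hint hP.continuous (TestFun.lineDeriv v φ)
      simp only [TestFun.lineDeriv_apply] at this
      exact this)
    (hint hP.continuous φ)
    (fun x _ => (hP.contDiff.differentiable (by simp) x).hasFDerivAt)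
    (fun x _ => (φ.contDiff.differentiable (by simp) x).hasFDerivAt)
  simp only [TestFun.lineDeriv_apply]
  exact neg_eq_iff_eq_neg.2 h

theorem lineDeriv_sub_ofFunction {T : Distrib n Y} {k : ℤ}
    {P : EuclideanSpace ℝ (Fin n) → StrongDual ℝ Y} (hP : IsPolynomialOfDegreeLE k P)
    (v : EuclideanSpace ℝ (Fin n)) :
    (T - ofFunction P).lineDeriv v = T.lineDeriv v - ofFunction fun x => fderiv ℝ P x v := by
  rw [← Distrib.lineDeriv_ofFunction v hP]
  ext φ
  simp only [Distrib.lineDeriv_apply, _root_.sub_apply]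
  ring

theorem DerivLE.lineDeriv {i : ℕ} {r M : ℝ} {ψ : TestFun n Y} (hr : 0 < r)
    (h : DerivLE (i + 1) r M ψ) {v : EuclideanSpace ℝ (Fin n)} (hv : ‖v‖ ≤ 1) :
    DerivLE i r (M / r) (TestFun.lineDeriv v ψ) := by
  intro m hm x
  have h1 : (TestFun.lineDeriv v ψ : EuclideanSpace ℝ (Fin n) → Y) =
      (ContinuousLinearMap.apply ℝ Y v) ∘ fderiv ℝ ψ := by
    ext x
    exact TestFun.lineDeriv_apply v ψ x
  have h2 : ContDiff ℝ m (fderiv ℝ ψ) := ψ.contDiff.fderiv_right (by norm_cast; exact le_top)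
  have h3 : ‖iteratedFDeriv ℝ m (TestFun.lineDeriv v ψ) x‖ ≤ ‖iteratedFDeriv ℝ (m + 1) ψ x‖ := by
    rw [h1, ← norm_iteratedFDeriv_fderiv,
      ContinuousLinearMap.iteratedFDeriv_comp_left _ h2.contDiffAt le_rfl]
    refine (ContinuousLinearMap.norm_compContinuousMultilinearMap_le _ _).trans ?_
    refine mul_le_of_le_one_left (norm_nonneg _) ?_
    refine ContinuousLinearMap.opNorm_le_bound _ zero_le_one fun L => ?_
    rw [one_mul]
    exact (L.le_opNorm v).trans (mul_le_of_le_one_right (norm_nonneg _) hv)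
  rw [le_div_iff₀ hr]
  calc r ^ m * ‖iteratedFDeriv ℝ m (TestFun.lineDeriv v ψ) x‖ * r
      ≤ r ^ m * ‖iteratedFDeriv ℝ (m + 1) ψ x‖ * r := by gcongr
    _ = r ^ (m + 1) * ‖iteratedFDeriv ℝ (m + 1) ψ x‖ := by ring
    _ ≤ M := h (m + 1) (by omega) x

theorem TestFun.support_lineDeriv_subset {ψ : TestFun n Y} {a : EuclideanSpace ℝ (Fin n)} {r : ℝ}
    (h : Function.support ψ ⊆ Metric.closedBall a r) (v : EuclideanSpace ℝ (Fin n)) :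
    Function.support (TestFun.lineDeriv v ψ) ⊆ Metric.closedBall a r := by
  intro x hx
  have h1 : x ∈ tsupport (fderiv ℝ ψ) := subset_tsupport _ fun h0 => hx (by
    rw [TestFun.lineDeriv_apply, h0, _root_.zero_apply])
  exact closure_minimal h Metric.isClosed_closedBall (tsupport_fderiv_subset ℝ h1)

theorem BoundAt.lineDeriv {i : ℕ} {T : Distrib n Y} {a : EuclideanSpace ℝ (Fin n)} {r c : ℝ}
    (hr : 0 < r) (h : BoundAt i T a r c) {v : EuclideanSpace ℝ (Fin n)} (hv : ‖v‖ ≤ 1) :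
    BoundAt (i + 1) (T.lineDeriv v) a r (c / r) := fun ψ M hψ hM => by
  rw [Distrib.lineDeriv_apply, abs_neg]
  exact (h _ _ (TestFun.support_lineDeriv_subset hψ v) (hM.lineDeriv hr hv)).trans_eq (by ring)

/-- Differentiation costs one factor `r` and one order of the seminorm, and lowers the degree of the
polynomial by one. -/
theorem UniformOrderAt.lineDeriv {i k : ℕ} {T : Distrib n Y} {N δ : ℝ}
    {a : EuclideanSpace ℝ (Fin n)} (h : UniformOrderAt i T (k + 1) N δ a)
    {v : EuclideanSpace ℝ (Fin n)} (hv : ‖v‖ ≤ 1) :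
    UniformOrderAt (i + 1) (T.lineDeriv v) k N δ a := by
  obtain ⟨P, hP, h⟩ := h
  refine ⟨_, (hP.fderiv_apply v).mono (by push_cast; omega), fun r hr hrδ => ?_⟩
  have h1 := (h r hr hrδ).lineDeriv hr hv
  rw [lineDeriv_sub_ofFunction hP] at h1
  refine h1.mono (le_of_eq ?_)
  rw [show k + 1 + n = k + n + 1 by ring, pow_succ]
  field_simp

/-! ### The Euler operator and differentiation in the scale. -/

section Euler

variable {V Z : Type*} [NormedAddCommGroup V] [NormedSpace ℝ V] [NormedAddCommGroup Z]
  [NormedSpace ℝ Z]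

theorem contDiff_fderiv_self {f : V → Z} (hf : ContDiff ℝ ∞ f) :
    ContDiff ℝ ∞ fun x => fderiv ℝ f x x :=
  (hf.fderiv_right (m := ∞) le_rfl).clm_apply contDiff_id

theorem fderiv_fderiv_self {f : V → Z} (hf : ContDiff ℝ ∞ f) (x : V) :
    fderiv ℝ (fun x => fderiv ℝ f x x) x = fderiv ℝ f x + fderiv ℝ (fderiv ℝ f) x x := by
  have h1 : HasFDerivAt (fderiv ℝ f) (fderiv ℝ (fderiv ℝ f) x) x :=
    ((hf.fderiv_right (m := ∞) le_rfl).differentiable (by simp) x).hasFDerivAt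
  have h2 := h1.clm_apply (hasFDerivAt_id x)
  have h3 : HasFDerivAt (fun x => fderiv ℝ f x x) _ x := h2
  rw [h3.fderiv]
  ext v
  have h4 : IsSymmSndFDerivAt ℝ f x := hf.contDiffAt.isSymmSndFDerivAt (by
    rw [minSmoothness_of_isRCLikeNormedField]
    exact WithTop.coe_le_coe.2 (le_top : (2 : ℕ∞) ≤ ⊤))
  simp [h4.eq v x]

/-- Commutation of the Euler operator with higher derivatives; symmetry of the second derivative
enters through `fderiv_fderiv_self`. -/
theorem iteratedFDeriv_fderiv_self {f : V → Z} (hf : ContDiff ℝ ∞ f) (m : ℕ) (x : V) :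
    iteratedFDeriv ℝ m (fun x => fderiv ℝ f x x) x =
      (m : ℝ) • iteratedFDeriv ℝ m f x + fderiv ℝ (iteratedFDeriv ℝ m f) x x := by
  induction m generalizing x with
  | zero =>
    rw [iteratedFDeriv_zero_eq_comp, iteratedFDeriv_zero_eq_comp,
      (continuousMultilinearCurryFin0 ℝ V Z).symm.comp_fderiv]
    simp
  | succ m ih =>
    have hg : ContDiff ℝ ∞ (iteratedFDeriv ℝ m f) :=
      hf.iteratedFDeriv_right (m := ∞) (by exact_mod_cast le_top)
    have hdg : DifferentiableAt ℝ (iteratedFDeriv ℝ m f) x := hg.differentiable (by simp) x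
    let I : (V →L[ℝ] (V [×m]→L[ℝ] Z)) →L[ℝ] (V [×(m + 1)]→L[ℝ] Z) :=
      (continuousMultilinearCurryLeftEquiv ℝ (fun _ : Fin (m + 1) => V)
        Z).symm.toContinuousLinearEquiv.toContinuousLinearMap
    have hI : ∀ g : V → Z, iteratedFDeriv ℝ (m + 1) g =
        fun x => I (fderiv ℝ (iteratedFDeriv ℝ m g) x) := fun g => rfl
    have hI' : fderiv ℝ (fun x => I (fderiv ℝ (iteratedFDeriv ℝ m f) x)) x =
        I ∘L fderiv ℝ (fderiv ℝ (iteratedFDeriv ℝ m f)) x :=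
      (I.hasFDerivAt.comp x ((hg.fderiv_right (m := ∞) le_rfl).differentiable
        (by simp) x).hasFDerivAt).fderiv
    rw [hI, hI f, hI', funext ih]
    have h1 : fderiv ℝ (fun x => (m : ℝ) • iteratedFDeriv ℝ m f x +
        fderiv ℝ (iteratedFDeriv ℝ m f) x x) x =
        (m : ℝ) • fderiv ℝ (iteratedFDeriv ℝ m f) x + (fderiv ℝ (iteratedFDeriv ℝ m f) x +
          fderiv ℝ (fderiv ℝ (iteratedFDeriv ℝ m f)) x x) := by
      rw [← fderiv_fderiv_self hg, ← fderiv_const_smul hdg]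
      exact fderiv_fun_add (hdg.const_smul (m : ℝ))
        ((contDiff_fderiv_self hg).differentiable (by simp) x)
    simp only [ContinuousLinearMap.comp_apply, h1, map_add, map_smul]
    rw [Nat.cast_add, Nat.cast_one, add_smul, one_smul, add_assoc]

/-- The exponential turns dilations into a one-parameter group generated by the Euler operator, so a
second derivative in `s` is obtained by applying the same formula again. -/
theorem hasDerivAt_iteratedFDeriv_comp_exp_smul {f : V → Z} (hf : ContDiff ℝ ∞ f) (m : ℕ) (x : V)
    (s : ℝ) : HasDerivAt (fun s => iteratedFDeriv ℝ m (fun y => f (Real.exp s • y)) x)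
      (iteratedFDeriv ℝ m (fun y => fderiv ℝ f (Real.exp s • y) (Real.exp s • y)) x) s := by
  have hg : ContDiff ℝ ∞ (iteratedFDeriv ℝ m f) :=
    hf.iteratedFDeriv_right (m := ∞) (by exact_mod_cast le_top)
  have h0 : ∀ s : ℝ, iteratedFDeriv ℝ m (fun y => f (Real.exp s • y)) x =
      Real.exp s ^ m • iteratedFDeriv ℝ m f (Real.exp s • x) := fun s => by
    rw [iteratedFDeriv_comp_const_smul _ (hf.of_le (by exact_mod_cast le_top))]
  have h1 : iteratedFDeriv ℝ m (fun y => fderiv ℝ f (Real.exp s • y) (Real.exp s • y)) x =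
      Real.exp s ^ m • iteratedFDeriv ℝ m (fun y => fderiv ℝ f y y) (Real.exp s • x) := by
    rw [iteratedFDeriv_comp_const_smul (f := fun y => fderiv ℝ f y y) _
      ((contDiff_fderiv_self hf).of_le (by exact_mod_cast le_top))]
  rw [funext h0, h1, iteratedFDeriv_fderiv_self hf]
  have h2 : HasDerivAt (fun s => Real.exp s • x) (Real.exp s • x) s :=
    (Real.hasDerivAt_exp s).smul_const x
  have h3 : HasDerivAt (fun s => iteratedFDeriv ℝ m f (Real.exp s • x))
      (fderiv ℝ (iteratedFDeriv ℝ m f) (Real.exp s • x) (Real.exp s • x)) s :=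
    (hg.differentiable (by simp) _).hasFDerivAt.comp_hasDerivAt s h2
  have h4 : HasDerivAt (fun s => Real.exp s ^ m) (m * Real.exp s ^ m) s := by
    have h5 := (Real.hasDerivAt_exp s).pow m
    refine h5.congr_deriv ?_
    cases m with
    | zero => simp
    | succ m => rw [Nat.add_sub_cancel, pow_succ]; ring
  refine (h4.smul h3).congr_deriv ?_
  rw [smul_add, smul_smul, mul_comm (m : ℝ), add_comm]

theorem norm_sub_sub_smul_le {f f' f'' : ℝ → Z} (hf : ∀ s, HasDerivAt f (f' s) s)
    (hf' : ∀ s, HasDerivAt f' (f'' s) s) {B : ℝ} (hB : ∀ s, |s| ≤ 1 → ‖f'' s‖ ≤ B) {s : ℝ}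
    (hs : |s| ≤ 1) : ‖f s - f 0 - s • f' 0‖ ≤ B * s ^ 2 := by
  have hconv : Convex ℝ (Set.Icc (-|s|) |s|) := convex_Icc _ _
  have h0 : (0 : ℝ) ∈ Set.Icc (-|s|) |s| := ⟨by simp, abs_nonneg s⟩
  have hs' : s ∈ Set.Icc (-|s|) |s| := abs_le.1 le_rfl
  have hB0 : 0 ≤ B := (norm_nonneg _).trans (hB 0 (by simp))
  have h1 : ∀ t ∈ Set.Icc (-|s|) |s|, ‖f' t - f' 0‖ ≤ B * |s| := fun t ht => by
    have := hconv.norm_image_sub_le_of_norm_hasDerivWithin_le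
      (fun t _ => (hf' t).hasDerivWithinAt) (fun t ht => hB t ((abs_le.2 ht).trans hs)) h0 ht
    rw [sub_zero, Real.norm_eq_abs] at this
    exact this.trans (mul_le_mul_of_nonneg_left (abs_le.2 ht) hB0)
  have h2 : ∀ t, HasDerivAt (fun t => f t - t • f' 0) (f' t - f' 0) t := fun t => by
    have := (hf t).sub ((hasDerivAt_id t).smul_const (f' 0))
    rw [one_smul] at this
    exact this
  have h3 := hconv.norm_image_sub_le_of_norm_hasDerivWithin_le
    (fun t _ => (h2 t).hasDerivWithinAt) h1 h0 hs'
  rw [sub_zero, Real.norm_eq_abs, zero_smul, sub_zero, mul_assoc, ← sq, sq_abs] at h3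
  rwa [sub_right_comm]

end Euler

/-- The test function `x ↦ Dφ(x)(x)`. -/
def TestFun.euler (φ : TestFun n Y) : TestFun n Y :=
  TestFun.ofSupport (fun x => fderiv ℝ φ x x) (contDiff_fderiv_self φ.contDiff)
    (φ.hasCompactSupport.fderiv (𝕜 := ℝ) |>.mono fun x hx h => hx (by simp [h]))

theorem TestFun.euler_apply (φ : TestFun n Y) (x : EuclideanSpace ℝ (Fin n)) :
    φ.euler x = fderiv ℝ φ x x := rfl

/-- The second order remainder in `s` is `O(s ^ 2)` in finitely many derivatives, with support in a
fixed ball where `T` has finite order. -/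
theorem hasDerivAt_rescale_exp_neg (T : Distrib n Y) (φ : TestFun n Y) :
    HasDerivAt (fun s : ℝ => T (rescale φ 0 (Real.exp (-s)))) (T φ.euler) 0 := by
  obtain ⟨R, hR, hφ⟩ := φ.exists_support_subset
  have hsup : ∀ s : ℝ, |s| ≤ 1 → Function.support (rescale φ 0 (Real.exp (-s)) - φ - s • φ.euler :
      TestFun n Y) ⊆ Metric.closedBall 0 (R * Real.exp 1) := by
    intro s hs x hx
    by_contra hcon
    rw [mem_closedBall_zero_iff, not_le] at hcon
    have hx1 : R < ‖x‖ := lt_of_le_of_lt (le_mul_of_one_le_right hR.le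
      (Real.one_le_exp zero_le_one)) hcon
    have hz : ∀ y, R < ‖y‖ → φ y = 0 := fun y hy => by
      by_contra h
      exact absurd (mem_closedBall_zero_iff.1 (hφ h)) (not_le.2 hy)
    have hE : φ.euler x = 0 := by
      rw [TestFun.euler_apply, ← TestFun.lineDeriv_apply]
      by_contra h
      exact absurd (mem_closedBall_zero_iff.1 (TestFun.support_lineDeriv_subset hφ x h))
        (not_le.2 hx1)
    have hr : rescale φ 0 (Real.exp (-s)) x = 0 := by
      rw [rescale_apply _ _ (Real.exp_ne_zero _)]
      refine hz _ ?_
      rw [sub_zero, norm_smul, ← Real.exp_neg, neg_neg, Real.norm_of_nonneg (Real.exp_pos _).le]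
      have h1 : Real.exp (-1) ≤ Real.exp s := Real.exp_le_exp.2 (abs_le.1 hs).1
      calc R = Real.exp (-1) * (R * Real.exp 1) := by
            rw [mul_left_comm, ← Real.exp_add]; simp
        _ < Real.exp (-1) * ‖x‖ := by gcongr
        _ ≤ Real.exp s * ‖x‖ := by gcongr
    refine hx ?_
    simp [hr, hz x hx1, hE]
  obtain ⟨i, C, hC, hT⟩ := T.exists_order (R * Real.exp 1)
  obtain ⟨M, hM, hder⟩ := φ.euler.euler.exists_derivLE i 1 zero_le_one
  have hexp : ∀ (ψ : TestFun n Y) (s : ℝ), (rescale ψ 0 (Real.exp (-s)) :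
      EuclideanSpace ℝ (Fin n) → Y) = fun y => ψ (Real.exp s • y) := fun ψ s => by
    ext y
    rw [rescale_apply _ _ (Real.exp_ne_zero _), sub_zero, ← Real.exp_neg, neg_neg]
  have hkey : ∀ s : ℝ, |s| ≤ 1 → DerivLE i 1 (Real.exp 1 ^ i * M * s ^ 2)
      (rescale φ 0 (Real.exp (-s)) - φ - s • φ.euler : TestFun n Y) := by
    intro s hs m hm x
    have h1 := norm_sub_sub_smul_le
      (f := fun s => iteratedFDeriv ℝ m (fun y => φ (Real.exp s • y)) x)
      (f' := fun s => iteratedFDeriv ℝ m (fun y => φ.euler (Real.exp s • y)) x)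
      (f'' := fun s => iteratedFDeriv ℝ m (fun y => φ.euler.euler (Real.exp s • y)) x)
      (hasDerivAt_iteratedFDeriv_comp_exp_smul φ.contDiff m x)
      (hasDerivAt_iteratedFDeriv_comp_exp_smul φ.euler.contDiff m x)
      (B := Real.exp 1 ^ i * M) (fun t ht => by
        rw [iteratedFDeriv_comp_const_smul _ (φ.euler.euler.contDiff.of_le
          (by exact_mod_cast le_top)), norm_smul, norm_pow,
          Real.norm_of_nonneg (Real.exp_pos _).le]
        have h2 := hder m hm (Real.exp t • x)
        rw [one_pow, one_mul] at h2
        have h3 : Real.exp t ≤ Real.exp 1 := Real.exp_le_exp.2 ((le_abs_self t).trans ht)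
        calc Real.exp t ^ m * _ ≤ Real.exp 1 ^ m * M := by gcongr
          _ ≤ Real.exp 1 ^ i * M := by
            gcongr
            exact Real.one_le_exp zero_le_one) hs
    simp only [Real.exp_zero, one_smul] at h1
    rw [one_pow, one_mul]
    have hd : ∀ ψ : TestFun n Y, ContDiffAt ℝ m ψ x := fun ψ =>
      ψ.contDiff.contDiffAt.of_le (by exact_mod_cast le_top)
    have h4 : ((rescale φ 0 (Real.exp (-s)) - φ - s • φ.euler : TestFun n Y) :
        EuclideanSpace ℝ (Fin n) → Y) =
        (⇑(rescale φ 0 (Real.exp (-s))) - ⇑φ) - s • ⇑φ.euler := rfl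
    have h5 : ContDiffAt ℝ m (⇑(rescale φ 0 (Real.exp (-s))) - ⇑φ) x := (hd _).sub (hd _)
    have h6 : ContDiffAt ℝ m (s • ⇑φ.euler) x := (hd _).const_smul s
    rw [h4, iteratedFDeriv_sub_apply h5 h6,
      iteratedFDeriv_sub_apply (hd _) (hd _), iteratedFDeriv_const_smul_apply (hd _), hexp]
    exact h1
  rw [hasDerivAt_iff_isLittleO_nhds_zero]
  have hO : (fun s : ℝ => T (rescale φ 0 (Real.exp (-(0 + s)))) -
      T (rescale φ 0 (Real.exp (-0))) - s • T φ.euler) =O[𝓝 0] fun s : ℝ => s ^ 2 := by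
    refine Asymptotics.IsBigO.of_bound (C * (Real.exp 1 ^ i * M)) ?_
    filter_upwards [Metric.closedBall_mem_nhds (0 : ℝ) one_pos] with s hs
    rw [mem_closedBall_zero_iff, Real.norm_eq_abs] at hs
    have h1 := hT _ _ (hsup s hs) (hkey s hs)
    have h2 : rescale φ 0 (Real.exp (-0)) = φ := by
      ext x
      simp only [hexp, Real.exp_zero, one_smul]
    rw [zero_add, h2, Real.norm_eq_abs, Real.norm_of_nonneg (sq_nonneg s), ← map_smul, ← map_sub,
      ← map_sub]
    exact h1.trans_eq (by ring)
  exact hO.trans_isLittleO (Asymptotics.isLittleO_pow_id one_lt_two)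

/-- Reduction to scale one and centre zero: `T` is replaced by `φ ↦ T (rescale φ a r)`, and the
dilation from `r` to `t` has parameter `log r - log t`. -/
theorem hasDerivAt_rescale (T : Distrib n Y) (φ : TestFun n Y) (a : EuclideanSpace ℝ (Fin n))
    {r : ℝ} (hr : 0 < r) :
    HasDerivAt (fun t => T (rescale φ a t)) (-(r⁻¹ * T (rescale φ.euler a r))) r := by
  obtain ⟨F, hF⟩ := exists_distrib_rescale T a hr
  have h1 := hasDerivAt_rescale_exp_neg F φ
  have h2 : HasDerivAt (fun t => Real.log r - Real.log t) (-r⁻¹) r :=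
    (Real.hasDerivAt_log hr.ne').const_sub _
  have h3 : HasDerivAt (fun s : ℝ => F (rescale φ 0 (Real.exp (-s)))) (F φ.euler)
      (Real.log r - Real.log r) := by rwa [sub_self]
  have h4 := h3.comp r h2
  rw [hF] at h4
  refine (h4.congr_of_eventuallyEq ?_).congr_deriv (by ring)
  filter_upwards [lt_mem_nhds hr] with t ht
  simp only [Function.comp_apply]
  rw [hF, rescale_rescale_zero _ _ hr.ne' (Real.exp_ne_zero _), neg_sub, Real.exp_sub,
    Real.exp_log hr, Real.exp_log ht, div_mul_cancel₀ _ hr.ne']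

/-- The product of a test function with a coordinate function. -/
def TestFun.coordMul (j : Fin n) (φ : TestFun n Y) : TestFun n Y :=
  φ.mulFun (fun x => x j) (by fun_prop)

theorem TestFun.coordMul_apply (j : Fin n) (φ : TestFun n Y) (x : EuclideanSpace ℝ (Fin n)) :
    φ.coordMul j x = x j • φ x := rfl

theorem TestFun.support_coordMul_subset (j : Fin n) (φ : TestFun n Y) :
    Function.support (φ.coordMul j) ⊆ Function.support φ := fun x hx h =>
  hx (by rw [coordMul_apply, h, smul_zero])

theorem fderiv_rescale (φ : TestFun n Y) (a : EuclideanSpace ℝ (Fin n)) {r : ℝ} (hr : r ≠ 0)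
    (x v : EuclideanSpace ℝ (Fin n)) :
    fderiv ℝ (rescale φ a r) x v = r⁻¹ • fderiv ℝ φ (r⁻¹ • (x - a)) v := by
  have h1 : HasFDerivAt (fun x => r⁻¹ • (x - a))
      (r⁻¹ • ContinuousLinearMap.id ℝ (EuclideanSpace ℝ (Fin n))) x :=
    ((hasFDerivAt_id x).sub_const a).const_smul r⁻¹
  have h2 := (φ.contDiff.differentiable (by simp) (r⁻¹ • (x - a))).hasFDerivAt.comp x h1
  have h3 : (rescale φ a r : EuclideanSpace ℝ (Fin n) → Y) = φ ∘ fun x => r⁻¹ • (x - a) :=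
    funext (rescale_apply φ a hr)
  rw [h3, h2.fderiv]
  simp

/-- The divergence of the vector field `x φ(x)` is `n φ` plus the Euler operator applied to `φ`. -/
theorem sum_lineDeriv_rescale_coordMul (φ : TestFun n Y) (a : EuclideanSpace ℝ (Fin n)) {r : ℝ}
    (hr : r ≠ 0) :
    ∑ j, TestFun.lineDeriv (EuclideanSpace.single j 1) (rescale (φ.coordMul j) a r) =
      r⁻¹ • ((n : ℝ) • rescale φ a r + rescale φ.euler a r) := by
  ext x
  have h0 : (∑ j, TestFun.lineDeriv (EuclideanSpace.single j 1) (rescale (φ.coordMul j) a r) :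
      TestFun n Y) x =
      ∑ j, (TestFun.lineDeriv (EuclideanSpace.single j 1) (rescale (φ.coordMul j) a r)) x := by
    have := map_sum (AddMonoidHom.mk' (fun ψ : TestFun n Y => ψ x) fun _ _ => rfl)
      (fun j => TestFun.lineDeriv (EuclideanSpace.single j 1) (rescale (φ.coordMul j) a r))
      Finset.univ
    exact this
  rw [h0]
  simp only [_root_.smul_apply, _root_.add_apply, TestFun.lineDeriv_apply,
    fderiv_rescale _ _ hr, rescale_apply _ _ hr, ← Finset.smul_sum]
  congr 1
  set y := r⁻¹ • (x - a)
  have h1 : ∀ j, fderiv ℝ (φ.coordMul j) y (EuclideanSpace.single j 1) =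
      φ y + y j • fderiv ℝ φ y (EuclideanSpace.single j 1) := fun j => by
    have h2 : HasFDerivAt (fun x : EuclideanSpace ℝ (Fin n) => x j)
        (EuclideanSpace.proj j : EuclideanSpace ℝ (Fin n) →L[ℝ] ℝ) y :=
      (EuclideanSpace.proj j : EuclideanSpace ℝ (Fin n) →L[ℝ] ℝ).hasFDerivAt
    have h3 := h2.smul (φ.contDiff.differentiable (by simp) y).hasFDerivAt
    have h4 : HasFDerivAt (φ.coordMul j) _ y := h3
    rw [h4.fderiv]
    simp [add_comm]
  simp only [h1]
  rw [Finset.sum_add_distrib, TestFun.euler_apply]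
  congr 1
  · rw [Finset.sum_const, Finset.card_univ, Fintype.card_fin, Nat.cast_smul_eq_nsmul]
  · have h2 : ∑ j, y j • EuclideanSpace.single j (1 : ℝ) = y := by
      ext l
      simp [Finset.sum_apply, Pi.single_apply]
    conv_rhs => rw [← h2]
    rw [map_sum]
    simp only [map_smul]
    rw [h2]

/-- The factor `t^(-n)` contributes exactly the term `n φ` of the divergence, so that only
derivatives of `T` remain. -/
theorem hasDerivAt_inv_pow_mul_rescale (T : Distrib n Y) (φ : TestFun n Y)
    (a : EuclideanSpace ℝ (Fin n)) {r : ℝ} (hr : 0 < r) :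
    HasDerivAt (fun t => (t ^ n)⁻¹ * T (rescale φ a t)) ((r ^ n)⁻¹ *
      ∑ j, T.lineDeriv (EuclideanSpace.single j 1) (rescale (φ.coordMul j) a r)) r := by
  have h1 := ((hasDerivAt_pow n r).inv (pow_pos hr n).ne').mul (hasDerivAt_rescale T φ a hr)
  refine h1.congr_deriv ?_
  have h2 : ∑ j, T.lineDeriv (EuclideanSpace.single j 1) (rescale (φ.coordMul j) a r) =
      -(r⁻¹ * (n * T (rescale φ a r) + T (rescale φ.euler a r))) := by
    simp only [Distrib.lineDeriv_apply]
    rw [Finset.sum_neg_distrib, ← map_sum, sum_lineDeriv_rescale_coordMul φ a hr.ne', map_smul,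
      map_add, map_smul, smul_eq_mul, smul_eq_mul]
  rw [h2]
  rcases Nat.eq_zero_or_pos n with hn | hn
  · simp [hn]
  · have h3 : r ^ n = r ^ (n - 1) * r := by rw [← pow_succ, Nat.sub_add_cancel hn]
    have h4 : r ^ (n - 1) ≠ 0 := (pow_pos hr _).ne'
    simp only [Pi.inv_apply]
    rw [h3]
    field_simp
    ring

/-! ### From the derivatives back to the distribution. -/

/-- Bounds for a distribution from bounds for its radial derivative. -/
theorem abs_rescale_le_of_radial {R : Distrib n Y} {φ : TestFun n Y}
    {a : EuclideanSpace ℝ (Fin n)} {k : ℕ} {κ δ : ℝ}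
    (h0 : ∀ ε, 0 < ε → ∃ δ, 0 < δ ∧ ∀ r, 0 < r → r < δ → |R (rescale φ a r)| ≤ ε * r ^ n)
    (h : ∀ t, 0 < t → t < δ → |∑ j, R.lineDeriv (EuclideanSpace.single j 1)
      (rescale (φ.coordMul j) a t)| ≤ κ * t ^ (k + n)) {r : ℝ} (hr : 0 < r) (hrδ : r < δ) :
    |R (rescale φ a r)| ≤ κ * r ^ (k + 1 + n) := by
  have hκ : 0 ≤ κ := by
    have h1 := (abs_nonneg _).trans (h r hr hrδ)
    exact nonneg_of_mul_nonneg_left h1 (by positivity)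
  have hrn : 0 < r ^ n := by positivity
  have hmain : |(r ^ n)⁻¹ * R (rescale φ a r)| ≤ κ * r ^ (k + 1) := by
    refine le_of_forall_pos_le_add fun ε hε => ?_
    obtain ⟨δ', hδ', h1⟩ := h0 ε hε
    -- Mean value inequality on `[ρ, r]`: the initial value is at most `ε` by `h0`, and the slope is
    -- at most `κ r ^ k`.
    set ρ := min r δ' / 2 with hρ
    have hρ0 : 0 < ρ := by positivity
    have hρr : ρ < r := (half_lt_self (by positivity)).trans_le (min_le_left _ _)
    have hρδ : ρ < δ' := (half_lt_self (by positivity)).trans_le (min_le_right _ _)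
    have h2 := (convex_Icc ρ r).norm_image_sub_le_of_norm_hasDerivWithin_le
      (f := fun t => (t ^ n)⁻¹ * R (rescale φ a t)) (C := κ * r ^ k)
      (fun t ht => (hasDerivAt_inv_pow_mul_rescale R φ a
        (hρ0.trans_le ht.1)).hasDerivWithinAt) (fun t ht => by
        have ht0 := hρ0.trans_le ht.1
        have htn : 0 < t ^ n := by positivity
        rw [Real.norm_eq_abs, abs_mul, abs_of_pos (inv_pos.2 htn), inv_mul_le_iff₀ htn]
        calc _ ≤ κ * t ^ (k + n) := h t ht0 (ht.2.trans_lt hrδ)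
          _ = t ^ n * (κ * t ^ k) := by ring
          _ ≤ t ^ n * (κ * r ^ k) := by
            gcongr
            exact ht.2) (Set.left_mem_Icc.2 hρr.le) (Set.right_mem_Icc.2 hρr.le)
    have h3 : |(ρ ^ n)⁻¹ * R (rescale φ a ρ)| ≤ ε := by
      have hρn : 0 < ρ ^ n := by positivity
      rw [abs_mul, abs_of_pos (inv_pos.2 hρn), inv_mul_le_iff₀ hρn, mul_comm]
      exact h1 ρ hρ0 hρδ
    rw [Real.norm_eq_abs, Real.norm_eq_abs, abs_of_nonneg (sub_nonneg.2 hρr.le)] at h2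
    have h4 : κ * r ^ k * (r - ρ) ≤ κ * r ^ (k + 1) := by
      rw [pow_succ, ← mul_assoc]
      gcongr
      linarith
    have h5 := abs_sub_abs_le_abs_sub ((r ^ n)⁻¹ * R (rescale φ a r))
      ((ρ ^ n)⁻¹ * R (rescale φ a ρ))
    linarith
  rw [abs_mul, abs_of_pos (inv_pos.2 hrn), inv_mul_le_iff₀ hrn] at hmain
  exact hmain.trans_eq (by ring)

theorem exists_setIntegral_norm_sub_le {Z : Type*} [NormedAddCommGroup Z]
    {g : EuclideanSpace ℝ (Fin n) → Z} (hg : Continuous g) (a : EuclideanSpace ℝ (Fin n)) {ε : ℝ}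
    (hε : 0 < ε) : ∃ δ, 0 < δ ∧
      ∀ r, 0 < r → r < δ → ∫ x in Metric.closedBall a r, ‖g x - g a‖ ≤ ε * r ^ n := by
  set v₁ := volume.real (Metric.closedBall (0 : EuclideanSpace ℝ (Fin n)) 1) with hv₁
  have hv : 0 ≤ v₁ := measureReal_nonneg
  obtain ⟨δ, hδ, h⟩ := Metric.continuous_iff.1 hg a (ε / (v₁ + 1)) (by positivity)
  refine ⟨δ, hδ, fun r hr hrδ => (le_abs_self _).trans ?_⟩
  rw [← Real.norm_eq_abs]
  have h1 := norm_setIntegral_le_of_norm_le_const (μ := volume) (f := fun x => ‖g x - g a‖)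
    (s := Metric.closedBall a r) (C := ε / (v₁ + 1)) measure_closedBall_lt_top fun x hx => by
      rw [norm_norm, ← dist_eq_norm]
      exact (h x (lt_of_le_of_lt hx hrδ)).le
  refine h1.trans ?_
  rw [volume_real_closedBall a hr.le, ← hv₁]
  calc ε / (v₁ + 1) * (r ^ n * v₁) = ε * r ^ n * (v₁ / (v₁ + 1)) := by ring
    _ ≤ ε * r ^ n * 1 := by
      gcongr
      rw [div_le_one (by positivity)]
      linarith
    _ = _ := mul_one _

theorem exists_abs_ofFunction_rescale_le {k : ℤ}
    {P : EuclideanSpace ℝ (Fin n) → StrongDual ℝ Y} (hP : IsPolynomialOfDegreeLE k P)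
    {a : EuclideanSpace ℝ (Fin n)} (hPa : P a = 0) (φ : TestFun n Y) {ε : ℝ} (hε : 0 < ε) :
    ∃ δ, 0 < δ ∧ ∀ r, 0 < r → r < δ → |ofFunction P (rescale φ a r)| ≤ ε * r ^ n := by
  obtain ⟨δ, hδ, h⟩ := exists_abs_integral_rescale_sub_le
    (ContinuousLinearMap.id ℝ (StrongDual ℝ Y)) (fun z y => z.le_opNorm y)
    hP.continuous.locallyIntegrable
    (fun ε hε => exists_setIntegral_norm_sub_le hP.continuous a hε) φ hε
  refine ⟨δ, hδ, fun r hr hrδ => ?_⟩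
  have := h r hr hrδ
  simp only [hPa, ContinuousLinearMap.id_apply, _root_.zero_apply, integral_zero, sub_zero] at this
  rwa [ofFunction_apply hP]

theorem exists_abs_rescale_le (φ : TestFun n Y) (i : ℕ) : ∃ R M : ℝ, 0 < R ∧ 0 < M ∧
    ∀ (T : Distrib n Y) (a : EuclideanSpace ℝ (Fin n)) (r c : ℝ), 0 < r → BoundAt i T a (R * r) c →
      |T (rescale φ a r)| ≤ c * M := by
  obtain ⟨R, hR, hφ⟩ := φ.exists_support_subset
  obtain ⟨M, hM, hφM⟩ := φ.exists_derivLE i R hR.le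
  refine ⟨R, M, hR, hM, fun T a r c hr h => h _ _ (support_rescale hφ a hr) fun m hm x => ?_⟩
  rw [mul_pow, mul_assoc, norm_iteratedFDeriv_rescale _ _ hr]
  exact hφM m hm _

/-- Comparison of polynomial functions agreeing at `a`. -/
theorem exists_abs_sub_ofFunction_rescale_le {i k l : ℕ} {T : Distrib n Y} {N δ : ℝ}
    {a : EuclideanSpace ℝ (Fin n)} (hδ : 0 < δ) {P Q : EuclideanSpace ℝ (Fin n) → StrongDual ℝ Y}
    (hP : IsPolynomialOfDegreeLE (l : ℤ) P) (hQ : IsPolynomialOfDegreeLE (l : ℤ) Q)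
    (hPQ : Q a = P a)
    (hT : ∀ r, 0 < r → r < δ → BoundAt i (T - ofFunction P) a r (N * r ^ (k + 1 + n)))
    (φ : TestFun n Y) {ε : ℝ} (hε : 0 < ε) :
    ∃ δ, 0 < δ ∧ ∀ r, 0 < r → r < δ → |(T - ofFunction Q) (rescale φ a r)| ≤ ε * r ^ n := by
  obtain ⟨R, M, hR, hM, h1⟩ := exists_abs_rescale_le φ i
  obtain ⟨δ', hδ', h2⟩ := exists_abs_ofFunction_rescale_le (hP.sub hQ) (a := a) (by simp [hPQ]) φ
    (half_pos hε)
  set B := |N| * R ^ (k + 1 + n) * M with hB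
  have hB0 : 0 ≤ B := by positivity
  refine ⟨min (min (δ / R) δ') (min 1 (ε / (2 * (B + 1)))), by positivity, fun r hr hrδ => ?_⟩
  have hr1 := hrδ.trans_le ((min_le_left _ _).trans (min_le_left _ _))
  have hr2 := hrδ.trans_le ((min_le_left _ _).trans (min_le_right _ _))
  have hr3 := hrδ.trans_le ((min_le_right _ _).trans (min_le_left _ _))
  have hr4 := hrδ.trans_le ((min_le_right _ _).trans (min_le_right _ _))
  have h3 := h1 _ a r _ hr (hT (R * r) (by positivity) (by rwa [lt_div_iff₀ hR, mul_comm] at hr1))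
  have h4 := h2 r hr hr2
  rw [ofFunction_sub hP hQ] at h4
  have h5 : N * (R * r) ^ (k + 1 + n) * M ≤ ε / 2 * r ^ n := by
    calc N * (R * r) ^ (k + 1 + n) * M ≤ |N| * (R * r) ^ (k + 1 + n) * M := by
          gcongr
          exact le_abs_self N
      _ = B * (r ^ k * r) * r ^ n := by rw [hB]; ring
      _ ≤ (B + 1) * (1 * (ε / (2 * (B + 1)))) * r ^ n := by
          gcongr
          · linarith
          · exact pow_le_one₀ hr.le hr3.le
      _ = ε / 2 * r ^ n := by field_simp
  rw [_root_.sub_apply] at h3 ⊢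
  rw [abs_le] at *
  constructor <;> linarith [h3.1, h3.2, h4.1, h4.2]

/-- Summed against the coordinate multiples, the derivatives of `Q` enter only through the radial
derivative. They may thus be replaced by `W`, even where `W` is not the gradient of `Q`. -/
theorem sum_ofFunction_rescale_coordMul {k l : ℤ}
    {Q : EuclideanSpace ℝ (Fin n) → StrongDual ℝ Y}
    {W : Fin n → EuclideanSpace ℝ (Fin n) → StrongDual ℝ Y} {a : EuclideanSpace ℝ (Fin n)}
    (hQ : IsPolynomialOfDegreeLE l Q) (hW : ∀ j, IsPolynomialOfDegreeLE k (W j))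
    (h : ∀ x, fderiv ℝ Q x (x - a) = ∑ j, (x - a) j • W j x) (φ : TestFun n Y) {t : ℝ}
    (ht : t ≠ 0) :
    ∑ j, ofFunction (fun x => fderiv ℝ Q x (EuclideanSpace.single j 1))
      (rescale (φ.coordMul j) a t) = ∑ j, ofFunction (W j) (rescale (φ.coordMul j) a t) := by
  have hint : ∀ {P : EuclideanSpace ℝ (Fin n) → StrongDual ℝ Y}, Continuous P →
      ∀ φ : TestFun n Y, Integrable (fun x => P x (φ x)) volume := fun {P} hP φ =>
    (hP.clm_apply φ.continuous).integrable_of_hasCompactSupport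
      (φ.hasCompactSupport.mono fun x hx h => hx (by simp [h]))
  simp only [ofFunction_apply (hQ.fderiv_apply _), ofFunction_apply (hW _)]
  rw [← integral_finsetSum _ fun j _ => hint (hQ.fderiv_apply _).continuous _,
    ← integral_finsetSum _ fun j _ => hint (hW j).continuous _]
  congr 1 with x
  have h1 : ∀ j, rescale (φ.coordMul j) a t x = (t⁻¹ * (x - a) j) • rescale φ a t x := fun j => by
    rw [rescale_apply _ _ ht, rescale_apply _ _ ht, TestFun.coordMul_apply]
    simp
  simp only [h1, map_smul, smul_eq_mul, mul_assoc, ← Finset.mul_sum]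
  congr 1
  have h2 : ∑ j, (x - a) j • EuclideanSpace.single j (1 : ℝ) = x - a := by
    ext l
    simp [Finset.sum_apply, Pi.single_apply]
  have h3 : ∑ j, (x - a) j • fderiv ℝ Q x (EuclideanSpace.single j (1 : ℝ)) =
      ∑ j, (x - a) j • W j x := by
    rw [← h x]
    conv_rhs => rw [← h2]
    rw [map_sum]
    simp only [map_smul]
  have h4 := congrArg (fun L : StrongDual ℝ Y => L (rescale φ a t x)) h3
  simpa [_root_.sum_apply] using h4

/-- The common polynomial part of the passage from the derivatives to the distribution. -/
theorem UniformOrderAt.exists_primitive {i k : ℕ} {T : Distrib n Y} {N δ : ℝ}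
    {a : EuclideanSpace ℝ (Fin n)} (hδ : 0 < δ) (h : UniformOrderAt i T (k + 1) N δ a)
    {W : Fin n → EuclideanSpace ℝ (Fin n) → StrongDual ℝ Y}
    (hW : ∀ j, IsPolynomialOfDegreeLE (k : ℤ) (W j)) :
    ∃ Q : EuclideanSpace ℝ (Fin n) → StrongDual ℝ Y,
      IsPolynomialOfDegreeLE ((k + 1 : ℕ) : ℤ) Q ∧
      ∀ (φ : TestFun n Y) (κ δ : ℝ), (∀ t, 0 < t → t < δ → |∑ j,
        (T.lineDeriv (EuclideanSpace.single j 1) - ofFunction (W j)) (rescale (φ.coordMul j) a t)|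
          ≤ κ * t ^ (k + n)) →
        ∀ r, 0 < r → r < δ → |(T - ofFunction Q) (rescale φ a r)| ≤ κ * r ^ (k + 1 + n) := by
  obtain ⟨P, hP, hT⟩ := h
  -- The constant term `Q a = P a` is what makes `r^(-n) (T - Q)(φ_{a,r})` tend to zero, so the
  -- integration in `r` starts from zero.
  obtain ⟨Q, hQ, hQa, hQd⟩ := IsPolynomialOfDegreeLE.exists_radial_primitive hW a (P a)
  have hQ' : IsPolynomialOfDegreeLE ((k + 1 : ℕ) : ℤ) Q := by exact_mod_cast hQ
  refine ⟨Q, hQ', fun φ κ δ' hκ r hr hrδ => ?_⟩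
  refine abs_rescale_le_of_radial (fun ε hε => exists_abs_sub_ofFunction_rescale_le hδ
    (hP.mono (by push_cast; omega)) hQ' hQa hT φ hε) (fun t ht htδ => ?_) hr hrδ
  refine (le_of_eq ?_).trans (hκ t ht htδ)
  simp only [lineDeriv_sub_ofFunction hQ', _root_.sub_apply, Finset.sum_sub_distrib]
  rw [sum_ofFunction_rescale_coordMul hQ hW hQd φ ht.ne']

/-- The bound on `T` itself serves only to fix the constant term of its polynomial; the decay comes
from the derivatives. -/
theorem UniformOrderAt.ptDiffAt_succ {i k : ℕ} {T : Distrib n Y} {N δ : ℝ}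
    {a : EuclideanSpace ℝ (Fin n)} (hδ : 0 < δ) (h : UniformOrderAt i T (k + 1) N δ a)
    (hD : ∀ j, PtDiffAt (T.lineDeriv (EuclideanSpace.single j 1)) k a) :
    PtDiffAt T (k + 1 : ℕ) a := by
  choose W hW hWT using fun j => (hD j).exists_forall
  obtain ⟨Q, hQ, h1⟩ := h.exists_primitive hδ hW
  refine ptDiffAt_of_forall hQ fun φ ε hε => ?_
  choose δ' hδ' h2 using fun j => hWT j (φ.coordMul j) (ε / (n + 1)) (by positivity)
  obtain ⟨δ₀, hδ₀, h3⟩ : ∃ δ₀, 0 < δ₀ ∧ ∀ j, δ₀ ≤ δ' j := by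
    have : ∀ᶠ t in 𝓝[>] (0 : ℝ), ∀ j, t ≤ δ' j := eventually_all.2 fun j =>
      mem_nhdsWithin_of_mem_nhds (Iic_mem_nhds (hδ' j))
    obtain ⟨t, ht, ht0⟩ := (this.and self_mem_nhdsWithin).exists
    exact ⟨t, ht0, ht⟩
  refine ⟨δ₀, hδ₀, h1 φ ε δ₀ fun t ht htδ => ?_⟩
  refine (Finset.abs_sum_le_sum_abs _ _).trans ?_
  calc _ ≤ ∑ j : Fin n, ε / (n + 1) * t ^ (k + n) :=
        Finset.sum_le_sum fun j _ => h2 j t ht (htδ.trans_le (h3 j))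
    _ = ε * t ^ (k + n) * (n / (n + 1)) := by
        rw [Finset.sum_const, Finset.card_univ, Fintype.card_fin, nsmul_eq_mul]
        ring
    _ ≤ ε * t ^ (k + n) * 1 := by
        gcongr
        rw [div_le_one (by positivity)]
        linarith
    _ = _ := mul_one _

theorem exists_derivLE_coordMul (n i : ℕ) : ∃ C : ℝ, 0 < C ∧
    ∀ {Y : Type*} [NormedAddCommGroup Y] [NormedSpace ℝ Y] (φ : TestFun n Y) (M : ℝ) (j : Fin n),
      Function.support φ ⊆ Metric.closedBall 0 1 → DerivLE i 1 M φ →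
      DerivLE i 1 (C * M) (φ.coordMul j) := by
  -- The unbounded coordinate function is replaced by its product with a cutoff that equals one on
  -- the unit ball, where `φ` lives.
  let b : ContDiffBump (0 : EuclideanSpace ℝ (Fin n)) := ⟨1, 2, by norm_num, by norm_num⟩
  let g : TestFun n ℝ := TestFun.ofSupport b b.contDiff b.hasCompactSupport
  choose C hC h using fun j : Fin n => (g.coordMul j).exists_derivLE i 1 zero_le_one
  refine ⟨2 ^ i * (∑ j, C j + 1), mul_pos (by positivity) (add_pos_of_nonneg_of_pos
    (Finset.sum_nonneg fun j _ => (hC j).le) one_pos), ?_⟩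
  intro Y _ _ φ M j hφ hM
  have h1 : (φ.coordMul j : EuclideanSpace ℝ (Fin n) → Y) = fun x => g.coordMul j x • φ x := by
    ext x
    rw [TestFun.coordMul_apply, TestFun.coordMul_apply]
    by_cases hx : φ x = 0
    · simp [hx]
    · have : g x = 1 := b.one_of_mem_closedBall (hφ hx)
      simp [this]
  rw [h1]
  have h2 := DerivLE.smul (g.coordMul j).contDiff φ.contDiff zero_le_one (h j) hM
  have h3 : C j ≤ ∑ j, C j + 1 := (Finset.single_le_sum (fun l _ => (hC l).le)
    (Finset.mem_univ j)).trans (le_add_of_nonneg_right zero_le_one)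
  intro m hm x
  refine (h2 m hm x).trans ?_
  have hM0 := hM.nonneg
  rw [← mul_assoc]
  gcongr

theorem UniformOrderAt.strongOrderAt_succ {i i' k : ℕ} {T : Distrib n Y} {N δ : ℝ}
    {a : EuclideanSpace ℝ (Fin n)} (hδ : 0 < δ) (h : UniformOrderAt i T (k + 1) N δ a)
    (hD : ∀ j, StrongOrderAt i' (T.lineDeriv (EuclideanSpace.single j 1)) k a) :
    StrongOrderAt i' T (k + 1) a := by
  obtain ⟨C, hC, hcoord⟩ := exists_derivLE_coordMul n i'
  choose W hW hWT using hD
  obtain ⟨Q, hQ, h1⟩ := h.exists_primitive hδ hW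
  refine ⟨Q, hQ, fun ε hε => ?_⟩
  choose δ' hδ' h2 using fun j => hWT j (ε / ((n + 1) * C)) (by positivity)
  obtain ⟨δ₀, hδ₀, h3⟩ : ∃ δ₀, 0 < δ₀ ∧ ∀ j, δ₀ ≤ δ' j := by
    have : ∀ᶠ t in 𝓝[>] (0 : ℝ), ∀ j, t ≤ δ' j := eventually_all.2 fun j =>
      mem_nhdsWithin_of_mem_nhds (Iic_mem_nhds (hδ' j))
    obtain ⟨t, ht, ht0⟩ := (this.and self_mem_nhdsWithin).exists
    exact ⟨t, ht0, ht⟩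
  refine ⟨δ₀, hδ₀, fun r hr hrδ => (boundAt_iff hr).2 fun φ hφ hM => ?_⟩
  rw [tsupport_subset_closedBall_iff] at hφ
  rw [nu_unitBall_le_one_iff hφ] at hM
  refine (le_abs_self _).trans (h1 φ ε δ₀ (fun t ht htδ => ?_) r hr hrδ)
  refine (Finset.abs_sum_le_sum_abs _ _).trans ?_
  calc _ ≤ ∑ j : Fin n, ε / ((n + 1) * C) * t ^ (k + n) * (C * 1) :=
        Finset.sum_le_sum fun j _ => (h2 j t ht (htδ.trans_le (h3 j))).rescale ht
          ((φ.support_coordMul_subset j).trans hφ) (hcoord φ 1 j hφ hM)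
    _ = ε * t ^ (k + n) * (n / (n + 1)) := by
        rw [Finset.sum_const, Finset.card_univ, Fintype.card_fin, nsmul_eq_mul]
        field_simp
    _ ≤ ε * t ^ (k + n) * 1 := by
        gcongr
        rw [div_le_one (by positivity)]
        linarith
    _ = _ := mul_one _

/-! ### Recovering the lower order seminorm at density points. -/

theorem TestFun.sum_apply {ι : Type*} (s : Finset ι) (φ : ι → TestFun n Y)
    (x : EuclideanSpace ℝ (Fin n)) : (∑ j ∈ s, φ j) x = ∑ j ∈ s, φ j x :=
  map_sum (AddMonoidHom.mk' (fun ψ : TestFun n Y => ψ x) fun _ _ => rfl) φ s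

theorem IsPolynomialOfDegreeLE.comp_smul {Z : Type*} [NormedAddCommGroup Z] [NormedSpace ℝ Z]
    {k : ℤ} {P : EuclideanSpace ℝ (Fin n) → Z} (hP : IsPolynomialOfDegreeLE k P) (t : ℝ) :
    IsPolynomialOfDegreeLE k fun x => P (t • x) := by
  obtain ⟨p, hp⟩ := hP
  refine ⟨fun m => t ^ m • p m, fun x => (hp (t • x)).trans ?_⟩
  refine Finset.sum_congr rfl fun m _ => ?_
  have := (p m).map_smul_univ (fun _ => t) (fun _ => x)
  simpa using this

theorem IsPolynomialOfDegreeLE.apply_const {k : ℤ}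
    {P : EuclideanSpace ℝ (Fin n) → StrongDual ℝ Y} (hP : IsPolynomialOfDegreeLE k P) (y : Y) :
    IsPolynomialOfDegreeLE k fun x => P x y := by
  obtain ⟨p, hp⟩ := hP
  refine ⟨fun m => (ContinuousLinearMap.apply ℝ ℝ y).compContinuousMultilinearMap (p m),
    fun x => ?_⟩
  change P x y = _
  rw [hp, _root_.sum_apply]
  rfl

theorem integral_mul_rescale_zero (f : EuclideanSpace ℝ (Fin n) → ℝ) (φ : TestFun n ℝ) {t : ℝ}
    (ht : 0 < t) : ∫ x, f x * rescale φ 0 t x = t ^ n * ∫ x, f (t • x) * φ x := by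
  have h := Measure.integral_comp_inv_smul (μ := volume)
    (fun x : EuclideanSpace ℝ (Fin n) => f (t • x) * φ x) t
  simp only [smul_smul, mul_inv_cancel₀ ht.ne', one_smul, finrank_euclideanSpace, Fintype.card_fin,
    smul_eq_mul, abs_of_pos (pow_pos ht n)] at h
  rw [← h]
  simp [rescale_apply _ _ ht.ne']

theorem exists_polynomial_integral_smul {K : ℕ} {f : EuclideanSpace ℝ (Fin n) → ℝ}
    (hf : IsPolynomialOfDegreeLE (K : ℤ) f) (φ : TestFun n ℝ) :
    ∃ J : Polynomial ℝ, J.degree < (K + 1 : ℕ) ∧ ∀ t : ℝ, J.eval t = ∫ x, f (t • x) * φ x := by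
  obtain ⟨p, hp⟩ := hf
  have hK : ((K : ℤ) + 1).toNat = K + 1 := by omega
  refine ⟨∑ m ∈ Finset.range (K + 1), Polynomial.C (∫ x, p m (fun _ => x) * φ x) *
    Polynomial.X ^ m, ?_, fun t => ?_⟩
  · refine (Polynomial.degree_sum_le _ _).trans_lt ?_
    rw [Finset.sup_lt_iff (WithBot.bot_lt_coe _)]
    intro m hm
    refine (Polynomial.degree_C_mul_X_pow_le _ _).trans_lt ?_
    exact_mod_cast Finset.mem_range.1 hm
  · rw [Polynomial.eval_finsetSum]
    have h1 : ∀ x, f (t • x) * φ x =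
        ∑ m ∈ Finset.range (K + 1), t ^ m * (p m (fun _ => x) * φ x) := fun x => by
      rw [hp, hK, Finset.sum_mul]
      refine Finset.sum_congr rfl fun m _ => ?_
      have := (p m).map_smul_univ (fun _ => t) (fun _ => x)
      simp only [Finset.prod_const, Finset.card_univ, Fintype.card_fin, smul_eq_mul] at this
      rw [this, mul_assoc]
    simp only [h1]
    rw [integral_finsetSum]
    · refine Finset.sum_congr rfl fun m _ => ?_
      rw [integral_const_mul, Polynomial.eval_mul, Polynomial.eval_C, Polynomial.eval_pow,
        Polynomial.eval_X, mul_comm]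
    · intro m _
      have hc : Continuous fun x => p m fun _ : Fin m => x :=
        (p m).cont.comp (continuous_pi fun _ => continuous_id)
      exact ((hc.mul φ.continuous).integrable_of_hasCompactSupport
        φ.hasCompactSupport.mul_left).const_mul _

/-- Test functions reproducing the value at zero of polynomial functions. -/
theorem exists_reproducing (n K : ℕ) : ∃ χ : TestFun n ℝ,
    Function.support χ ⊆ Metric.closedBall 0 1 ∧
      ∀ f : EuclideanSpace ℝ (Fin n) → ℝ, IsPolynomialOfDegreeLE (K : ℤ) f →
        ∫ x, f x * χ x = f 0 := by
  -- For a polynomial `f` of degree at most `K`, the integral of `f(t x)` against the mollifier is a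
  -- polynomial in `t` of degree at most `K` with value `f 0` at `t = 0`. Lagrange extrapolation
  -- from the `K + 1` scales `v l ≤ 1` to zero gives the weights `c l`.
  let v : ℕ → ℝ := fun l => ((l : ℝ) + 1)⁻¹
  have hv : ∀ l, 0 < v l := fun l => by positivity
  have hv1 : ∀ l, v l ≤ 1 := fun l => inv_le_one_of_one_le₀ (by linarith [l.cast_nonneg (α := ℝ)])
  have hinj : Set.InjOn v (Finset.range (K + 1)) := fun l _ m _ h => by
    have := inv_injective h
    exact_mod_cast add_right_cancel this
  let c : ℕ → ℝ := fun l => (Lagrange.basis (Finset.range (K + 1)) v l).eval 0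
  refine ⟨∑ l ∈ Finset.range (K + 1), (c l * (v l ^ n)⁻¹) • rescale (mollifier n) 0 (v l), ?_, ?_⟩
  · intro x hx
    by_contra hcon
    refine hx ?_
    rw [TestFun.sum_apply]
    refine Finset.sum_eq_zero fun l _ => ?_
    have : rescale (mollifier n) 0 (v l) x = 0 := by
      by_contra h
      refine hcon (Metric.closedBall_subset_closedBall ?_ (support_rescale support_mollifier 0
        (hv l) h))
      simpa using hv1 l
    rw [_root_.smul_apply, this, smul_zero]
  · intro f hf
    obtain ⟨J, hJ, hJf⟩ := exists_polynomial_integral_smul hf (mollifier n)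
    have h1 : ∀ x, f x * (∑ l ∈ Finset.range (K + 1),
        (c l * (v l ^ n)⁻¹) • rescale (mollifier n) 0 (v l) : TestFun n ℝ) x =
        ∑ l ∈ Finset.range (K + 1),
          (c l * (v l ^ n)⁻¹) * (f x * rescale (mollifier n) 0 (v l) x) := fun x => by
      rw [TestFun.sum_apply, Finset.mul_sum]
      refine Finset.sum_congr rfl fun l _ => ?_
      rw [_root_.smul_apply, smul_eq_mul]
      ring
    simp only [h1]
    rw [integral_finsetSum]
    · have h2 : J.eval 0 = f 0 := by
        rw [hJf]
        simp only [zero_smul]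
        rw [integral_const_mul, integral_mollifier, mul_one]
      have h3 := congrArg (Polynomial.eval 0) (Lagrange.eq_interpolate hinj (by simpa using hJ))
      rw [h2, Lagrange.interpolate_apply, Polynomial.eval_finsetSum] at h3
      rw [h3]
      refine Finset.sum_congr rfl fun l _ => ?_
      rw [integral_const_mul, integral_mul_rescale_zero _ _ (hv l), ← hJf, Polynomial.eval_mul,
        Polynomial.eval_C]
      have : v l ^ n ≠ 0 := (pow_pos (hv l) n).ne'
      field_simp
      simp only [c]
      ring
    · intro l _
      exact ((hf.continuous.mul (rescale (mollifier n) 0 (v l)).continuous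
        ).integrable_of_hasCompactSupport
        (rescale (mollifier n) 0 (v l)).hasCompactSupport.mul_left).const_mul _

theorem derivLE_const (i : ℕ) {r : ℝ} (y : Y) :
    DerivLE i r ‖y‖ (fun _ : EuclideanSpace ℝ (Fin n) => y) := by
  intro m _ x
  rcases Nat.eq_zero_or_pos m with rfl | hm
  · simp
  · rw [iteratedFDeriv_const_of_ne hm.ne']
    simp

/-- Pointwise bounds for polynomial functions from bounds for the associated distributions. -/
theorem exists_norm_le_of_boundAt (n K j : ℕ) : ∃ C : ℝ, 0 < C ∧
    ∀ {Y : Type*} [NormedAddCommGroup Y] [NormedSpace ℝ Y]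
      (P : EuclideanSpace ℝ (Fin n) → StrongDual ℝ Y) (z : EuclideanSpace ℝ (Fin n)) (t c : ℝ),
      IsPolynomialOfDegreeLE (K : ℤ) P → 0 < t → 0 ≤ c → BoundAt j (ofFunction P) z t c →
      ‖P z‖ ≤ C * c * (t ^ n)⁻¹ := by
  obtain ⟨χ, hχ, hrep⟩ := exists_reproducing n K
  obtain ⟨M, hM, hχM⟩ := χ.exists_derivLE j 1 zero_le_one
  refine ⟨2 ^ j * M, by positivity, ?_⟩
  intro Y _ _ P z t c hP ht hc h
  refine ContinuousLinearMap.opNorm_le_bound _ (by positivity) fun y => ?_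
  -- Testing with the rescaled `χ ⊗ y` returns `t ^ n * P z y`. Hence a bound of any order `j`
  -- controls values of the polynomial.
  have h1 := h.rescale ht (φ := χ.tensor y) (M := 2 ^ j * (M * ‖y‖)) (fun x hx => hχ fun h0 =>
    hx (by rw [TestFun.tensor_apply, h0, zero_smul]))
    (DerivLE.smul χ.contDiff contDiff_const zero_le_one hχM (derivLE_const j y))
  have h2 : ofFunction P (rescale (χ.tensor y) z t) = t ^ n * P z y := by
    rw [ofFunction_apply hP, rescale_tensor _ _ _ ht.ne']
    have h3 : IsPolynomialOfDegreeLE (K : ℤ) fun x => P (z + t • x) y :=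
      ((hP.comp_add_left z).comp_smul t).apply_const y
    have h4 := hrep _ h3
    rw [smul_zero, add_zero] at h4
    have h5 := integral_mul_rescale_zero (fun x => P (z + x) y) χ ht
    rw [← h4, ← h5, ← integral_add_right_eq_self _ z]
    congr 1 with x
    rw [TestFun.tensor_apply, map_smul, rescale_apply _ _ ht.ne', rescale_apply _ _ ht.ne',
      add_sub_cancel_right, sub_zero, smul_eq_mul, mul_comm, add_comm x z]
  rw [h2, abs_mul, abs_of_pos (pow_pos ht n)] at h1
  rw [Real.norm_eq_abs]
  have htn : 0 < t ^ n := pow_pos ht n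
  calc |P z y| = t ^ n * |P z y| * (t ^ n)⁻¹ := by field_simp
    _ ≤ c * (2 ^ j * (M * ‖y‖)) * (t ^ n)⁻¹ := by gcongr
    _ = _ := by ring

/-- Bounds for `T` near density points from those of the local approximations by polynomials. -/
theorem exists_abs_le_of_uniformOrderAt (n i j k : ℕ) (hij : i ≤ j) : ∃ B₁ : ℝ, 0 ≤ B₁ ∧
    ∀ η : ℝ, 0 < η → η ≤ 1 / 2 → ∃ B₂ : ℝ, 0 ≤ B₂ ∧
    ∀ {Y : Type*} [NormedAddCommGroup Y] [NormedSpace ℝ Y] (T : Distrib n Y)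
      (N δ ε r : ℝ) (A : Set (EuclideanSpace ℝ (Fin n))) (a : EuclideanSpace ℝ (Fin n))
      (Q : EuclideanSpace ℝ (Fin n) → StrongDual ℝ Y),
      0 ≤ N → 0 ≤ ε → 0 < r → 5 * r < δ → IsPolynomialOfDegreeLE (k : ℤ) Q →
      (∀ b ∈ A, UniformOrderAt i T k N δ b) →
      (∀ x ∈ Metric.closedBall a (2 * r), ∃ b ∈ A, dist x b ≤ 2 * (η * r)) →
      BoundAt j (T - ofFunction Q) a (4 * r) (ε * r ^ (k + n)) →
      BoundAt i (T - ofFunction Q) a r ((N * B₁ * η ^ k + ε * B₂) * r ^ (k + n)) := by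
  obtain ⟨C₁, hC₁, hcut⟩ := exists_derivLE_cut n i
  obtain ⟨C₂, hC₂, hpoly⟩ := exists_norm_le_of_boundAt n k j
  set v₁ := volume.real (Metric.closedBall (0 : EuclideanSpace ℝ (Fin n)) 1) with hv₁
  have hv : 0 ≤ v₁ := measureReal_nonneg
  set V := 2 ^ n * v₁ with hV
  have hV0 : 0 ≤ V := by positivity
  refine ⟨V * (4 ^ (k + n + i) * C₁ + C₁ * V * C₂ * 5 ^ (k + n + i)), by positivity,
    fun η hη hη2 => ⟨V * (C₁ * V * C₂ * ((η ^ n)⁻¹ * (4 / η) ^ j)), by positivity, ?_⟩⟩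
  intro Y _ _ T N δ ε r A a Q hN hε hr hrδ hQ hA hnear hTQ ψ M hψ hM
  have hM0 := hM.nonneg
  set s := η * r with hs_def
  have hs : 0 < s := by positivity
  have hsr : 2 * s ≤ r := by nlinarith
  set κ := N * (4 ^ (k + n + i) * C₁ + C₁ * V * C₂ * 5 ^ (k + n + i)) * η ^ k +
    ε * (C₁ * V * C₂ * ((η ^ n)⁻¹ * (4 / η) ^ j)) with hκ
  have hκ0 : 0 ≤ κ := by positivity
  -- Pieces of size `s = η r` meeting the support of `ψ` have all their points in `B(a, 2r)`, so a
  -- constant weight on that ball suffices.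
  have key := abs_le_integral_of_cut (R := T - ofFunction Q) (ψ := ψ) hs
    (w := (Metric.closedBall a (2 * r)).indicator fun _ => κ * r ^ k * M)
    ((integrable_indicator_iff measurableSet_closedBall).2
      (integrableOn_const measure_closedBall_lt_top.ne))
    (fun x => Set.indicator_nonneg (fun _ _ => by positivity) x) ?_
  · refine key.trans_eq ?_
    rw [integral_indicator measurableSet_closedBall, setIntegral_const,
      volume_real_closedBall a (by positivity), smul_eq_mul, ← hv₁, mul_pow, pow_add, hκ, hV]
    ring
  intro S hS x₀ hx₀ hSx₀
  have hsup : Function.support (cut s S hS ψ) ⊆ Metric.closedBall x₀ (2 * s) := fun x hx => by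
    have := support_moll_subset hs hSx₀ (support_cut_subset hS ψ hx).1
    rwa [← two_mul] at this
  by_cases hx₀a : x₀ ∈ Metric.closedBall a (2 * r)
  swap
  · have h0 : cut s S hS ψ = 0 := by
      ext x
      by_contra hx
      refine hx₀a ?_
      have h1 := Metric.mem_closedBall.1 (hsup hx)
      have h2 := Metric.mem_closedBall.1 (hψ (support_cut_subset hS ψ hx).2)
      rw [Metric.mem_closedBall]
      rw [dist_comm] at h1
      linarith [dist_triangle x₀ x a]
    rw [h0, map_zero, abs_zero, Set.indicator_of_notMem hx₀a, mul_zero]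
  rw [Set.indicator_of_mem hx₀a]
  obtain ⟨b, hb, hxb⟩ := hnear x₀ hx₀a
  obtain ⟨P, hP, hTP⟩ := hA b hb
  have hP' : IsPolynomialOfDegreeLE (k : ℤ) P := hP.mono (by omega)
  set m := volume.real S with hm
  have hm0 : 0 ≤ m := measureReal_nonneg
  have hder := hcut ψ s x₀ M S hS hs hSx₀ fun y _ l hl =>
    (hM.mono hs.le (by linarith)) l hl y
  rw [← hm] at hder
  have hsn : 0 < s ^ n := by positivity
  -- The piece lies in `B(x₀, 2s)` and `b` is within `2s` of `x₀`; hence the ball `B(b, 4s)`. The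
  -- bound of order `i` is used at the small scale, where it gains `s ^ k`.
  have h1 : |(T - ofFunction P) (cut s S hS ψ)| ≤
      N * (4 ^ (k + n + i) * C₁) * s ^ k * m * M := by
    refine (hTP (4 * s) (by positivity) (by linarith) _ _ (hsup.trans
      (Metric.closedBall_subset_closedBall' (by linarith)))
      (hder.scale (c := 4) (by norm_num))).trans_eq ?_
    rw [mul_pow, pow_add s, pow_add 4 (k + n)]
    field_simp
  -- The polynomials are compared on `B(z, s)`, which is contained both in `B(b, 5s)` and in `B(a,
  -- 4r)`. Passing from the scale `s` to `4r` costs `(4/η) ^ j`, which is harmless because it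
  -- multiplies `ε`.
  have h2 : ∀ z ∈ Metric.closedBall x₀ (2 * s), ‖Q z - P z‖ ≤
      C₂ * (N * 5 ^ (k + n + i) * s ^ k + ε * r ^ k * ((η ^ n)⁻¹ * (4 / η) ^ j)) := by
    intro z hz
    rw [Metric.mem_closedBall] at hz
    rw [Metric.mem_closedBall] at hx₀a
    refine (hpoly (fun x => Q x - P x) z s (N * (5 * s) ^ (k + n) * 5 ^ i +
      ε * r ^ (k + n) * (4 / η) ^ j) (hQ.sub hP') hs (by positivity) ?_).trans_eq ?_
    · intro χ M' hχ hM'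
      have e1 := hTP (5 * s) (by positivity) (by linarith) χ _ (hχ.trans
        (Metric.closedBall_subset_closedBall' (by linarith [dist_triangle z x₀ b])))
        ((hM'.of_le hij).scale (c := 5) (by norm_num))
      have e2 := hTQ χ ((4 / η) ^ j * M') (hχ.trans
        (Metric.closedBall_subset_closedBall' (by linarith [dist_triangle z x₀ a])))
        (by
          have := hM'.scale (c := 4 / η) (by rw [le_div_iff₀ hη]; linarith)
          rwa [hs_def, ← mul_assoc, div_mul_cancel₀ _ hη.ne'] at this)
      rw [ofFunction_sub hQ hP']
      rw [_root_.sub_apply] at e1 e2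
      rw [abs_le] at *
      constructor <;> nlinarith [e1.1, e1.2, e2.1, e2.2]
    · rw [hs_def]
      simp only [mul_pow, pow_add]
      field_simp
  have h3 : |ofFunction (fun x => Q x - P x) (cut s S hS ψ)| ≤
      C₂ * (N * 5 ^ (k + n + i) * s ^ k + ε * r ^ k * ((η ^ n)⁻¹ * (4 / η) ^ j)) *
        (C₁ * V * m * M) := by
    have e1 := integral_norm_le_of_support (by positivity) hsup hder.norm_le
    rw [ofFunction_apply (hQ.sub hP'), ← Real.norm_eq_abs]
    have e2 : C₁ * (s ^ n)⁻¹ * m * M * ((2 * s) ^ n * v₁) = C₁ * V * m * M := by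
      rw [mul_pow 2 s, hV]
      field_simp
    rw [← hv₁, e2] at e1
    refine (norm_integral_le_of_norm_le ((cut s S hS ψ).integrable.norm.const_mul (C₂ *
      (N * 5 ^ (k + n + i) * s ^ k + ε * r ^ k * ((η ^ n)⁻¹ * (4 / η) ^ j))))
      (Eventually.of_forall fun x => ?_)).trans ?_
    · by_cases hx : cut s S hS ψ x = 0
      · simp [hx]
      · exact (Q x - P x).le_of_opNorm_le (h2 x (hsup hx)) _
    · rw [integral_const_mul]
      gcongr
  have h4 : (T - ofFunction Q) (cut s S hS ψ) = (T - ofFunction P) (cut s S hS ψ) -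
      ofFunction (fun x => Q x - P x) (cut s S hS ψ) := by
    rw [ofFunction_sub hQ hP', _root_.sub_apply, _root_.sub_apply]
    ring
  rw [h4]
  refine (abs_sub _ _).trans ((add_le_add h1 h3).trans_eq ?_)
  rw [hκ, hs_def, mul_pow]
  ring

/-- A ball `B(x, ηr)` missing `closure A` would lie in `B(a, 3r) \ closure A`, whose volume is at
most half of that of the ball. -/
theorem exists_dist_le_of_measure_diff_le {A : Set (EuclideanSpace ℝ (Fin n))}
    {a : EuclideanSpace ℝ (Fin n)} (h : ∀ ε, 0 < ε → ∃ δ, 0 < δ ∧ ∀ r, 0 < r → r < δ →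
      volume.real (Metric.closedBall a r \ closure A) ≤ ε * r ^ n) {η : ℝ} (hη : 0 < η)
    (hη1 : η ≤ 1) : ∃ δ, 0 < δ ∧ ∀ r, 0 < r → r < δ → ∀ x ∈ Metric.closedBall a (2 * r),
      ∃ b ∈ A, dist x b ≤ 2 * (η * r) := by
  set v₁ := volume.real (Metric.closedBall (0 : EuclideanSpace ℝ (Fin n)) 1) with hv₁
  have hv : 0 < v₁ := ENNReal.toReal_pos (Metric.measure_closedBall_pos _ _ one_pos).ne'
      measure_closedBall_lt_top.ne
  obtain ⟨δ, hδ, h1⟩ := h ((η / 3) ^ n * v₁ / 2) (by positivity)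
  refine ⟨δ / 3, by positivity, fun r hr hrδ x hx => ?_⟩
  have hs : 0 < η * r := by positivity
  obtain ⟨y, hyx, hyA⟩ : ∃ y ∈ Metric.closedBall x (η * r), y ∈ closure A := by
    by_contra! hcon
    have h2 : Metric.closedBall x (η * r) ⊆ Metric.closedBall a (3 * r) \ closure A := fun y hy =>
      ⟨Metric.closedBall_subset_closedBall' (by
        rw [Metric.mem_closedBall] at hx
        nlinarith) hy, hcon y hy⟩
    have h3 := (measureReal_mono h2 (measure_ne_top_of_subset Set.sdiff_subset
      measure_closedBall_lt_top.ne)).trans (h1 (3 * r) (by positivity) (by linarith))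
    rw [volume_real_closedBall x hs.le, ← hv₁] at h3
    have h4 : (η / 3) ^ n * v₁ / 2 * (3 * r) ^ n = (η * r) ^ n * v₁ / 2 := by
      rw [div_pow, mul_pow, mul_pow]
      field_simp
    rw [h4] at h3
    have : 0 < (η * r) ^ n * v₁ := by positivity
    linarith
  obtain ⟨b, hb, hyb⟩ := Metric.mem_closure_iff.1 hyA _ hs
  refine ⟨b, hb, ?_⟩
  rw [Metric.mem_closedBall, dist_comm] at hyx
  linarith [dist_triangle x y b]

/-- Strong differentiability of high order seminorms improves at density points. -/
theorem StrongOrderAt.of_density {i j k : ℕ} (hij : i ≤ j) (hk : k ≠ 0) {T : Distrib n Y}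
    {N δ : ℝ} {A : Set (EuclideanSpace ℝ (Fin n))} {a : EuclideanSpace ℝ (Fin n)} (hN : 0 ≤ N)
    (hδ : 0 < δ) (hA : ∀ b ∈ A, UniformOrderAt i T k N δ b)
    (hdens : ∀ ε, 0 < ε → ∃ δ, 0 < δ ∧ ∀ r, 0 < r → r < δ →
      volume.real (Metric.closedBall a r \ closure A) ≤ ε * r ^ n)
    (hS : StrongOrderAt j T k a) : StrongOrderAt i T k a := by
  obtain ⟨B₁, hB₁, hB⟩ := exists_abs_le_of_uniformOrderAt n i j k hij
  obtain ⟨Q, hQ, hTQ⟩ := hS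
  refine ⟨Q, hQ, fun ε hε => ?_⟩
  -- This choice needs `k ≠ 0`. As `B₂` depends on `η`, the accuracy required of the order `j` bound
  -- is fixed only afterwards.
  obtain ⟨η, hη, hη2, hηB⟩ : ∃ η : ℝ, 0 < η ∧ η ≤ 1 / 2 ∧ N * B₁ * η ^ k ≤ ε / 2 := by
    have hNB : 0 ≤ N * B₁ := by positivity
    refine ⟨min (1 / 2) (ε / (2 * (N * B₁ + 1))), by positivity, min_le_left _ _, ?_⟩
    set η := min (1 / 2) (ε / (2 * (N * B₁ + 1)))
    have h0 : 0 ≤ η := by positivity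
    have h1 : η ≤ 1 := (min_le_left _ _).trans (by norm_num)
    calc N * B₁ * η ^ k ≤ (N * B₁ + 1) * (ε / (2 * (N * B₁ + 1))) := by
          gcongr
          · linarith
          · exact (pow_le_of_le_one h0 h1 hk).trans (min_le_right _ _)
      _ = ε / 2 := by field_simp
  obtain ⟨B₂, hB₂, h⟩ := hB η hη hη2
  obtain ⟨δ₁, hδ₁, hnear⟩ := exists_dist_le_of_measure_diff_le hdens hη (hη2.trans (by norm_num))
  obtain ⟨δ₂, hδ₂, h2⟩ := hTQ (ε / (2 * (B₂ + 1) * 4 ^ (k + n))) (by positivity)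
  refine ⟨min (δ / 5) (min δ₁ (δ₂ / 4)), by positivity, fun r hr hrδ => ?_⟩
  have hr1 := hrδ.trans_le (min_le_left _ _)
  have hr2 := hrδ.trans_le ((min_le_right _ _).trans (min_le_left _ _))
  have hr3 := hrδ.trans_le ((min_le_right _ _).trans (min_le_right _ _))
  have h3 := h2 (4 * r) (by positivity) (by linarith)
  have h4 : ε / (2 * (B₂ + 1) * 4 ^ (k + n)) * (4 * r) ^ (k + n) =
      ε / (2 * (B₂ + 1)) * r ^ (k + n) := by
    rw [mul_pow]
    field_simp
  rw [h4] at h3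
  refine (h T N δ (ε / (2 * (B₂ + 1))) r A a Q hN (by positivity) hr (by linarith) hQ hA
    (hnear r hr hr2) h3).mono ?_
  gcongr
  have h5 : ε / (2 * (B₂ + 1)) * B₂ ≤ ε / 2 := by
    rw [div_mul_eq_mul_div, div_le_div_iff₀ (by positivity) (by positivity)]
    nlinarith
  linarith

/-! ### Countable decomposition and induction on the order. -/

/-- The points where the bounds hold with constants controlled by `m`. -/
def uniformSet (i : ℕ) (T : Distrib n Y) (k m : ℕ) : Set (EuclideanSpace ℝ (Fin n)) :=
  {a | a ∈ Metric.closedBall 0 (m : ℝ) ∧ UniformOrderAt i T k m ((m : ℝ) + 1)⁻¹ a}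

theorem UniformOrderAt.exists_mem_uniformSet {i k : ℕ} {T : Distrib n Y} {N δ : ℝ}
    {a : EuclideanSpace ℝ (Fin n)} (hδ : 0 < δ) (h : UniformOrderAt i T k N δ a) :
    ∃ m, a ∈ uniformSet i T k m := by
  obtain ⟨m, hm⟩ := exists_nat_ge (max (max N ‖a‖) δ⁻¹)
  have h1 : N ≤ m := ((le_max_left _ _).trans (le_max_left _ _)).trans hm
  have h2 : ‖a‖ ≤ m := ((le_max_right _ _).trans (le_max_left _ _)).trans hm
  have h3 : δ⁻¹ ≤ m := (le_max_right _ _).trans hm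
  refine ⟨m, by simpa using h2, h.mono h1 ?_⟩
  exact inv_le_of_inv_le₀ hδ (by linarith)

theorem uniformBoundOn_uniformSet (i : ℕ) (T : Distrib n Y) (m : ℕ) :
    UniformBoundOn i T m ((m : ℝ) + 1)⁻¹ (uniformSet i T 0 m) := by
  rintro a ⟨-, P, hP, h⟩ r hr hrδ
  -- For `k = 0` the degree bound is `-1`, so the sum defining `P` is empty.
  have hP0 : P = 0 := by
    obtain ⟨p, hp⟩ := hP
    ext x : 1
    simp [hp]
  have h0 : ofFunction P = 0 := by
    ext φ
    rw [ofFunction_apply hP, hP0]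
    simp
  have := h r hr hrδ
  rwa [h0, sub_zero, zero_add] at this

/-- Almost everywhere differentiability of order `k` where bounds of order `k` hold. -/
theorem ae_ptDiffAt_and_strongOrderAt [SeparableSpace Y] (k : ℕ) (T : Distrib n Y) (i : ℕ) :
    ∀ᵐ a ∂(volume : Measure (EuclideanSpace ℝ (Fin n))),
      (∃ N δ : ℝ, 0 < δ ∧ UniformOrderAt i T k N δ a) → PtDiffAt T k a ∧
        (SeparableSpace (StrongDual ℝ Y) → StrongOrderAt i T k a) := by
  induction k generalizing T i with
  | zero =>
    filter_upwards [ae_all_iff.2 fun m : ℕ => ae_strongOrderAt_zero (Nat.cast_nonneg m)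
      (by positivity) (uniformBoundOn_uniformSet i T m) fun a ha => ha.1] with a ha
    rintro ⟨N, δ, hδ, h⟩
    obtain ⟨m, hm⟩ := h.exists_mem_uniformSet hδ
    exact ha m hm
  | succ k ih =>
    -- The induction hypothesis is applied to the partial derivatives with order `i + 1`;
    -- `of_density` then returns from `i + 1` to `i`.
    filter_upwards [ae_all_iff.2 fun j : Fin n =>
        ih (T.lineDeriv (EuclideanSpace.single j 1)) (i + 1),
      ae_all_iff.2 fun m : ℕ => ae_measure_diff_le
        (isClosed_closure (s := uniformSet i T (k + 1) m)).measurableSet] with a h1 h2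
    rintro ⟨N, δ, hδ, h⟩
    have h3 : ∀ j, _ := fun j => h1 j ⟨N, δ, hδ, h.lineDeriv (by simp)⟩
    refine ⟨h.ptDiffAt_succ hδ fun j => (h3 j).1, fun hsep => ?_⟩
    obtain ⟨m, hm⟩ := h.exists_mem_uniformSet hδ
    exact (h.strongOrderAt_succ hδ fun j => (h3 j).2 hsep).of_density (Nat.le_succ i)
      (Nat.succ_ne_zero k) (Nat.cast_nonneg m) (by positivity) (fun b hb => hb.2)
      (h2 m (subset_closure hm))

end PointwiseDiff

end

theorem corollary4p16 {n : ℕ} (hn : 0 < n) {Y : Type*} [NormedAddCommGroup Y] [NormedSpace ℝ Y]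
    [CompleteSpace Y] [SeparableSpace Y] (T : PointwiseDiff.Distrib n Y) (k : ℕ) :
    (∀ᵐ a ∂(volume : Measure (EuclideanSpace ℝ (Fin n))),
      PointwiseDiff.HolderPtDiffAt T ((k : ℤ) - 1) 1 a → PointwiseDiff.PtDiffAt T k a) ∧
    ∀ i : ℕ, ∀ᵐ a ∂(volume : Measure (EuclideanSpace ℝ (Fin n))),
      PointwiseDiff.SeminormHolderPtDiffAt
          (PointwiseDiff.nu (PointwiseDiff.unitBall n) i) T ((k : ℤ) - 1) 1 a →
        PointwiseDiff.PtDiffAt T k a ∧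
        (SeparableSpace (StrongDual ℝ Y) →
          PointwiseDiff.SeminormPtDiffAt
            (PointwiseDiff.nu (PointwiseDiff.unitBall n) i) T k a) := by
  refine ⟨?_, fun i => ?_⟩
  -- The order supplied by uniform boundedness depends on the point, so the exceptional null sets of
  -- all orders are united.
  · filter_upwards [ae_all_iff.2 fun i => PointwiseDiff.ae_ptDiffAt_and_strongOrderAt k T i]
      with a ha h
    obtain ⟨i, N, δ, hδ, hT⟩ := PointwiseDiff.UniformOrderAt.of_holderPtDiffAt h
    exact (ha i ⟨N, δ, hδ, hT⟩).1
  · filter_upwards [PointwiseDiff.ae_ptDiffAt_and_strongOrderAt k T i] with a ha h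
    obtain ⟨h1, h2⟩ := ha (PointwiseDiff.UniformOrderAt.of_seminormHolderPtDiffAt h)
    exact ⟨h1, fun hsep => (h2 hsep).seminormPtDiffAt⟩
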